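/- **Theorem.** An instance $I=(G,w)$ of \textsc{MinPAC} (Min-Power Asymmetric Connectivity) consists of a strongly connected finite directed graph $G$ (nonempty, without loops) and a weight function $w\colon A(G)\to\mathbb N=\{0,1,2,\dots\}$. A solution is a strongly connected spanning subgraph $H$ of $G$; its cost is $\sum_{v\in V(G)}\max_{vu\in A(H)}w(vu)$ (an empty maximum being $0$), and $\mathrm{opt}(I)$ is the minimum cost of a solution. The feedback edge number of $G$ is the minimum number of edges whose removal turns the underlying undirected graph of $G$ into a forest. There is an algorithm that, given any instance $I=(G,w)$ of \textsc{MinPAC} whose feedback edge number $g$ satisfies $g\ge 2$, computes in linear time, that is, in $O(n+m)$ time for $n=|V(G)|$ and $m=|A(G)|$, an instance $I'=(G',w')$ of \textsc{MinPAC} and a number $d\in\mathbb N$ such that $G'$ has at most $20g-20$ vertices and at most $42g-42$ arcs, and $$\mathrm{opt}(I)=\mathrm{opt}(I')+d.$$ Here the algorithm runs on a word random access machine with words of $O(\log(n+m+\max w))$ bits, on which addition, subtraction, halving, comparison and memory access take unit time; instances are given as lists of weighted arcs in arbitrary order. -/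

import Mathlib

/-! ## The problem MinPAC -/

/-- A digraph is strongly connected if every vertex can be reached from every vertex. -/
def IsStronglyConnected {V : Type*} (G : Digraph V) : Prop :=
  ∀ u v : V, Relation.ReflTransGen G.Adj u v

/-- An instance of Min-Power Asymmetric Connectivity: a strongly connected loopless digraph on a
nonempty vertex set, with natural-number weights on its arcs. Only the values of `weight` on arcs
are ever used. -/
structure MinPAC (V : Type*) where
  nonempty : Nonempty V
  graph : Digraph V
  loopless : ∀ v, ¬ graph.Adj v v
  strong : IsStronglyConnected graph
  weight : V → V → ℕ

namespace MinPAC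

variable {V : Type*}

/-- `H` is (the arc set of) a strongly connected spanning subgraph. -/
def IsSolution (I : MinPAC V) (H : Digraph V) : Prop :=
  (∀ u v, H.Adj u v → I.graph.Adj u v) ∧ IsStronglyConnected H

open Classical in
/-- The cost `∑ v, max {w(vu) : vu ∈ A(H)}` of a subgraph `H`; a vertex without outgoing arcs
(possible in a solution only if it is the only vertex) costs `0`. -/
noncomputable def cost [Fintype V] (I : MinPAC V) (H : Digraph V) : ℕ :=
  ∑ v, (Finset.univ.filter fun u => H.Adj v u).sup fun u => I.weight v u

/-- The minimum cost of a solution. -/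
noncomputable def opt [Fintype V] (I : MinPAC V) : ℕ :=
  sInf {k | ∃ H, I.IsSolution H ∧ I.cost H = k}

/-- The minimum in the definition of `opt` is attained. -/
theorem opt_isLeast [Fintype V] (I : MinPAC V) :
    IsLeast {k | ∃ H, I.IsSolution H ∧ I.cost H = k} I.opt :=
  ⟨Nat.sInf_mem ⟨_, I.graph, ⟨fun _ _ h => h, I.strong⟩, rfl⟩, fun _ hk => Nat.sInf_le hk⟩

open Classical in
/-- The set of arcs. -/
noncomputable def arcs [Fintype V] (I : MinPAC V) : Finset (V × V) :=
  Finset.univ.filter fun a => I.graph.Adj a.1 a.2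

/-- The largest arc weight. -/
noncomputable def maxWeight [Fintype V] (I : MinPAC V) : ℕ :=
  I.arcs.sup fun a => I.weight a.1 a.2

end MinPAC

/-- The feedback edge number of an undirected graph: the minimum number of edges whose removal
leaves a forest. -/
noncomputable def SimpleGraph.feedbackEdgeNumber {V : Type*} (G : SimpleGraph V) : ℕ :=
  sInf {k | ∃ F : Finset (Sym2 V), (F : Set (Sym2 V)) ⊆ G.edgeSet ∧ F.card = k ∧
    (G.deleteEdges (F : Set (Sym2 V))).IsAcyclic}

/-- The feedback edge number of an instance is that of the underlying undirected graph, in which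
`u ≠ v` are adjacent if at least one of `uv`, `vu` is an arc. -/
noncomputable def MinPAC.feedbackEdgeNumber {V : Type*} (I : MinPAC V) : ℕ :=
  I.graph.toSimpleGraphInclusive.feedbackEdgeNumber

/-! ## Word random access machines

The machine has registers and arrays of natural numbers; a program mentions finitely many of them.
Programs are structured (sequence, branching, loops), and every elementary instruction and every
evaluation of a branching or loop condition takes one unit of time. -/

/-- Programs. -/
inductive RAM.Prog : Type
  /-- do nothing -/
  | skip
  /-- `reg x := k` -/
  | const (x k : ℕ)
  /-- `reg x := reg y` -/
  | move (x y : ℕ)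
  /-- `reg x := reg y + reg z` -/
  | add (x y z : ℕ)
  /-- `reg x := max (reg y - reg z) 0` -/
  | sub (x y z : ℕ)
  /-- `reg x := ⌊reg y / 2⌋` -/
  | half (x y : ℕ)
  /-- `reg x := a[reg i]`, where `a` is the number of an array -/
  | load (x a i : ℕ)
  /-- `a[reg i] := reg x`, where `a` is the number of an array -/
  | store (a i x : ℕ)
  /-- `p; q` -/
  | seq (p q : RAM.Prog)
  /-- `if reg x ≤ reg y then p else q` -/
  | ifLe (x y : ℕ) (p q : RAM.Prog)
  /-- `while reg x < reg y do p` -/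
  | whileLt (x y : ℕ) (p : RAM.Prog)

/-- Memory contents: `reg x` is register `x`, and `arr a i` is entry `i` of array `a`. -/
@[ext] structure RAM.State where
  reg : ℕ → ℕ
  arr : ℕ → ℕ → ℕ

/-- Assignment to a register. -/
def RAM.State.setReg (s : RAM.State) (x v : ℕ) : RAM.State :=
  { s with reg := Function.update s.reg x v }

/-- Assignment to an array entry. -/
def RAM.State.setArr (s : RAM.State) (a i v : ℕ) : RAM.State :=
  { s with arr := Function.update s.arr a (Function.update (s.arr a) i v) }

/-- `RAM.Exec B p s t s'`: on a machine whose memory words hold the numbers `0, …, B`, the program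
`p` started in `s` halts in `s'` after exactly `t` time units. An instruction whose result exceeds
`B` has no execution; only `const` and `add` can produce numbers larger than those already
stored. -/
inductive RAM.Exec (B : ℕ) : RAM.Prog → RAM.State → ℕ → RAM.State → Prop
  | skip (s : RAM.State) : RAM.Exec B .skip s 1 s
  | const (s : RAM.State) (x k : ℕ) (h : k ≤ B) : RAM.Exec B (.const x k) s 1 (s.setReg x k)
  | move (s : RAM.State) (x y : ℕ) : RAM.Exec B (.move x y) s 1 (s.setReg x (s.reg y))
  | add (s : RAM.State) (x y z : ℕ) (h : s.reg y + s.reg z ≤ B) :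
      RAM.Exec B (.add x y z) s 1 (s.setReg x (s.reg y + s.reg z))
  | sub (s : RAM.State) (x y z : ℕ) :
      RAM.Exec B (.sub x y z) s 1 (s.setReg x (s.reg y - s.reg z))
  | half (s : RAM.State) (x y : ℕ) : RAM.Exec B (.half x y) s 1 (s.setReg x (s.reg y / 2))
  | load (s : RAM.State) (x a i : ℕ) :
      RAM.Exec B (.load x a i) s 1 (s.setReg x (s.arr a (s.reg i)))
  | store (s : RAM.State) (a i x : ℕ) :
      RAM.Exec B (.store a i x) s 1 (s.setArr a (s.reg i) (s.reg x))
  | seq {p q : RAM.Prog} {s s' s'' : RAM.State} {t t' : ℕ} :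
      RAM.Exec B p s t s' → RAM.Exec B q s' t' s'' → RAM.Exec B (.seq p q) s (t + t') s''
  | ifLe_true {x y : ℕ} {p q : RAM.Prog} {s s' : RAM.State} {t : ℕ} (h : s.reg x ≤ s.reg y) :
      RAM.Exec B p s t s' → RAM.Exec B (.ifLe x y p q) s (t + 1) s'
  | ifLe_false {x y : ℕ} {p q : RAM.Prog} {s s' : RAM.State} {t : ℕ} (h : s.reg y < s.reg x) :
      RAM.Exec B q s t s' → RAM.Exec B (.ifLe x y p q) s (t + 1) s'
  | while_done {x y : ℕ} {p : RAM.Prog} {s : RAM.State} (h : s.reg y ≤ s.reg x) :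
      RAM.Exec B (.whileLt x y p) s 1 s
  | while_step {x y : ℕ} {p : RAM.Prog} {s s' s'' : RAM.State} {t t' : ℕ}
      (h : s.reg x < s.reg y) :
      RAM.Exec B p s t s' → RAM.Exec B (.whileLt x y p) s' t' s'' →
        RAM.Exec B (.whileLt x y p) s (t + t' + 1) s''

/-! ## Instances as input and output -/

/-- The state stores the instance as a list of arcs: register `0` holds the number of vertices,
register `1` the number of arcs, and arrays `0`, `1`, `2` hold the tails, heads and weights of the
arcs, listed in an arbitrary order without repetition. -/
def RAM.State.Stores (s : RAM.State) {n : ℕ} (I : MinPAC (Fin n)) : Prop :=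
  s.reg 0 = n ∧ ∃ l : List (Fin n × Fin n),
    l.Nodup ∧ (∀ u v, (u, v) ∈ l ↔ I.graph.Adj u v) ∧ s.reg 1 = l.length ∧
    ∀ (i : ℕ) (h : i < l.length), s.arr 0 i = (l[i].1 : ℕ) ∧ s.arr 1 i = (l[i].2 : ℕ) ∧
      s.arr 2 i = I.weight l[i].1 l[i].2

/-- An initial state with input `I`: it stores `I`, and all other registers and array entries
are zero. -/
def RAM.State.IsInput (s : RAM.State) {n : ℕ} (I : MinPAC (Fin n)) : Prop :=
  s.Stores I ∧ (∀ x, 2 ≤ x → s.reg x = 0) ∧ ∀ a i, 3 ≤ a ∨ s.reg 1 ≤ i → s.arr a i = 0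

/-! The proof forgets the inner structure of an instance and keeps only the trade-offs that its
pieces offer. In a network, the profile of an edge tells in which directions the edge can be used,
given the powers at its two ends and the power spent in its interior. `Net.Reduces` says that the
minima of two networks differ by a constant. The instance itself becomes a network with one edge per
pair of adjacent vertices; a missing reverse arc gets a weight above the optimum, namely one more
than the sum of all weights, so that no optimal choice uses it.

A leaf is entered and left through its only edge, so its power is determined and the minimum power
of its neighbour rises (`Net.Leaf.reduces`). A vertex of degree two can be hidden inside one edge
between its neighbours (`Net.Series.reduces`). A whole path then has a summary of bounded size. Let
an inner vertex need power `q` to go backwards and `r` to go forwards. It pays `r`, `q` or their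
maximum, depending on which directions are used. Once `min q r` is moved to the constant, these
costs are the truncated differences `r - q`, `q - r`, and their sum, so along the path they add up
to `A`, `B` and `A + B`. If the path can be passed in neither direction, strong connectivity lets
exactly one of its edges be left out, and the saving depends on whether this is the first, the last
or an inner edge. These are the parameters of `Profile.long`; they are computed by
`Profile.comp_single_single` and `Profile.comp_long_single`.

When no vertex of degree at most two is left, the handshake lemma and `|E| = |V| + g - 1` give `|V|
≤ 2g - 2` and `|E| ≤ 3g - 3`. A path with only six inner vertices realises any summary that occurs
(`Data.Core.expand`). This gives at most `2g - 2 + 6(3g - 3) = 20g - 20` vertices and `3g - 3 + 6(3g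
- 3) = 21g - 21` edges, each of which is written as two arcs. Minimum powers are subtracted from the
weights, and their sum joins the constant `d`.

For linear time, a table indexed by pairs of vertices, which relies on memory being zero at the
start, finds the edge of the reverse arc. Every vertex stores its degree and the sum of the numbers
of its edges; this yields the only edge of a leaf, and at a vertex of degree two the other edge,
without adjacency lists. Each loop has a body of constant time and a linear potential. -/

/-! ## Power networks

A power network is a finite multigraph whose edges may stand for whole paths of an instance of
MinPAC. -/

/-- The admissible configurations of an edge: `O f b x y c` says that the edge can be used in
forward direction (if `f`) and in backward direction (if `b`) when its source has power `x`, its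
target has power `y`, and power `c` is spent in its interior. -/
abbrev Profile := Bool → Bool → ℕ → ℕ → ℕ → Prop

/-- A multigraph with vertex set `V`, edge set `E`, ends `src`, `tgt`, with a minimum power `base`
for every vertex and a profile for every edge. -/
@[ext] structure Net where
  V : Finset ℕ
  E : Finset ℕ
  src : ℕ → ℕ
  tgt : ℕ → ℕ
  base : ℕ → ℕ
  prof : ℕ → Profile

namespace Net

/-- The steps that are possible when the edges are used as told by `f` and `b`. -/
def Step (N : Net) (f b : ℕ → Bool) (u v : ℕ) : Prop :=
  ∃ e ∈ N.E, (f e = true ∧ N.src e = u ∧ N.tgt e = v) ∨ (b e = true ∧ N.tgt e = u ∧ N.src e = v)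

/-- All ends of edges are vertices. -/
def WF (N : Net) : Prop := ∀ e ∈ N.E, N.src e ∈ N.V ∧ N.tgt e ∈ N.V

/-- The network is strongly connected by the steps given by `f` and `b`. -/
def Conn (N : Net) (f b : ℕ → Bool) : Prop :=
  ∀ u ∈ N.V, ∀ v ∈ N.V, Relation.ReflTransGen (N.Step f b) u v

/-- There is a strongly connecting choice of total power at most `k`. -/
def Ach (N : Net) (k : ℕ) : Prop :=
  ∃ (π : ℕ → ℕ) (f b : ℕ → Bool) (c : ℕ → ℕ), (∀ v ∈ N.V, N.base v ≤ π v) ∧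
    (∀ e ∈ N.E, N.prof e (f e) (b e) (π (N.src e)) (π (N.tgt e)) (c e)) ∧
    N.Conn f b ∧ ∑ v ∈ N.V, π v + ∑ e ∈ N.E, c e ≤ k

/-- The minimum power of `N` exceeds that of `N'` by `d`. -/
def Reduces (N N' : Net) (d : ℕ) : Prop :=
  ∀ k, N.Ach k ↔ ∃ k', N'.Ach k' ∧ k' + d ≤ k

theorem Ach.mono {N : Net} {k k' : ℕ} (h : N.Ach k) (hk : k ≤ k') : N.Ach k' := by
  obtain ⟨π, f, b, c, h1, h2, h3, h4⟩ := h
  exact ⟨π, f, b, c, h1, h2, h3, h4.trans hk⟩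

theorem Ach.sum_base_le {N : Net} {k : ℕ} (h : N.Ach k) : ∑ v ∈ N.V, N.base v ≤ k := by
  obtain ⟨π, f, b, c, h1, -, -, h4⟩ := h
  exact (Finset.sum_le_sum h1).trans ((Nat.le_add_right _ _).trans h4)

theorem Reduces.isLeast {N N' : Net} {d k : ℕ} (h : N.Reduces N' d)
    (hk : IsLeast {k | N.Ach k} k) : d ≤ k ∧ IsLeast {k | N'.Ach k} (k - d) := by
  obtain ⟨k', h1, h2⟩ := (h k).1 hk.1
  refine ⟨by omega, h1.mono (by omega), fun k'' hk'' => ?_⟩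
  have := hk.2 ((h (k'' + d)).2 ⟨k'', hk'', le_rfl⟩)
  omega

theorem Reduces.trans {N N' N'' : Net} {d d' : ℕ} (h : N.Reduces N' d) (h' : N'.Reduces N'' d') :
    N.Reduces N'' (d + d') := by
  intro k
  rw [h k]
  constructor
  · rintro ⟨k', hk, hd⟩
    obtain ⟨k'', hk', hd'⟩ := (h' k').1 hk
    exact ⟨k'', hk', by omega⟩
  · rintro ⟨k'', hk, hd⟩
    exact ⟨k'' + d', (h' _).2 ⟨k'', hk, le_rfl⟩, by omega⟩

theorem Reduces.symm_zero {N N' : Net} (h : N.Reduces N' 0) : N'.Reduces N 0 := by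
  intro k
  constructor
  · intro hk
    exact ⟨k, (h k).2 ⟨k, hk, le_rfl⟩, le_rfl⟩
  · rintro ⟨k', hk, hd⟩
    obtain ⟨k'', h1, h2⟩ := (h k').1 hk
    exact h1.mono (by omega)

theorem Step.mem_ends {N : Net} (hN : N.WF) {f b : ℕ → Bool} {u v : ℕ} (h : N.Step f b u v) :
    u ∈ N.V ∧ v ∈ N.V := by
  obtain ⟨e, he, ⟨_, rfl, rfl⟩ | ⟨_, rfl, rfl⟩⟩ := h
  · exact hN e he
  · exact (hN e he).symm

end Net

/-- `O` and `O'` admit the same configurations, except that `O` costs `d` more. -/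
def Profile.Shift (O O' : Profile) (d : ℕ) : Prop :=
  (∀ f b x y c, O f b x y c → ∃ c', O' f b x y c' ∧ c' + d ≤ c) ∧
    ∀ f b x y c, O' f b x y c → ∃ c', O f b x y c' ∧ c' ≤ c + d

theorem Profile.Shift.trans {O O' O'' : Profile} {d d' : ℕ} (h : O.Shift O' d)
    (h' : O'.Shift O'' d') : O.Shift O'' (d + d') := by
  constructor
  · intro f b x y c hc
    obtain ⟨c', h1, h2⟩ := h.1 _ _ _ _ _ hc
    obtain ⟨c'', h3, h4⟩ := h'.1 _ _ _ _ _ h1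
    exact ⟨c'', h3, by omega⟩
  · intro f b x y c hc
    obtain ⟨c', h1, h2⟩ := h'.2 _ _ _ _ _ hc
    obtain ⟨c'', h3, h4⟩ := h.2 _ _ _ _ _ h1
    exact ⟨c'', h3, by omega⟩

/-- The profile of an edge read backwards. -/
def Profile.flip (O : Profile) : Profile := fun f b x y c => O b f y x c

/-- The profile of two edges in series at a vertex with minimum power `p`. -/
def Profile.comp (p : ℕ) (O O' : Profile) : Profile := fun f b x y c =>
  ∃ z f₁ b₁ c₁ f₂ b₂ c₂, p ≤ z ∧ O f₁ b₁ x z c₁ ∧ O' f₂ b₂ z y c₂ ∧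
    (f₁ = true ∨ b₂ = true) ∧ (b₁ = true ∨ f₂ = true) ∧
    (f = true → f₁ = true ∧ f₂ = true) ∧ (b = true → b₁ = true ∧ b₂ = true) ∧ c₁ + c₂ + z ≤ c

/-- The profile of a single edge of an instance: using it requires power `w` at the source for the
forward direction, and `w'` at the target for the backward direction. -/
def Profile.single (w w' : ℕ) : Profile := fun f b x y _ =>
  (f = true → w ≤ x) ∧ (b = true → w' ≤ y)

/-- The profile of a path with at least one inner vertex; `w` and `w'` are the weights of its
first arcs from both ends, `A` and `B` the interior costs of using it in forward or backward
direction only, `b₀`, `a₀`, `m` the gains from omitting the first edge, the last edge, or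
another edge. -/
def Profile.long (w w' A B a₀ b₀ m : ℕ) : Profile := fun f b x y c =>
  (b = false ∧ w ≤ x ∧ A ≤ c) ∨ (f = false ∧ w' ≤ y ∧ B ≤ c) ∨ (w ≤ x ∧ w' ≤ y ∧ A + B ≤ c) ∨
  (f = false ∧ b = false ∧ w' ≤ y ∧ A + B ≤ c + b₀) ∨
  (f = false ∧ b = false ∧ w ≤ x ∧ A + B ≤ c + a₀) ∨
  (f = false ∧ b = false ∧ w ≤ x ∧ w' ≤ y ∧ A + B ≤ c + m)

/-! ### Composition of profiles -/

namespace Profile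

theorem flip_single (w w' : ℕ) : (single w w').flip = single w' w := by
  funext f b x y c
  simp only [flip, single, eq_iff_iff]
  tauto

theorem flip_long (w w' A B a₀ b₀ m : ℕ) :
    (long w w' A B a₀ b₀ m).flip = long w' w B A b₀ a₀ m := by
  funext f b x y c
  simp only [flip, long, eq_iff_iff, add_comm B A]
  tauto

theorem eq_false_of_imp {g g' : Bool} (h : g = true → g' = true) (h' : g' = false) :
    g = false := by
  cases g <;> simp_all

/-- Let `q = max p w'` and `r = max p r` be the powers that the middle vertex needs to go backwards
and forwards. It pays `r`, `q` or the larger one, and leaving out the last or the first edge reduces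
the larger one to `q` or `r`. Subtracting `min q r` gives the listed parameters. There is no inner
edge, hence the gain `0`. -/
theorem comp_single_single (p w w' r r' : ℕ) :
    (comp p (single w w') (single r r')).Shift
      (long w r' (max p r - max p w') (max p w' - max p r) (max p r - max p w')
        (max p w' - max p r) 0) (min (max p w') (max p r)) := by
  constructor
  · rintro f b x y c ⟨z, f₁, b₁, c₁, f₂, b₂, c₂, hz, h1, h2, h3, h4, h5, h6, h7⟩
    -- The middle vertex has to be left (`h4`), which takes power `max p w'` or `max p r`; so the
    -- subtraction is not truncated.
    refine ⟨c - min (max p w') (max p r), ?_⟩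
    obtain ⟨h1, h1'⟩ := h1
    obtain ⟨h2, h2'⟩ := h2
    unfold long
    rcases Bool.eq_false_or_eq_true f₁ with hf | hf
    · have := h1 hf
      rcases Bool.eq_false_or_eq_true b₁ with hb | hb
      · have := h1' hb
        rcases Bool.eq_false_or_eq_true f₂ with hf' | hf' <;>
          rcases Bool.eq_false_or_eq_true b₂ with hb' | hb'
        · have := h2 hf'
          have := h2' hb'
          exact ⟨Or.inr (Or.inr (Or.inl ⟨by omega, by omega, by omega⟩)), by omega⟩
        · have := h2 hf'
          exact ⟨Or.inl ⟨eq_false_of_imp (fun h => (h6 h).2) hb', by omega, by omega⟩, by omega⟩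
        · have := h2' hb'
          exact ⟨Or.inr (Or.inl ⟨eq_false_of_imp (fun h => (h5 h).2) hf', by omega, by omega⟩),
            by omega⟩
        · exact ⟨Or.inr (Or.inr (Or.inr (Or.inr (Or.inl ⟨eq_false_of_imp (fun h => (h5 h).2) hf',
            eq_false_of_imp (fun h => (h6 h).2) hb', by omega, by omega⟩)))), by omega⟩
      · have := h2 (by simpa [hb] using h4)
        exact ⟨Or.inl ⟨eq_false_of_imp (fun h => (h6 h).1) hb, by omega, by omega⟩, by omega⟩
    · have := h2' (by simpa [hf] using h3)
      rcases Bool.eq_false_or_eq_true b₁ with hb | hb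
      · have := h1' hb
        exact ⟨Or.inr (Or.inl ⟨eq_false_of_imp (fun h => (h5 h).1) hf, by omega, by omega⟩),
          by omega⟩
      · have := h2 (by simpa [hb] using h4)
        exact ⟨Or.inr (Or.inr (Or.inr (Or.inl ⟨eq_false_of_imp (fun h => (h5 h).1) hf,
          eq_false_of_imp (fun h => (h6 h).1) hb, by omega, by omega⟩))), by omega⟩
  · rintro f b x y c (⟨rfl, h1, h2⟩ | ⟨rfl, h1, h2⟩ | ⟨h0, h1, h2⟩ | ⟨rfl, rfl, h1, h2⟩ |
      ⟨rfl, rfl, h1, h2⟩ | ⟨rfl, rfl, h0, h1, h2⟩)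
    -- In each case `z` is the least power of the middle vertex: `max p r` to go forwards only, `max
    -- p w'` to go backwards only, the larger of the two for both.
    · exact ⟨_, ⟨max p r, true, false, 0, true, false, 0, by simp, by simp [single, h1],
        by simp [single], by simp, by simp, by simp, by simp, le_rfl⟩, by omega⟩
    · exact ⟨_, ⟨max p w', false, true, 0, false, true, 0, by simp, by simp [single],
        by simp [single, h1], by simp, by simp, by simp, by simp, le_rfl⟩, by omega⟩
    · exact ⟨_, ⟨max (max p w') r, true, true, 0, true, true, 0, by simp, by simp [single, h0],
        by simp [single, h1], by simp, by simp, by simp, by simp, le_rfl⟩, by omega⟩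
    · exact ⟨_, ⟨max p r, false, false, 0, true, true, 0, by simp, by simp [single],
        by simp [single, h1], by simp, by simp, by simp, by simp, le_rfl⟩, by omega⟩
    · exact ⟨_, ⟨max p w', true, true, 0, false, false, 0, by simp, by simp [single, h1],
        by simp [single], by simp, by simp, by simp, by simp, le_rfl⟩, by omega⟩
    · exact ⟨_, ⟨max (max p w') r, true, true, 0, true, true, 0, by simp, by simp [single, h0],
        by simp [single, h1], by simp, by simp, by simp, by simp, le_rfl⟩, by omega⟩

/-- The costs of the new vertex are added to `A` and `B`. The former last edge becomes an inner
edge: leaving it out saves `a₀` at its old inner end and, at the new vertex, the excess of the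
backward over the forward need. The new gain `m` is therefore a maximum, the gain at the first edge
stays, and the gain at the last edge is determined by the new vertex alone. -/
theorem comp_long_single {p w w' r r' A B a₀ b₀ m : ℕ} (ha : a₀ ≤ A) (hb : b₀ ≤ B)
    (hm : m ≤ A + B) :
    (comp p (long w w' A B a₀ b₀ m) (single r r')).Shift
      (long w r' (A + (max p r - max p w')) (B + (max p w' - max p r)) (max p r - max p w')
        b₀ (max m (a₀ + (max p w' - max p r)))) (min (max p w') (max p r)) := by
  constructor
  · rintro f b x y c ⟨z, f₁, b₁, c₁, f₂, b₂, c₂, hz, h1, h2, h3, h4, h5, h6, h7⟩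
    refine ⟨c - min (max p w') (max p r), ?_⟩
    obtain ⟨h2, h2'⟩ := h2
    rcases h1 with ⟨rfl, h8, h9⟩ | ⟨rfl, h8, h9⟩ | ⟨h8, h9, h10⟩ | ⟨rfl, rfl, h8, h9⟩ |
      ⟨rfl, rfl, h8, h9⟩ | ⟨rfl, rfl, h8, h9, h10⟩
    · have := h2 (by simpa using h4)
      exact ⟨Or.inl ⟨eq_false_of_imp (fun h => (h6 h).1) rfl, h8, by omega⟩, by omega⟩
    · have := h2' (by simpa using h3)
      exact ⟨Or.inr (Or.inl ⟨eq_false_of_imp (fun h => (h5 h).1) rfl, by omega, by omega⟩),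
          by omega⟩
    · cases hf : f₂ <;> cases hb : b₂
      · exact ⟨Or.inr (Or.inr (Or.inr (Or.inr (Or.inl
          ⟨eq_false_of_imp (fun h => (h5 h).2) hf, eq_false_of_imp (fun h => (h6 h).2) hb, h8,
              by omega⟩)))), by omega⟩
      · have := h2' hb
        exact ⟨Or.inr (Or.inl ⟨eq_false_of_imp (fun h => (h5 h).2) hf, by omega, by omega⟩),
            by omega⟩
      · have := h2 hf
        exact ⟨Or.inl ⟨eq_false_of_imp (fun h => (h6 h).2) hb, h8, by omega⟩, by omega⟩
      · have := h2 hf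
        have := h2' hb
        exact ⟨Or.inr (Or.inr (Or.inl ⟨h8, by omega, by omega⟩)), by omega⟩
    -- In the remaining cases the long piece is passable in neither direction, so the middle vertex
    -- is both entered and left through the second edge.
    all_goals
      have := h2 (by simpa using h4)
      have := h2' (by simpa using h3)
    · exact ⟨Or.inr (Or.inr (Or.inr (Or.inl ⟨eq_false_of_imp (fun h => (h5 h).1) rfl,
          eq_false_of_imp (fun h => (h6 h).1) rfl, by omega, by omega⟩))),
        by omega⟩
    all_goals
      exact ⟨Or.inr (Or.inr (Or.inr (Or.inr (Or.inr
        ⟨eq_false_of_imp (fun h => (h5 h).1) rfl, eq_false_of_imp (fun h => (h6 h).1) rfl, h8,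
            by omega, by omega⟩)))), by omega⟩
  · rintro f b x y c (⟨rfl, h1, h2⟩ | ⟨rfl, h1, h2⟩ | ⟨h0, h1, h2⟩ | ⟨rfl, rfl, h1, h2⟩ |
      ⟨rfl, rfl, h1, h2⟩ | ⟨rfl, rfl, h0, h1, h2⟩)
    · exact ⟨_, ⟨max p r, true, false, A, true, false, 0, by simp, by simp [long, h1],
        by simp [single], by simp, by simp, by simp, by simp, le_rfl⟩, by omega⟩
    · exact ⟨_, ⟨max p w', false, true, B, false, true, 0, by simp, by simp [long],
        by simp [single, h1], by simp, by simp, by simp, by simp, le_rfl⟩, by omega⟩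
    · exact ⟨_, ⟨max (max p w') r, true, true, A + B, true, true, 0, by simp, by simp [long, h0],
        by simp [single, h1], by simp, by simp, by simp, by simp, le_rfl⟩, by omega⟩
    · refine ⟨_, ⟨max (max p w') r, false, false, A + B - b₀, true, true, 0, by simp, ?_,
        by simp [single, h1], by simp, by simp, by simp, by simp, le_rfl⟩, by omega⟩
      unfold long; simp; omega
    · exact ⟨_, ⟨max p w', true, true, A + B, false, false, 0, by simp, by simp [long, h1],
        by simp [single], by simp, by simp, by simp, by simp, le_rfl⟩, by omega⟩
    -- The omitted inner edge is the former last edge or an older inner edge, whichever gain is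
    -- larger.
    · rcases le_total m (a₀ + (max p w' - max p r)) with h | h
      · refine ⟨_, ⟨max p r, false, false, A + B - a₀, true, true, 0, by simp, ?_,
          by simp [single, h1], by simp, by simp, by simp, by simp, le_rfl⟩, by omega⟩
        unfold long; simp; omega
      · refine ⟨_, ⟨max (max p w') r, false, false, A + B - m, true, true, 0, by simp, ?_,
          by simp [single, h1], by simp, by simp, by simp, by simp, le_rfl⟩, by omega⟩
        unfold long; simp; omega

/-- The gain from omitting an inner edge is irrelevant below the cost of either direction. -/
theorem long_shift_long {w w' A B a₀ b₀ m m' : ℕ} (h : m ≤ m') (h' : m' ≤ max m (max A B)) :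
    (long w w' A B a₀ b₀ m').Shift (long w w' A B a₀ b₀ m) 0 := by
  constructor
  · intro f b x y c hc
    refine ⟨c, ?_, le_rfl⟩
    unfold long at *
    rcases hc with hc | hc | hc | hc | hc | ⟨rfl, rfl, h1, h2, h3⟩ <;> try tauto
    simp only [true_and]
    omega
  · intro f b x y c hc
    refine ⟨c, ?_, le_rfl⟩
    unfold long at *
    rcases hc with hc | hc | hc | hc | hc | ⟨h0, h0', h1, h2, h3⟩ <;> try tauto
    exact Or.inr (Or.inr (Or.inr (Or.inr (Or.inr ⟨h0, h0', h1, h2, by omega⟩))))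

end Profile


/-! ### Joining two edges at a vertex of degree two -/

namespace Net

open Relation

/-- `N'` arises from `N` by joining the edges `e₁` and `e₂`, which meet in the vertex `x` of
degree two, to the edge `e₁`. -/
structure Series (N N' : Net) (x e₁ e₂ : ℕ) : Prop where
  wf : N.WF
  memV : x ∈ N.V
  mem₁ : e₁ ∈ N.E
  mem₂ : e₂ ∈ N.E
  ne : e₁ ≠ e₂
  tgt₁ : N.tgt e₁ = x
  src₂ : N.src e₂ = x
  src₁ : N.src e₁ ≠ x
  tgt₂ : N.tgt e₂ ≠ x
  only : ∀ e ∈ N.E, e ≠ e₁ → e ≠ e₂ → N.src e ≠ x ∧ N.tgt e ≠ x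
  V_eq : N'.V = N.V.erase x
  E_eq : N'.E = N.E.erase e₂
  src_eq : ∀ e ∈ N'.E, N'.src e = N.src e
  tgt_eq : ∀ e ∈ N'.E, e ≠ e₁ → N'.tgt e = N.tgt e
  tgt₁_eq : N'.tgt e₁ = N.tgt e₂
  base_eq : ∀ v ∈ N'.V, N'.base v = N.base v
  prof_eq : ∀ e ∈ N'.E, e ≠ e₁ → N'.prof e = N.prof e

namespace Series

variable {N N' : Net} {x e₁ e₂ : ℕ} (h : Series N N' x e₁ e₂)

include h

theorem mem₁' : e₁ ∈ N'.E := by rw [h.E_eq]; exact Finset.mem_erase.2 ⟨h.ne, h.mem₁⟩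

theorem step_to {f b : ℕ → Bool} {y : ℕ} : N.Step f b y x ↔
    (f e₁ = true ∧ y = N.src e₁) ∨ (b e₂ = true ∧ y = N.tgt e₂) := by
  constructor
  · rintro ⟨e, he, ⟨hf, rfl, hx⟩ | ⟨hf, rfl, hx⟩⟩ <;> by_cases h1 : e = e₁ <;> by_cases h2 : e = e₂
    · exact absurd (h1.symm.trans h2) h.ne
    · subst h1; exact Or.inl ⟨hf, rfl⟩
    · subst h2; exact absurd hx h.tgt₂
    · exact absurd hx (h.only e he h1 h2).2
    · exact absurd (h1.symm.trans h2) h.ne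
    · subst h1; exact absurd hx h.src₁
    · subst h2; exact Or.inr ⟨hf, rfl⟩
    · exact absurd hx (h.only e he h1 h2).1
  · rintro (⟨hf, rfl⟩ | ⟨hf, rfl⟩)
    · exact ⟨e₁, h.mem₁, Or.inl ⟨hf, rfl, h.tgt₁⟩⟩
    · exact ⟨e₂, h.mem₂, Or.inr ⟨hf, rfl, h.src₂⟩⟩

theorem step_from {f b : ℕ → Bool} {z : ℕ} : N.Step f b x z ↔
    (b e₁ = true ∧ z = N.src e₁) ∨ (f e₂ = true ∧ z = N.tgt e₂) := by
  constructor
  · rintro ⟨e, he, ⟨hf, hx, rfl⟩ | ⟨hf, hx, rfl⟩⟩ <;> by_cases h1 : e = e₁ <;> by_cases h2 : e = e₂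
    · exact absurd (h1.symm.trans h2) h.ne
    · subst h1; exact absurd hx h.src₁
    · subst h2; exact Or.inr ⟨hf, rfl⟩
    · exact absurd hx (h.only e he h1 h2).1
    · exact absurd (h1.symm.trans h2) h.ne
    · subst h1; exact Or.inl ⟨hf, rfl⟩
    · subst h2; exact absurd hx h.tgt₂
    · exact absurd hx (h.only e he h1 h2).2
  · rintro (⟨hf, rfl⟩ | ⟨hf, rfl⟩)
    · exact ⟨e₁, h.mem₁, Or.inr ⟨hf, h.tgt₁, rfl⟩⟩
    · exact ⟨e₂, h.mem₂, Or.inl ⟨hf, h.src₂, rfl⟩⟩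

theorem wf' : N'.WF := by
  intro e he
  rw [h.V_eq, Finset.mem_erase, Finset.mem_erase, h.src_eq e he]
  have he' := he
  rw [h.E_eq, Finset.mem_erase] at he
  by_cases h1 : e = e₁
  · subst h1
    rw [h.tgt₁_eq]
    exact ⟨⟨h.src₁, (h.wf _ h.mem₁).1⟩, h.tgt₂, (h.wf _ h.mem₂).2⟩
  · rw [h.tgt_eq e he' h1]
    exact ⟨⟨(h.only e he.2 h1 he.1).1, (h.wf _ he.2).1⟩, (h.only e he.2 h1 he.1).2,
      (h.wf _ he.2).2⟩

/-- Steps that avoid `x` exist in both networks. A visit to `x` either returns along the edge by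
which it came, and can be cut out, or passes along both edges, and becomes one step along the merged
edge. -/
theorem conn {f b f' b' : ℕ → Bool} (hf : ∀ e, e ≠ e₁ → f' e = f e) (hb : ∀ e, e ≠ e₁ → b' e = b e)
    (hf₁ : f e₁ = true → f e₂ = true → f' e₁ = true)
    (hb₁ : b e₁ = true → b e₂ = true → b' e₁ = true) (hc : N.Conn f b) : N'.Conn f' b' := by
  have hstep : ∀ u v, u ≠ x → v ≠ x → N.Step f b u v → N'.Step f' b' u v := by
    rintro u v hu hv ⟨e, he, hs⟩
    have h1 : e ≠ e₁ := by
      rintro rfl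
      rcases hs with ⟨_, _, hs⟩ | ⟨_, hs, _⟩
      · exact hv (hs ▸ h.tgt₁)
      · exact hu (hs ▸ h.tgt₁)
    have h2 : e ≠ e₂ := by
      rintro rfl
      rcases hs with ⟨_, hs, _⟩ | ⟨_, _, hs⟩
      · exact hu (hs ▸ h.src₂)
      · exact hv (hs ▸ h.src₂)
    have he' : e ∈ N'.E := by rw [h.E_eq]; exact Finset.mem_erase.2 ⟨h2, he⟩
    refine ⟨e, he', ?_⟩
    rw [hf e h1, hb e h1, h.src_eq e he', h.tgt_eq e he' h1]
    exact hs
  -- While a walk stands at `x`, the induction remembers the vertex from which `x` was entered.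
  have key : ∀ u v, u ≠ x → ReflTransGen (N.Step f b) u v →
      (v ≠ x → ReflTransGen (N'.Step f' b') u v) ∧
      (v = x → ∃ y, N.Step f b y x ∧ y ≠ x ∧ ReflTransGen (N'.Step f' b') u y) := by
    intro u v hu huv
    induction huv with
    | refl => exact ⟨fun _ => .refl, fun h => absurd h hu⟩
    | @tail y z _ hyz ih =>
      by_cases hy : y = x
      · subst hy
        obtain ⟨w, hw, hwx, huw⟩ := ih.2 rfl
        refine ⟨fun hz => ?_, fun _ => ⟨w, hw, hwx, huw⟩⟩
        rcases h.step_to.1 hw with ⟨h1, rfl⟩ | ⟨h1, rfl⟩ <;>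
          rcases h.step_from.1 hyz with ⟨h2, rfl⟩ | ⟨h2, rfl⟩
        · exact huw
        · exact huw.tail ⟨e₁, h.mem₁', Or.inl ⟨hf₁ h1 h2, h.src_eq _ h.mem₁', h.tgt₁_eq⟩⟩
        · exact huw.tail ⟨e₁, h.mem₁', Or.inr ⟨hb₁ h2 h1, h.tgt₁_eq, h.src_eq _ h.mem₁'⟩⟩
        · exact huw
      · refine ⟨fun hz => (ih.1 hy).tail (hstep y z hy hz hyz), fun hz => ?_⟩
        subst hz
        exact ⟨y, hyz, hy, ih.1 hy⟩
  intro u hu v hv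
  rw [h.V_eq, Finset.mem_erase] at hu hv
  exact (key u v hu.1 (hc u hu.2 v hv.2)).1 hv.1

/-- A step along the merged edge is replaced by two steps through `x`. The conditions `hin` and
`hout` attach `x` itself, which does not lie on the walks of the smaller network if the merged edge
is unused. -/
theorem conn' {f b f' b' : ℕ → Bool} (hf : ∀ e, e ≠ e₁ → e ≠ e₂ → f e = f' e)
    (hb : ∀ e, e ≠ e₁ → e ≠ e₂ → b e = b' e)
    (hf₁ : f' e₁ = true → f e₁ = true ∧ f e₂ = true)
    (hb₁ : b' e₁ = true → b e₁ = true ∧ b e₂ = true)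
    (hin : f e₁ = true ∨ b e₂ = true) (hout : b e₁ = true ∨ f e₂ = true)
    (hc : N'.Conn f' b') : N.Conn f b := by
  have hstep : ∀ u v, N'.Step f' b' u v → ReflTransGen (N.Step f b) u v := by
    rintro u v ⟨e, he', hs⟩
    have he := he'
    rw [h.E_eq, Finset.mem_erase] at he
    rw [h.src_eq e he'] at hs
    by_cases h1 : e = e₁
    · subst h1
      rw [h.tgt₁_eq] at hs
      rcases hs with ⟨h1, rfl, rfl⟩ | ⟨h1, rfl, rfl⟩
      · exact .tail (.single (h.step_to.2 (Or.inl ⟨(hf₁ h1).1, rfl⟩)))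
          (h.step_from.2 (Or.inr ⟨(hf₁ h1).2, rfl⟩))
      · exact .tail (.single (h.step_to.2 (Or.inr ⟨(hb₁ h1).2, rfl⟩)))
          (h.step_from.2 (Or.inl ⟨(hb₁ h1).1, rfl⟩))
    · rw [h.tgt_eq e he' h1] at hs
      refine .single ⟨e, he.2, ?_⟩
      rw [hf e h1 he.1, hb e h1 he.1]
      exact hs
  have hpath : ∀ u v, ReflTransGen (N'.Step f' b') u v → ReflTransGen (N.Step f b) u v := by
    intro u v huv
    induction huv with
    | refl => exact .refl
    | tail _ hyz ih => exact ih.trans (hstep _ _ hyz)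
  obtain ⟨y, hy, hyx⟩ : ∃ y ∈ N'.V, N.Step f b y x := by
    rcases hin with h1 | h1
    · exact ⟨_, (h.wf' _ h.mem₁').1,
        h.step_to.2 (Or.inl ⟨h1, h.src_eq _ h.mem₁'⟩)⟩
    · exact ⟨_, (h.wf' _ h.mem₁').2, h.step_to.2 (Or.inr ⟨h1, h.tgt₁_eq⟩)⟩
  obtain ⟨z, hz, hxz⟩ : ∃ z ∈ N'.V, N.Step f b x z := by
    rcases hout with h1 | h1
    · exact ⟨_, (h.wf' _ h.mem₁').1,
        h.step_from.2 (Or.inl ⟨h1, h.src_eq _ h.mem₁'⟩)⟩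
    · exact ⟨_, (h.wf' _ h.mem₁').2, h.step_from.2 (Or.inr ⟨h1, h.tgt₁_eq⟩)⟩
  intro u hu v hv
  have hu' : u ≠ x → u ∈ N'.V := fun h1 => by rw [h.V_eq]; exact Finset.mem_erase.2 ⟨h1, hu⟩
  have hv' : v ≠ x → v ∈ N'.V := fun h1 => by rw [h.V_eq]; exact Finset.mem_erase.2 ⟨h1, hv⟩
  by_cases h1 : u = x <;> by_cases h2 : v = x
  · rw [h1, h2]
  · rw [h1]; exact .head hxz (hpath _ _ (hc _ hz _ (hv' h2)))
  · rw [h2]; exact .tail (hpath _ _ (hc _ (hu' h1) _ hy)) hyx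
  · exact hpath _ _ (hc _ (hu' h1) _ (hv' h2))

/-- In one direction the merged edge is used wherever both halves are; in the other, `Profile.comp`
supplies the power of `x` and the use of the two halves. All other powers and edges are carried
over, so the minima differ by the shift of the one changed profile. -/
theorem reduces {d : ℕ}
    (hO : (Profile.comp (N.base x) (N.prof e₁) (N.prof e₂)).Shift (N'.prof e₁) d) :
    N.Reduces N' d := by
  have hsub : ∀ g g' : ℕ → ℕ, (∀ e ∈ N'.E, e ≠ e₁ → g e = g' e) →
      ∑ e ∈ N'.E.erase e₁, g e = ∑ e ∈ N'.E.erase e₁, g' e := fun g g' hg =>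
    Finset.sum_congr rfl fun e he =>
      hg e (Finset.mem_of_mem_erase he) (Finset.ne_of_mem_erase he)
  have hE1 : ∀ g : ℕ → ℕ, ∑ e ∈ N'.E, g e = g e₁ + ∑ e ∈ N'.E.erase e₁, g e := fun g =>
    (Finset.add_sum_erase _ _ h.mem₁').symm
  have hE : ∀ g : ℕ → ℕ, ∑ e ∈ N.E, g e = g e₂ + (g e₁ + ∑ e ∈ N'.E.erase e₁, g e) := fun g => by
    rw [← hE1 g, h.E_eq, Finset.add_sum_erase _ _ h.mem₂]
  have hV : ∀ g : ℕ → ℕ, ∑ v ∈ N.V, g v = g x + ∑ v ∈ N'.V, g v := fun g => by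
    rw [h.V_eq, Finset.add_sum_erase _ _ h.memV]
  have hmE : ∀ e ∈ N.E, e ≠ e₂ → e ∈ N'.E := fun e he h2 => by
    rw [h.E_eq]; exact Finset.mem_erase.2 ⟨h2, he⟩
  have hmE' : ∀ e ∈ N'.E, e ∈ N.E ∧ e ≠ e₂ := fun e he => by
    rw [h.E_eq, Finset.mem_erase] at he; exact he.symm
  have hmV' : ∀ v ∈ N'.V, v ∈ N.V ∧ v ≠ x := fun e he => by
    rw [h.V_eq, Finset.mem_erase] at he; exact he.symm
  intro k
  constructor
  · rintro ⟨π, f, b, c, h1, h2, h3, h4⟩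
    have hne : N.src e₁ ∈ N'.V := by
      rw [h.V_eq]; exact Finset.mem_erase.2 ⟨h.src₁, (h.wf _ h.mem₁).1⟩
    -- `N.src e₁` is a vertex other than `x`, so a walk from it to `x` has a last step, which enters
    -- `x`.
    have hin : f e₁ = true ∨ b e₂ = true := by
      rcases (h3 _ (h.wf _ h.mem₁).1 x h.memV).cases_tail with hx | ⟨y, _, hy⟩
      · exact absurd hx.symm h.src₁
      · rcases h.step_to.1 hy with hy | hy
        exacts [Or.inl hy.1, Or.inr hy.1]
    have hout : b e₁ = true ∨ f e₂ = true := by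
      rcases (h3 x h.memV _ (h.wf _ h.mem₁).1).cases_head with hx | ⟨y, hy, _⟩
      · exact absurd hx.symm h.src₁
      · rcases h.step_from.1 hy with hy | hy
        exacts [Or.inl hy.1, Or.inr hy.1]
    obtain ⟨c', hc', hd⟩ := hO.1 (f e₁ && f e₂) (b e₁ && b e₂) (π (N.src e₁)) (π (N.tgt e₂))
      (c e₁ + c e₂ + π x)
      ⟨π x, f e₁, b e₁, c e₁, f e₂, b e₂, c e₂, h1 x h.memV,
        by simpa only [h.tgt₁] using h2 e₁ h.mem₁, by simpa only [h.src₂] using h2 e₂ h.mem₂,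
        hin, hout, by simp, by simp, le_rfl⟩
    refine ⟨_, ⟨π, Function.update f e₁ (f e₁ && f e₂), Function.update b e₁ (b e₁ && b e₂),
      Function.update c e₁ c', ?_, ?_, ?_, le_rfl⟩, ?_⟩
    · intro v hv
      rw [h.base_eq v hv]
      exact h1 v (hmV' v hv).1
    · intro e he
      by_cases he1 : e = e₁
      · subst he1
        simpa [h.src_eq e he, h.tgt₁_eq] using hc'
      · simpa [he1, h.src_eq e he, h.tgt_eq e he he1, h.prof_eq e he he1] using h2 e (hmE' e he).1
    · exact h.conn (fun e he => by simp [he]) (fun e he => by simp [he])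
        (by simp +contextual) (by simp +contextual) h3
    · rw [hE, hV] at h4
      rw [hE1, hsub (Function.update c e₁ c') c (fun e _ he => by simp [he])]
      simp only [Function.update_self]
      omega
  · rintro ⟨k', ⟨π, f, b, c, h1, h2, h3, h4⟩, hk⟩
    have h5 := h2 e₁ h.mem₁'
    rw [h.src_eq _ h.mem₁', h.tgt₁_eq] at h5
    obtain ⟨c', ⟨z, f₁, b₁, c₁, f₂, b₂, c₂, hz, ho1, ho2, hin, hout, hf, hb, hc⟩, hd⟩ :=
      hO.2 _ _ _ _ _ h5
    have hne := h.ne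
    refine ⟨Function.update π x z, Function.update (Function.update f e₁ f₁) e₂ f₂,
      Function.update (Function.update b e₁ b₁) e₂ b₂,
      Function.update (Function.update c e₁ c₁) e₂ c₂, ?_, ?_, ?_, ?_⟩
    · intro v hv
      by_cases hvx : v = x
      · subst hvx; simpa using hz
      · have hv' : v ∈ N'.V := by rw [h.V_eq]; exact Finset.mem_erase.2 ⟨hvx, hv⟩
        simpa [hvx, h.base_eq v hv'] using h1 v hv'
    · intro e he
      by_cases he2 : e = e₂
      · subst he2
        simpa [h.src₂, h.tgt₂] using ho2
      by_cases he1 : e = e₁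
      · subst he1
        simpa [he2, h.tgt₁, h.src₁] using ho1
      have he' := hmE e he he2
      have := h2 e he'
      rw [h.src_eq e he', h.tgt_eq e he' he1, h.prof_eq e he' he1] at this
      simpa [he1, he2, (h.only e he he1 he2).1, (h.only e he he1 he2).2] using this
    · refine h.conn' (f' := f) (b' := b) ?_ ?_ ?_ ?_ ?_ ?_ h3
      · intro e he1 he2; simp [he1, he2]
      · intro e he1 he2; simp [he1, he2]
      · simpa [hne] using hf
      · simpa [hne] using hb
      · simpa [hne] using hin
      · simpa [hne] using hout
    · rw [hE, hV, hsub (Function.update (Function.update c e₁ c₁) e₂ c₂) c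
        (fun e he he1 => by simp [he1, (hmE' e he).2])]
      rw [hE1] at h4
      have : ∑ v ∈ N'.V, Function.update π x z v = ∑ v ∈ N'.V, π v :=
        Finset.sum_congr rfl fun v hv => by simp [(hmV' v hv).2]
      rw [this]
      simp only [Function.update_self, Function.update_of_ne hne]
      omega

end Series

/-! ### Removal of a leaf -/

/-- `N'` arises from `N` by removing the leaf `x` and its edge `e`, at whose other end the weight
`w` has to be paid in any case. -/
structure Leaf (N N' : Net) (x e w w' : ℕ) : Prop where
  wf : N.WF
  memV : x ∈ N.V
  mem : e ∈ N.E
  tgt : N.tgt e = x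
  src : N.src e ≠ x
  prof : N.prof e = Profile.single w w'
  only : ∀ e' ∈ N.E, e' ≠ e → N.src e' ≠ x ∧ N.tgt e' ≠ x
  V_eq : N'.V = N.V.erase x
  E_eq : N'.E = N.E.erase e
  src_eq : ∀ e ∈ N'.E, N'.src e = N.src e
  tgt_eq : ∀ e ∈ N'.E, N'.tgt e = N.tgt e
  base_eq : ∀ v ∈ N'.V, v ≠ N.src e → N'.base v = N.base v
  base_src : N'.base (N.src e) = max (N.base (N.src e)) w
  prof_eq : ∀ e ∈ N'.E, N'.prof e = N.prof e

namespace Leaf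

variable {N N' : Net} {x e w w' : ℕ} (h : Leaf N N' x e w w')

include h

theorem wf' : N'.WF := by
  intro e' he'
  rw [h.V_eq, Finset.mem_erase, Finset.mem_erase, h.src_eq e' he', h.tgt_eq e' he']
  rw [h.E_eq, Finset.mem_erase] at he'
  exact ⟨⟨(h.only e' he'.2 he'.1).1, (h.wf _ he'.2).1⟩, (h.only e' he'.2 he'.1).2,
    (h.wf _ he'.2).2⟩

theorem step_to {f b : ℕ → Bool} {y : ℕ} : N.Step f b y x ↔ f e = true ∧ y = N.src e := by
  constructor
  · rintro ⟨e', he', ⟨hf, rfl, hx⟩ | ⟨hf, rfl, hx⟩⟩ <;> by_cases h1 : e' = e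
    · subst h1; exact ⟨hf, rfl⟩
    · exact absurd hx (h.only e' he' h1).2
    · subst h1; exact absurd hx h.src
    · exact absurd hx (h.only e' he' h1).1
  · rintro ⟨hf, rfl⟩
    exact ⟨e, h.mem, Or.inl ⟨hf, rfl, h.tgt⟩⟩

theorem step_from {f b : ℕ → Bool} {y : ℕ} : N.Step f b x y ↔ b e = true ∧ y = N.src e := by
  constructor
  · rintro ⟨e', he', ⟨hf, hx, rfl⟩ | ⟨hf, hx, rfl⟩⟩ <;> by_cases h1 : e' = e
    · subst h1; exact absurd hx h.src
    · exact absurd hx (h.only e' he' h1).1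
    · subst h1; exact ⟨hf, rfl⟩
    · exact absurd hx (h.only e' he' h1).2
  · rintro ⟨hf, rfl⟩
    exact ⟨e, h.mem, Or.inr ⟨hf, h.tgt, rfl⟩⟩

/-- The edge `e` is the only way into and out of the leaf, so both directions are forced; a detour
to the leaf returns to where it started and can be cut out of any walk. -/
theorem conn_iff {f b : ℕ → Bool} :
    N.Conn f b ↔ N'.Conn f b ∧ f e = true ∧ b e = true := by
  have hs := (h.wf _ h.mem).1
  have hmV : ∀ v ∈ N.V, v ≠ x → v ∈ N'.V := fun v hv h1 => by
    rw [h.V_eq]; exact Finset.mem_erase.2 ⟨h1, hv⟩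
  have hmV' : ∀ v ∈ N'.V, v ∈ N.V ∧ v ≠ x := fun e he => by
    rw [h.V_eq, Finset.mem_erase] at he; exact he.symm
  have hsub : ∀ u v, N'.Step f b u v → N.Step f b u v := by
    rintro u v ⟨e', he', hs⟩
    rw [h.src_eq e' he', h.tgt_eq e' he'] at hs
    rw [h.E_eq, Finset.mem_erase] at he'
    exact ⟨e', he'.2, hs⟩
  have hsup : ∀ u v, u ≠ x → v ≠ x → N.Step f b u v → N'.Step f b u v := by
    rintro u v hu hv ⟨e', he', hst⟩
    have h1 : e' ≠ e := by
      rintro rfl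
      rcases hst with ⟨_, _, hst⟩ | ⟨_, hst, _⟩
      · exact hv (hst ▸ h.tgt)
      · exact hu (hst ▸ h.tgt)
    have he'' : e' ∈ N'.E := by rw [h.E_eq]; exact Finset.mem_erase.2 ⟨h1, he'⟩
    exact ⟨e', he'', by rwa [h.src_eq e' he'', h.tgt_eq e' he'']⟩
  constructor
  · intro hc
    refine ⟨?_, ?_, ?_⟩
    · intro u hu v hv
      have key : ∀ u v, u ≠ x → ReflTransGen (N.Step f b) u v →
          (v ≠ x → ReflTransGen (N'.Step f b) u v) ∧
          (v = x → ReflTransGen (N'.Step f b) u (N.src e)) := by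
        intro u v hu huv
        induction huv with
        | refl => exact ⟨fun _ => .refl, fun h => absurd h hu⟩
        | @tail y z _ hyz ih =>
          by_cases hy : y = x <;> by_cases hz : z = x
          · exact ⟨fun h => absurd hz h, fun _ => ih.2 hy⟩
          · refine ⟨fun _ => ?_, fun h => absurd h hz⟩
            rw [(h.step_from.1 (show N.Step f b x z from hy ▸ hyz)).2]
            exact ih.2 hy
          · refine ⟨fun h => absurd hz h, fun _ => ?_⟩
            rw [← (h.step_to.1 (show N.Step f b y x from hz ▸ hyz)).2]
            exact ih.1 hy
          · exact ⟨fun _ => (ih.1 hy).tail (hsup _ _ hy hz hyz), fun h => absurd h hz⟩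
      exact (key u v (hmV' u hu).2 (hc u (hmV' u hu).1 v (hmV' v hv).1)).1 (hmV' v hv).2
    · rcases (hc _ hs x h.memV).cases_tail with hx | ⟨y, _, hy⟩
      · exact absurd hx.symm h.src
      · exact (h.step_to.1 hy).1
    · rcases (hc x h.memV _ hs).cases_head with hx | ⟨y, hy, _⟩
      · exact absurd hx.symm h.src
      · exact (h.step_from.1 hy).1
  · rintro ⟨hc, hf, hb⟩ u hu v hv
    have hto := h.step_to (f := f) (b := b) |>.2 ⟨hf, rfl⟩
    have hfrom := h.step_from (f := f) (b := b) |>.2 ⟨hb, rfl⟩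
    have hs' := hmV _ hs h.src
    by_cases h1 : u = x <;> by_cases h2 : v = x
    · rw [h1, h2]
    · rw [h1]; exact .head hfrom (.mono hsub _ _ (hc _ hs' _ (hmV _ hv h2)))
    · rw [h2]; exact .tail (.mono hsub _ _ (hc _ (hmV _ hu h1) _ hs')) hto
    · exact .mono hsub _ _ (hc _ (hmV _ hu h1) _ (hmV _ hv h2))

/-- Both directions of `e` are forced: the leaf pays `max (N.base x) w'`, no more being of use, and
the demand `w` at the neighbour is recorded in its new minimum power. -/
theorem reduces : N.Reduces N' (max (N.base x) w') := by
  have hE : ∀ g : ℕ → ℕ, ∑ e ∈ N.E, g e = g e + ∑ e ∈ N'.E, g e := fun g => by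
    rw [h.E_eq, Finset.add_sum_erase _ _ h.mem]
  have hV : ∀ g : ℕ → ℕ, ∑ v ∈ N.V, g v = g x + ∑ v ∈ N'.V, g v := fun g => by
    rw [h.V_eq, Finset.add_sum_erase _ _ h.memV]
  have hmV' : ∀ v ∈ N'.V, v ∈ N.V ∧ v ≠ x := fun e he => by
    rw [h.V_eq, Finset.mem_erase] at he; exact he.symm
  have hmE' : ∀ e' ∈ N'.E, e' ∈ N.E ∧ e' ≠ e := fun e he => by
    rw [h.E_eq, Finset.mem_erase] at he; exact he.symm
  have hsV : N.src e ∈ N'.V := by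
    rw [h.V_eq]; exact Finset.mem_erase.2 ⟨h.src, (h.wf _ h.mem).1⟩
  intro k
  constructor
  · rintro ⟨π, f, b, c, h1, h2, h3, h4⟩
    rw [h.conn_iff] at h3
    have h5 := h2 e h.mem
    rw [h.prof, h.tgt] at h5
    have h6 := h5.1 h3.2.1
    have h7 := h5.2 h3.2.2
    have h8 := h1 x h.memV
    refine ⟨_, ⟨π, f, b, c, ?_, ?_, h3.1, le_rfl⟩, ?_⟩
    · intro v hv
      by_cases hvs : v = N.src e
      · rw [hvs, h.base_src]
        exact max_le (h1 _ (h.wf _ h.mem).1) h6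
      · rw [h.base_eq v hv hvs]
        exact h1 v (hmV' v hv).1
    · intro e' he'
      rw [h.src_eq e' he', h.tgt_eq e' he', h.prof_eq e' he']
      exact h2 e' (hmE' e' he').1
    · rw [hE, hV] at h4
      omega
  · rintro ⟨k', ⟨π, f, b, c, h1, h2, h3, h4⟩, hk⟩
    refine ⟨Function.update π x (max (N.base x) w'), Function.update f e true,
      Function.update b e true, Function.update c e 0, ?_, ?_, ?_, ?_⟩
    · intro v hv
      by_cases hvx : v = x
      · subst hvx; simp
      · have hv' : v ∈ N'.V := by rw [h.V_eq]; exact Finset.mem_erase.2 ⟨hvx, hv⟩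
        rw [Function.update_of_ne hvx]
        have := h1 v hv'
        by_cases hvs : v = N.src e
        · subst hvs
          rw [h.base_src] at this
          omega
        · rwa [h.base_eq v hv' hvs] at this
    · intro e' he
      by_cases he1 : e' = e
      · subst he1
        have := h1 _ hsV
        rw [h.base_src] at this
        simp [h.prof, Profile.single, h.tgt, h.src]
        omega
      · have he' : e' ∈ N'.E := by rw [h.E_eq]; exact Finset.mem_erase.2 ⟨he1, he⟩
        have := h2 e' he'
        rw [h.src_eq e' he', h.tgt_eq e' he', h.prof_eq e' he'] at this
        simpa [he1, (h.only e' he he1).1, (h.only e' he he1).2] using this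
    · rw [h.conn_iff]
      refine ⟨?_, by simp, by simp⟩
      intro u hu v hv
      refine .mono ?_ _ _ (h3 u hu v hv)
      rintro y z ⟨e', he', hs⟩
      exact ⟨e', he', by simpa [(hmE' e' he').2] using hs⟩
    · rw [hE, hV]
      have e1 : ∑ v ∈ N'.V, Function.update π x (max (N.base x) w') v = ∑ v ∈ N'.V, π v :=
        Finset.sum_congr rfl fun v hv => by simp [(hmV' v hv).2]
      have e2 : ∑ e' ∈ N'.E, Function.update c e 0 e' = ∑ e' ∈ N'.E, c e' :=
        Finset.sum_congr rfl fun v hv => by simp [(hmE' v hv).2]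
      rw [e1, e2]
      simp only [Function.update_self]
      omega

end Leaf

/-- Reading an edge backwards changes nothing. -/
theorem reduces_of_flip {N N' : Net} {e : ℕ} (hV : N'.V = N.V) (hE : N'.E = N.E)
    (hsrc : ∀ e' ∈ N.E, e' ≠ e → N'.src e' = N.src e')
    (htgt : ∀ e' ∈ N.E, e' ≠ e → N'.tgt e' = N.tgt e')
    (hsrc' : N'.src e = N.tgt e) (htgt' : N'.tgt e = N.src e)
    (hbase : ∀ v ∈ N.V, N'.base v = N.base v)
    (hprof : ∀ e' ∈ N.E, e' ≠ e → N'.prof e' = N.prof e')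
    (hO : N'.prof e = (N.prof e).flip) : N.Reduces N' 0 := by
  have hstep : ∀ f b, N'.Step f b =
      N.Step (Function.update f e (b e)) (Function.update b e (f e)) := by
    intro f b
    funext u v
    unfold Step
    rw [hE]
    refine propext (exists_congr fun e' => and_congr_right fun he => ?_)
    by_cases h : e' = e
    · subst h
      rw [hsrc', htgt']
      simp only [Function.update_self]
      tauto
    · rw [hsrc e' he h, htgt e' he h]
      simp [h]
  have hconn : ∀ f b, N'.Conn f b ↔
      N.Conn (Function.update f e (b e)) (Function.update b e (f e)) := by
    intro f b
    unfold Conn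
    rw [hV, hstep]
  intro k
  constructor
  · rintro ⟨π, f, b, c, h1, h2, h3, h4⟩
    refine ⟨k, ⟨π, Function.update f e (b e), Function.update b e (f e), c, ?_, ?_, ?_, ?_⟩, by
      omega⟩
    · intro v hv
      rw [hV] at hv
      rw [hbase v hv]
      exact h1 v hv
    · intro e' he'
      rw [hE] at he'
      by_cases h : e' = e
      · subst h
        simpa [hsrc', htgt', hO, Profile.flip] using h2 e' he'
      · simpa [h, hprof e' he' h, hsrc e' he' h, htgt e' he' h] using h2 e' he'
    · rw [hconn]
      simpa using h3
    · rwa [hV, hE]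
  · rintro ⟨k', ⟨π, f, b, c, h1, h2, h3, h4⟩, hk⟩
    refine ⟨π, Function.update f e (b e), Function.update b e (f e), c, ?_, ?_, ?_, ?_⟩
    · intro v hv
      rw [← hbase v hv]
      exact h1 v (hV ▸ hv)
    · intro e' he'
      have := h2 e' (hE ▸ he')
      by_cases h : e' = e
      · subst h
        simpa [hsrc', htgt', hO, Profile.flip] using this
      · simpa [h, hprof e' he' h, hsrc e' he' h, htgt e' he' h] using this
    · exact (hconn f b).1 h3
    · rw [hV, hE] at h4
      omega

end Net


/-! ## A small structured language compiled to the word RAM -/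

namespace RAM

/-- Expressions over registers and arrays. -/
inductive Expr : Type
  | var (x : ℕ)
  | const (k : ℕ)
  | add (a b : Expr)
  | sub (a b : Expr)
  | load (a : ℕ) (i : Expr)

namespace Expr

/-- The value of an expression. -/
def eval (s : State) : Expr → ℕ
  | var x => s.reg x
  | const k => k
  | add a b => a.eval s + b.eval s
  | sub a b => a.eval s - b.eval s
  | load a i => s.arr a (i.eval s)

/-- No intermediate result exceeds `B`. -/
def Safe (B : ℕ) (s : State) : Expr → Prop
  | var _ => True
  | const k => k ≤ B
  | add a b => a.Safe B s ∧ b.Safe B s ∧ a.eval s + b.eval s ≤ B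
  | sub a b => a.Safe B s ∧ b.Safe B s
  | load _ i => i.Safe B s

/-- Only registers below `T` are read. -/
def ok (T : ℕ) : Expr → Bool
  | var x => x < T
  | const _ => true
  | add a b => a.ok T && b.ok T
  | sub a b => a.ok T && b.ok T
  | load _ i => i.ok T

/-- Code that evaluates an expression into register `k`, using the registers from `k` on. -/
def code (k : ℕ) : Expr → Prog
  | var x => .move k x
  | const c => .const k c
  | add a b => .seq (a.code k) (.seq (b.code (k + 1)) (.add k k (k + 1)))
  | sub a b => .seq (a.code k) (.seq (b.code (k + 1)) (.sub k k (k + 1)))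
  | load a i => .seq (i.code k) (.load k a k)

/-- The running time of `code`. -/
def time : Expr → ℕ
  | var _ => 1
  | const _ => 1
  | add a b => a.time + (b.time + 1)
  | sub a b => a.time + (b.time + 1)
  | load _ i => i.time + 1

/-- The larger of two values. -/
def max (a b : Expr) : Expr := add a (sub b a)

end Expr

/-- The states agree in all arrays and all registers below `T`. -/
def Agree (T : ℕ) (s r : State) : Prop := (∀ x < T, r.reg x = s.reg x) ∧ r.arr = s.arr

theorem Agree.refl (T : ℕ) (s : State) : Agree T s s := ⟨fun _ _ => rfl, rfl⟩

theorem State.reg_setReg (s : State) (x v y : ℕ) :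
    (s.setReg x v).reg y = if y = x then v else s.reg y := by
  simp [State.setReg, Function.update_apply]

theorem State.arr_setReg (s : State) (x v : ℕ) : (s.setReg x v).arr = s.arr := rfl

theorem State.reg_setArr (s : State) (a i v : ℕ) : (s.setArr a i v).reg = s.reg := rfl

theorem State.arr_setArr (s : State) (a i v a' : ℕ) :
    (s.setArr a i v).arr a' = if a' = a then Function.update (s.arr a) i v else s.arr a' := by
  simp [State.setArr, Function.update_apply]

/-- Code for register `k` leaves all registers below `k` alone. Hence a left operand kept in
register `k` survives the evaluation of the right one in register `k + 1`. -/
theorem Expr.exec_code {B T : ℕ} {s : State} (e : Expr) : ∀ {k : ℕ} {r : State}, e.ok T = true →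
    T ≤ k → Agree T s r → e.Safe B s → ∃ r', Exec B (e.code k) r e.time r' ∧
      r'.reg k = e.eval s ∧ r'.arr = r.arr ∧ ∀ x < k, r'.reg x = r.reg x := by
  have agree : ∀ {k : ℕ} {r r' : State}, T ≤ k → Agree T s r → r'.arr = r.arr →
      (∀ x < k, r'.reg x = r.reg x) → Agree T s r' := fun hk h ha hr =>
    ⟨fun x hx => (hr x (by omega)).trans (h.1 x hx), ha.trans h.2⟩
  induction e with
  | var x =>
    intro k r ho hk h hs
    simp only [ok, decide_eq_true_eq] at ho
    exact ⟨_, .move r k x, by simp [State.reg_setReg, eval, h.1 x ho], rfl,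
      fun x hx => by simp [State.reg_setReg, hx.ne]⟩
  | const c =>
    intro k r ho hk h hs
    exact ⟨_, .const r k c hs, by simp [State.reg_setReg, eval], rfl,
      fun x hx => by simp [State.reg_setReg, hx.ne]⟩
  | add a b iha ihb =>
    intro k r ho hk h hs
    simp only [ok, Bool.and_eq_true] at ho
    obtain ⟨r₁, h1, h2, h3, h4⟩ := iha ho.1 hk h hs.1
    obtain ⟨r₂, h5, h6, h7, h8⟩ := ihb ho.2 (by omega : T ≤ k + 1) (agree hk h h3 h4) hs.2.1
    have h9 : r₂.reg k = a.eval s := (h8 k (by omega)).trans h2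
    refine ⟨_, .seq h1 (.seq h5 (.add r₂ k k (k + 1) ?_)), ?_, h7.trans h3, fun x hx => ?_⟩
    · rw [h9, h6]; exact hs.2.2
    · simp [State.reg_setReg, eval, h9, h6]
    · simp [State.reg_setReg, hx.ne, h8 x (by omega), h4 x hx]
  | sub a b iha ihb =>
    intro k r ho hk h hs
    simp only [ok, Bool.and_eq_true] at ho
    obtain ⟨r₁, h1, h2, h3, h4⟩ := iha ho.1 hk h hs.1
    obtain ⟨r₂, h5, h6, h7, h8⟩ := ihb ho.2 (by omega : T ≤ k + 1) (agree hk h h3 h4) hs.2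
    have h9 : r₂.reg k = a.eval s := (h8 k (by omega)).trans h2
    refine ⟨_, .seq h1 (.seq h5 (.sub r₂ k k (k + 1))), ?_, h7.trans h3, fun x hx => ?_⟩
    · simp [State.reg_setReg, eval, h9, h6]
    · simp [State.reg_setReg, hx.ne, h8 x (by omega), h4 x hx]
  | load a i ih =>
    intro k r ho hk h hs
    obtain ⟨r₁, h1, h2, h3, h4⟩ := ih ho hk h hs
    refine ⟨_, .seq h1 (.load r₁ k a k), ?_, h3, fun x hx => ?_⟩
    · simp [State.reg_setReg, eval, h2, h3, h.2]
    · simp [State.reg_setReg, hx.ne, h4 x hx]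

/-- Loop-free statements. -/
inductive Stmt : Type
  | skip
  | assign (x : ℕ) (e : Expr)
  | store (a : ℕ) (i e : Expr)
  | seq (p q : Stmt)
  | ifLe (e e' : Expr) (p q : Stmt)
  | ifEq (e e' : Expr) (p q : Stmt)

namespace Stmt

/-- Only registers below `T` are used. -/
def ok (T : ℕ) : Stmt → Bool
  | skip => true
  | assign x e => x < T && e.ok T
  | store _ i e => i.ok T && e.ok T
  | seq p q => p.ok T && q.ok T
  | ifLe e e' p q => e.ok T && e'.ok T && p.ok T && q.ok T
  | ifEq e e' p q => e.ok T && e'.ok T && p.ok T && q.ok T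

/-- The program of a statement, using the registers from `T` on as auxiliary memory. -/
def code (T : ℕ) : Stmt → Prog
  | skip => .skip
  | assign x e => .seq (e.code T) (.move x T)
  | store a i e => .seq (i.code T) (.seq (e.code (T + 1)) (.store a T (T + 1)))
  | seq p q => .seq (p.code T) (q.code T)
  | ifLe e e' p q => .seq (e.code T) (.seq (e'.code (T + 1)) (.ifLe T (T + 1) (p.code T)
      (q.code T)))
  | ifEq e e' p q => .seq (e.code T) (.seq (e'.code (T + 1))
      (.ifLe T (T + 1) (.ifLe (T + 1) T (p.code T) (q.code T)) (q.code T)))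

/-- A bound for the running time. -/
def time : Stmt → ℕ
  | skip => 1
  | assign _ e => e.time + 1
  | store _ i e => i.time + (e.time + 1)
  | seq p q => p.time + q.time
  | ifLe e e' p q => e.time + (e'.time + (p.time + q.time + 1))
  | ifEq e e' p q => e.time + (e'.time + (p.time + q.time + 2))

/-- The weakest precondition of a statement on a machine with words up to `B`. -/
def wp (B : ℕ) : Stmt → (State → Prop) → State → Prop
  | skip, Q, s => Q s
  | assign x e, Q, s => e.Safe B s ∧ Q (s.setReg x (e.eval s))
  | store a i e, Q, s => i.Safe B s ∧ e.Safe B s ∧ Q (s.setArr a (i.eval s) (e.eval s))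
  | seq p q, Q, s => p.wp B (q.wp B Q) s
  | ifLe e e' p q, Q, s => e.Safe B s ∧ e'.Safe B s ∧ (e.eval s ≤ e'.eval s → p.wp B Q s) ∧
      (e'.eval s < e.eval s → q.wp B Q s)
  | ifEq e e' p q, Q, s => e.Safe B s ∧ e'.Safe B s ∧ (e.eval s = e'.eval s → p.wp B Q s) ∧
      (e.eval s ≠ e'.eval s → q.wp B Q s)

end Stmt

/-- Started in `s`, the program halts within `t` steps in a state with property `Q`; the registers
from `T` on are ignored. -/
def Runs (B T : ℕ) (p : Prog) (s : State) (t : ℕ) (Q : State → Prop) : Prop :=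
  ∀ r, Agree T s r → ∃ t' r' s', Exec B p r t' r' ∧ t' ≤ t ∧ Agree T s' r' ∧ Q s'

theorem Runs.seq {B T : ℕ} {p q : Prog} {s : State} {t t' : ℕ} {Q Q' : State → Prop}
    (hp : Runs B T p s t Q) (hq : ∀ s', Q s' → Runs B T q s' t' Q') :
    Runs B T (.seq p q) s (t + t') Q' := by
  intro r hr
  obtain ⟨t₁, r₁, s₁, h1, h2, h3, h4⟩ := hp r hr
  obtain ⟨t₂, r₂, s₂, h5, h6, h7, h8⟩ := hq s₁ h4 r₁ h3
  exact ⟨_, r₂, s₂, .seq h1 h5, by omega, h7, h8⟩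

theorem Runs.mono {B T : ℕ} {p : Prog} {s : State} {t t' : ℕ} {Q Q' : State → Prop}
    (hp : Runs B T p s t Q) (ht : t ≤ t') (hQ : ∀ s', Q s' → Q' s') : Runs B T p s t' Q' := by
  intro r hr
  obtain ⟨t₁, r₁, s₁, h1, h2, h3, h4⟩ := hp r hr
  exact ⟨t₁, r₁, s₁, h1, h2.trans ht, h3, hQ _ h4⟩

/-- A loop whose body takes at most `K` steps and decreases `Φ`. -/
theorem Runs.whileLt {B T x y K : ℕ} {p : Prog} (I : State → Prop) (Φ : State → ℕ) (hx : x < T)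
    (hy : y < T) (hbody : ∀ s, I s → s.reg x < s.reg y →
      Runs B T p s K fun s' => I s' ∧ Φ s' < Φ s) {s : State} (hs : I s) :
    Runs B T (.whileLt x y p) s ((K + 1) * Φ s + 1) fun s' => I s' ∧ s'.reg y ≤ s'.reg x := by
  suffices ∀ N s, Φ s ≤ N → I s → Runs B T (.whileLt x y p) s ((K + 1) * N + 1)
      fun s' => I s' ∧ s'.reg y ≤ s'.reg x from this _ s le_rfl hs
  intro N
  induction N with
  | zero =>
    intro s hN hI r hr
    -- At potential zero the body cannot run, since it would have to lower the potential.
    by_cases hxy : s.reg x < s.reg y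
    · obtain ⟨_, _, s', _, _, _, _, h⟩ := hbody s hI hxy r hr
      omega
    · exact ⟨1, r, s, .while_done (by rw [hr.1 x hx, hr.1 y hy]; omega), by omega, hr, hI,
        by omega⟩
  | succ N ih =>
    intro s hN hI r hr
    by_cases hxy : s.reg x < s.reg y
    · obtain ⟨t₁, r₁, s₁, h1, h2, h3, h4, h5⟩ := hbody s hI hxy r hr
      obtain ⟨t₂, r₂, s₂, h6, h7, h8, h9⟩ := ih s₁ (by omega) h4 r₁ h3
      refine ⟨_, r₂, s₂, .while_step (by rwa [hr.1 x hx, hr.1 y hy]) h1 h6, ?_, h8, h9⟩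
      rw [mul_add]
      omega
    · exact ⟨1, r, s, .while_done (by rw [hr.1 x hx, hr.1 y hy]; omega), by omega, hr, hI,
        by omega⟩

/-- Soundness of the weakest preconditions: all later correctness proofs about straight-line code
are statements about `wp`. The time is only a bound, because `time` charges both branches of a
conditional. -/
theorem Stmt.runs {B T : ℕ} (p : Stmt) : ∀ {s : State} {Q : State → Prop}, p.ok T = true →
    p.wp B Q s → Runs B T (p.code T) s p.time Q := by
  induction p with
  | skip => exact fun _ h r hr => ⟨1, r, _, .skip r, le_rfl, hr, h⟩
  | assign x e =>
    intro s Q ho h r hr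
    simp only [ok, Bool.and_eq_true, decide_eq_true_eq] at ho
    obtain ⟨r₁, h1, h2, h3, h4⟩ := e.exec_code ho.2 le_rfl hr h.1
    refine ⟨_, _, s.setReg x (e.eval s), .seq h1 (.move r₁ x T), le_rfl, ⟨fun y hy => ?_,
        h3.trans hr.2⟩, h.2⟩
    simp [State.reg_setReg, h2, h4 y hy, hr.1 y hy]
  | store a i e =>
    intro s Q ho h r hr
    simp only [ok, Bool.and_eq_true] at ho
    obtain ⟨r₁, h1, h2, h3, h4⟩ := i.exec_code ho.1 le_rfl hr h.1
    obtain ⟨r₂, h5, h6, h7, h8⟩ := e.exec_code (k := T + 1) (r := r₁) ho.2 (by omega)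
      ⟨fun x hx => (h4 x hx).trans (hr.1 x hx), h3.trans hr.2⟩ h.2.1
    refine ⟨_, _, s.setArr a (i.eval s) (e.eval s), .seq h1 (.seq h5 (.store r₂ a T (T + 1))),
      le_rfl, ⟨fun y hy => ?_, ?_⟩, h.2.2⟩
    · simp [State.reg_setArr, h8 y (by omega), h4 y hy, hr.1 y hy]
    · rw [h6, h8 T (by omega), h2]
      simp [State.setArr, h7, h3, hr.2]
  | seq p q ihp ihq =>
    intro s Q ho h
    simp only [ok, Bool.and_eq_true] at ho
    exact (ihp ho.1 h).seq fun s' h' => ihq ho.2 h'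
  | ifLe e e' p q ihp ihq =>
    intro s Q ho h r hr
    simp only [ok, Bool.and_eq_true] at ho
    obtain ⟨⟨⟨ho1, ho2⟩, ho3⟩, ho4⟩ := ho
    obtain ⟨r₁, h1, h2, h3, h4⟩ := e.exec_code ho1 le_rfl hr h.1
    obtain ⟨r₂, h5, h6, h7, h8⟩ := e'.exec_code (k := T + 1) (r := r₁) ho2 (by omega)
      ⟨fun x hx => (h4 x hx).trans (hr.1 x hx), h3.trans hr.2⟩ h.2.1
    have hT : r₂.reg T = e.eval s := (h8 T (by omega)).trans h2
    have hr₂ : Agree T s r₂ :=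
      ⟨fun x hx => (h8 x (by omega)).trans ((h4 x hx).trans (hr.1 x hx)), h7.trans (h3.trans hr.2)⟩
    rcases le_or_gt (e.eval s) (e'.eval s) with hle | hlt
    · obtain ⟨t₃, r₃, s₃, h9, h10, h11, h12⟩ := ihp ho3 (h.2.2.1 hle) r₂ hr₂
      exact ⟨_, r₃, s₃, .seq h1 (.seq h5 (.ifLe_true (by rwa [hT, h6]) h9)),
        by simp only [time]; omega, h11, h12⟩
    · obtain ⟨t₃, r₃, s₃, h9, h10, h11, h12⟩ := ihq ho4 (h.2.2.2 hlt) r₂ hr₂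
      exact ⟨_, r₃, s₃, .seq h1 (.seq h5 (.ifLe_false (by rwa [hT, h6]) h9)),
        by simp only [time]; omega, h11, h12⟩
  | ifEq e e' p q ihp ihq =>
    intro s Q ho h r hr
    simp only [ok, Bool.and_eq_true] at ho
    obtain ⟨⟨⟨ho1, ho2⟩, ho3⟩, ho4⟩ := ho
    obtain ⟨r₁, h1, h2, h3, h4⟩ := e.exec_code ho1 le_rfl hr h.1
    obtain ⟨r₂, h5, h6, h7, h8⟩ := e'.exec_code (k := T + 1) (r := r₁) ho2 (by omega)
      ⟨fun x hx => (h4 x hx).trans (hr.1 x hx), h3.trans hr.2⟩ h.2.1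
    have hT : r₂.reg T = e.eval s := (h8 T (by omega)).trans h2
    have hr₂ : Agree T s r₂ :=
      ⟨fun x hx => (h8 x (by omega)).trans ((h4 x hx).trans (hr.1 x hx)), h7.trans (h3.trans hr.2)⟩
    by_cases heq : e.eval s = e'.eval s
    · obtain ⟨t₃, r₃, s₃, h9, h10, h11, h12⟩ := ihp ho3 (h.2.2.1 heq) r₂ hr₂
      exact ⟨_, r₃, s₃, .seq h1 (.seq h5 (.ifLe_true (by rw [hT, h6]; omega)
        (.ifLe_true (by rw [hT, h6]; omega) h9))), by simp only [time]; omega, h11, h12⟩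
    · obtain ⟨t₃, r₃, s₃, h9, h10, h11, h12⟩ := ihq ho4 (h.2.2.2 heq) r₂ hr₂
      rcases lt_or_gt_of_ne heq with hlt | hlt
      · exact ⟨_, r₃, s₃, .seq h1 (.seq h5 (.ifLe_true (by rw [hT, h6]; omega)
          (.ifLe_false (by rw [hT, h6]; omega) h9))), by simp only [time]; omega, h11, h12⟩
      · exact ⟨_, r₃, s₃, .seq h1 (.seq h5 (.ifLe_false (by rw [hT, h6]; omega) h9)),
          by simp only [time]; omega, h11, h12⟩

end RAM


/-! ### Degrees, sums of incident edges, and subdivision -/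

namespace Net

/-- The sum of `φ` over the edges at `v`; loops count twice. -/
def load (N : Net) (φ : ℕ → ℕ) (v : ℕ) : ℕ :=
  ∑ e ∈ N.E, φ e * ((if N.src e = v then 1 else 0) + if N.tgt e = v then 1 else 0)

theorem load_eq_add (N : Net) (φ : ℕ → ℕ) (v : ℕ) {e : ℕ} (he : e ∈ N.E) :
    N.load φ v = φ e * ((if N.src e = v then 1 else 0) + if N.tgt e = v then 1 else 0) +
      ∑ e ∈ N.E.erase e, φ e * ((if N.src e = v then 1 else 0) + if N.tgt e = v then 1 else 0) :=
  (Finset.add_sum_erase _ _ he).symm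

theorem load_eq_zero {N : Net} (hN : N.WF) (φ : ℕ → ℕ) {v : ℕ} (hv : v ∉ N.V) :
    N.load φ v = 0 := by
  refine Finset.sum_eq_zero fun e he => ?_
  have := hN e he
  rw [if_neg (by rintro rfl; exact hv this.1), if_neg (by rintro rfl; exact hv this.2)]
  rfl

theorem sum_load {N : Net} (hN : N.WF) : ∑ v ∈ N.V, N.load (fun _ => 1) v = 2 * N.E.card := by
  unfold load
  rw [Finset.sum_comm, Finset.card_eq_sum_ones, Finset.mul_sum]
  refine Finset.sum_congr rfl fun e he => ?_
  simp [Finset.sum_add_distrib, hN e he]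

theorem load_of_isolated {N : Net} {v e : ℕ} (φ : ℕ → ℕ) (he : e ∈ N.E)
    (h : ∀ e' ∈ N.E, e' ≠ e → N.src e' ≠ v ∧ N.tgt e' ≠ v) :
    N.load φ v = φ e * ((if N.src e = v then 1 else 0) + if N.tgt e = v then 1 else 0) := by
  rw [N.load_eq_add φ v he, Finset.sum_eq_zero, add_zero]
  intro e' he'
  obtain ⟨h1, h2⟩ := Finset.mem_erase.1 he'
  simp [h e' h2 h1]

/-- Loops count twice, so degree one means a single incident edge that is not a loop. The sum of the
incident edge numbers then has one term, and so is the number of that edge. -/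
theorem exists_of_load_eq_one {N : Net} {x : ℕ} (h : N.load (fun _ => 1) x = 1) :
    ∃ e ∈ N.E, N.load id x = e ∧ (N.src e = x ∧ N.tgt e ≠ x ∨ N.src e ≠ x ∧ N.tgt e = x) ∧
      ∀ e' ∈ N.E, e' ≠ e → N.src e' ≠ x ∧ N.tgt e' ≠ x := by
  obtain ⟨e, he, hne⟩ : ∃ e ∈ N.E, 1 * ((if N.src e = x then 1 else 0) +
      if N.tgt e = x then 1 else 0) ≠ 0 := by
    refine Finset.exists_ne_zero_of_sum_ne_zero (?_ : N.load (fun _ => 1) x ≠ 0)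
    omega
  have h1 := N.load_eq_add (fun _ => 1) x he
  have h2 : ∀ e' ∈ N.E, e' ≠ e → N.src e' ≠ x ∧ N.tgt e' ≠ x := by
    have : ∑ e ∈ N.E.erase e, 1 * ((if N.src e = x then 1 else 0) +
        if N.tgt e = x then 1 else 0) = 0 := by omega
    intro e' he' hne'
    have := Finset.sum_eq_zero_iff.1 this e' (Finset.mem_erase.2 ⟨hne', he'⟩)
    constructor <;> intro h3 <;> simp [h3] at this
  have h3 := load_of_isolated (fun _ => 1) he h2
  have h4 : (N.src e = x ∧ N.tgt e ≠ x ∨ N.src e ≠ x ∧ N.tgt e = x) := by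
    rw [h3] at h
    split_ifs at h with h5 h6 h6 <;> simp_all
  refine ⟨e, he, ?_, h4, h2⟩
  rw [load_of_isolated id he h2]
  rcases h4 with ⟨h5, h6⟩ | ⟨h5, h6⟩ <;> simp [h5, h6]

/-- After deletion of the known edge `e` the vertex has degree one, and `exists_of_load_eq_one`
applies; the other edge is the stored sum minus `e`. -/
theorem exists_of_load_eq_two {N : Net} {x e : ℕ} (h : N.load (fun _ => 1) x = 2) (he : e ∈ N.E)
    (ht : N.tgt e = x) (hs : N.src e ≠ x) :
    ∃ e' ∈ N.E, e' ≠ e ∧ N.load id x = e + e' ∧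
      (N.src e' = x ∧ N.tgt e' ≠ x ∨ N.src e' ≠ x ∧ N.tgt e' = x) ∧
      ∀ e'' ∈ N.E, e'' ≠ e → e'' ≠ e' → N.src e'' ≠ x ∧ N.tgt e'' ≠ x := by
  let M : Net := { N with E := N.E.erase e }
  have h1 : ∀ φ, N.load φ x = φ e + M.load φ x := by
    intro φ
    rw [N.load_eq_add φ x he]
    simp [ht, hs, load, M]
  have h2 : M.load (fun _ => 1) x = 1 := by have := h1 fun _ => 1; omega
  obtain ⟨e', he', h3, h4, h5⟩ := exists_of_load_eq_one h2
  obtain ⟨h6, h7⟩ := Finset.mem_erase.1 he'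
  refine ⟨e', h7, h6, by rw [h1, h3]; rfl, h4, fun e'' h8 h9 h10 => ?_⟩
  exact h5 e'' (Finset.mem_erase.2 ⟨h9, h8⟩) h10

/-- At the far end of `e₂` the edge `e₁` takes the place of `e₂`. For constant `φ` the two
correction terms agree, so degrees are kept. The additive form avoids truncated subtraction. -/
theorem Series.load {N N' : Net} {x e₁ e₂ : ℕ} (h : Series N N' x e₁ e₂) (φ : ℕ → ℕ) {v : ℕ}
    (hv : v ≠ x) : N'.load φ v + φ e₂ * (if N.tgt e₂ = v then 1 else 0) =
      N.load φ v + φ e₁ * (if N.tgt e₂ = v then 1 else 0) := by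
  rw [N.load_eq_add φ v h.mem₂, N'.load_eq_add φ v h.mem₁', h.src_eq _ h.mem₁', h.tgt₁_eq,
    h.src₂, if_neg hv.symm]
  have h1 : N.E.erase e₂ = N'.E := h.E_eq.symm
  rw [h1, ← Finset.add_sum_erase _ _ h.mem₁', h.tgt₁, if_neg hv.symm]
  have : ∑ e ∈ N'.E.erase e₁, φ e * ((if N'.src e = v then 1 else 0) +
      if N'.tgt e = v then 1 else 0) = ∑ e ∈ N'.E.erase e₁, φ e *
        ((if N.src e = v then 1 else 0) + if N.tgt e = v then 1 else 0) :=
    Finset.sum_congr rfl fun e he => by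
      obtain ⟨h2, h3⟩ := Finset.mem_erase.1 he
      rw [h.src_eq e h3, h.tgt_eq e h3 h2]
  rw [this]
  ring

theorem Leaf.load {N N' : Net} {x e w w' : ℕ} (h : Leaf N N' x e w w') (φ : ℕ → ℕ) {v : ℕ}
    (hv : v ≠ x) : N'.load φ v + φ e * (if N.src e = v then 1 else 0) = N.load φ v := by
  rw [N.load_eq_add φ v h.mem, h.tgt, if_neg hv.symm, ← h.E_eq]
  have : N'.load φ v = ∑ e ∈ N'.E, φ e *
        ((if N.src e = v then 1 else 0) + if N.tgt e = v then 1 else 0) :=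
    Finset.sum_congr rfl fun e he => by rw [h.src_eq e he, h.tgt_eq e he]
  rw [this]
  ring

/-- In a strongly connected network, a vertex whose only edge is a loop is the only vertex. -/
theorem Conn.eq_singleton {N : Net} {f b : ℕ → Bool} (hc : N.Conn f b) {x : ℕ}
    (hx : x ∈ N.V) (h : ∀ e ∈ N.E, N.src e = x ↔ N.tgt e = x) : N.V = {x} := by
  refine Finset.eq_singleton_iff_unique_mem.2 ⟨hx, fun v hv => ?_⟩
  have key : ∀ v, Relation.ReflTransGen (N.Step f b) x v → v = x := by
    intro v hxv
    induction hxv with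
    | refl => rfl
    | tail _ hyz ih =>
      subst ih
      obtain ⟨e, he, ⟨_, h1, rfl⟩ | ⟨_, h1, rfl⟩⟩ := hyz
      · exact (h e he).1 h1
      · exact (h e he).2 h1
  exact key v (hc x hx v hv)

/-- Subdivision of the edge `i` by the vertex `y`; the new second half is `f`. -/
def split (N : Net) (i y f : ℕ) (O O' : Profile) : Net where
  V := insert y N.V
  E := insert f N.E
  src := Function.update N.src f y
  tgt := Function.update (Function.update N.tgt f (N.tgt i)) i y
  base := N.base
  prof := Function.update (Function.update N.prof f O') i O

/-- Subdividing an edge undoes the joining of two edges, so the subdivided network is the larger one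
of a `Series` pair and needs no reduction proof of its own. -/
theorem split_series {N : Net} (hN : N.WF) {i y f : ℕ} (hi : i ∈ N.E) (hy : y ∉ N.V)
    (hf : f ∉ N.E) (O O' : Profile) : Series (N.split i y f O O') N y i f := by
  have hif : i ≠ f := by rintro rfl; exact hf hi
  have hne : ∀ e ∈ N.E, e ≠ f := by rintro e he rfl; exact hf he
  have hsy : ∀ e ∈ N.E, N.src e ≠ y := by rintro e he rfl; exact hy (hN e he).1
  have hty : ∀ e ∈ N.E, N.tgt e ≠ y := by rintro e he rfl; exact hy (hN e he).2
  constructor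
  case wf =>
    intro e he
    simp only [split, Finset.mem_insert] at he ⊢
    by_cases h1 : e = f
    · subst h1
      simp [hif.symm, (hN i hi).2]
    · have he := he.resolve_left h1
      by_cases h2 : e = i
      · subst h2; simp [h1, (hN e he).1]
      · simp [h1, h2, (hN e he).1, (hN e he).2]
  case ne => exact hif
  case only =>
    intro e he h1 h2
    have he := (Finset.mem_insert.1 he).resolve_left h2
    simp [split, h1, h2, hsy e he, hty e he]
  case V_eq => simp [split, hy]
  case E_eq => simp [split, hf]
  case src_eq => intro e he; simp [split, hne e he]
  case tgt_eq => intro e he h; simp [split, hne e he, h]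
  case prof_eq => intro e he h; simp [split, hne e he, h]
  all_goals simp [split, hif, hif.symm, hi, hsy i hi, hty i hi]

theorem split_reduces {N : Net} (hN : N.WF) {i y f : ℕ} (hi : i ∈ N.E) (hy : y ∉ N.V)
    (hf : f ∉ N.E) (hb : N.base y = 0) {O O' : Profile}
    (hO : (Profile.comp 0 O O').Shift (N.prof i) 0) : (N.split i y f O O').Reduces N 0 := by
  have hif : i ≠ f := by rintro rfl; exact hf hi
  refine (split_series hN hi hy hf O O').reduces ?_
  simpa [split, hb, hif.symm] using hO

end Net

/-! ## The data structure of the algorithm -/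

/-- A network as it is stored in memory. An edge of kind `1` is a single edge, an edge of kind `2`
stands for a path, an edge of kind `0` has been removed. -/
structure Data where
  nv : ℕ
  ne : ℕ
  kind : ℕ → ℕ
  src : ℕ → ℕ
  tgt : ℕ → ℕ
  ws : ℕ → ℕ
  wt : ℕ → ℕ
  A : ℕ → ℕ
  B : ℕ → ℕ
  a₀ : ℕ → ℕ
  b₀ : ℕ → ℕ
  a₁ : ℕ → ℕ
  b₁ : ℕ → ℕ
  dead : ℕ → ℕ
  base : ℕ → ℕ
  deg : ℕ → ℕ
  inc : ℕ → ℕ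

namespace Data

open Function

/-- The network that is stored. -/
def net (D : Data) : Net where
  V := (Finset.range D.nv).filter fun v => D.dead v = 0
  E := (Finset.range D.ne).filter fun e => D.kind e ≠ 0
  src := D.src
  tgt := D.tgt
  base := D.base
  prof e := if D.kind e = 1 then .single (D.ws e) (D.wt e)
    else .long (D.ws e) (D.wt e) (D.A e) (D.B e) (D.a₀ e) (D.b₀ e) (D.a₁ e + D.b₁ e)

theorem mem_V {D : Data} {v : ℕ} : v ∈ D.net.V ↔ v < D.nv ∧ D.dead v = 0 := by simp [net]

theorem mem_E {D : Data} {e : ℕ} : e ∈ D.net.E ↔ e < D.ne ∧ D.kind e ≠ 0 := by simp [net]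

/-- The invariants of the data structure. -/
structure Core (D : Data) : Prop where
  wf : D.net.WF
  simple : ∀ e ∈ D.net.E, D.kind e = 1 → D.src e ≠ D.tgt e
  par : ∀ e ∈ D.net.E, ∀ e' ∈ D.net.E, D.kind e = 1 → D.kind e' = 1 →
    (D.src e = D.src e' ∧ D.tgt e = D.tgt e') ∨ (D.src e = D.tgt e' ∧ D.tgt e = D.src e') → e = e'
  kind_le : ∀ e, D.kind e ≤ 2
  par_a : ∀ e ∈ D.net.E, D.kind e = 2 → D.a₀ e + D.a₁ e ≤ D.A e
  par_b : ∀ e ∈ D.net.E, D.kind e = 2 → D.b₀ e + D.b₁ e ≤ D.B e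
  dead_fresh : ∀ v, D.nv ≤ v → D.dead v = 0
  base_fresh : ∀ v, D.nv ≤ v → D.base v = 0

/-- The degrees and the sums of the incident edges are stored correctly. -/
def Degs (D : Data) : Prop :=
  (∀ v, D.deg v = D.net.load (fun _ => 1) v) ∧ ∀ v, D.inc v = D.net.load id v

/-- Reverse the edge `e`. -/
def flip (D : Data) (e : ℕ) : Data :=
  { D with
    src := update D.src e (D.tgt e), tgt := update D.tgt e (D.src e)
    ws := update D.ws e (D.wt e), wt := update D.wt e (D.ws e)
    A := update D.A e (D.B e), B := update D.B e (D.A e)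
    a₀ := update D.a₀ e (D.b₀ e), b₀ := update D.b₀ e (D.a₀ e)
    a₁ := update D.a₁ e (D.b₁ e), b₁ := update D.b₁ e (D.a₁ e) }

section flip

variable {D : Data} {e : ℕ}

theorem flip_reduces : D.net.Reduces (D.flip e).net 0 := by
  refine Net.reduces_of_flip (e := e) rfl rfl ?_ ?_ ?_ ?_ ?_ ?_ ?_
  case refine_7 =>
    simp only [net, flip, update_self]
    split_ifs
    · rw [Profile.flip_single]
    · rw [Profile.flip_long, add_comm]
  case refine_6 => intro e' he h; simp [net, flip, h]
  all_goals simp +contextual [net, flip]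

theorem flip_load (φ : ℕ → ℕ) (v : ℕ) : (D.flip e).net.load φ v = D.net.load φ v := by
  refine Finset.sum_congr rfl fun e' he => ?_
  by_cases h : e' = e
  · subst h; simp [net, flip, add_comm]
  · simp [net, flip, h]

theorem Degs.flip (h : D.Degs) : (D.flip e).Degs :=
  ⟨fun v => (h.1 v).trans (flip_load _ v).symm, fun v => (h.2 v).trans (flip_load _ v).symm⟩

theorem Core.flip (h : D.Core) : (D.flip e).Core where
  wf := by
    intro e' he
    have := h.wf e' he
    change (D.flip e).src e' ∈ D.net.V ∧ (D.flip e).tgt e' ∈ D.net.V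
    change D.src e' ∈ D.net.V ∧ D.tgt e' ∈ D.net.V at this
    by_cases h : e' = e
    · subst h; simpa only [Data.flip, update_self] using this.symm
    · simpa only [Data.flip, update_of_ne h] using this
  simple := by
    intro e' he hk
    have := h.simple e' he hk
    by_cases h : e' = e
    · subst h; simpa [net, Data.flip] using this.symm
    · simpa [net, Data.flip, h] using this
  par := by
    intro e₁ h1 e₂ h2 h3 h4 h5
    refine h.par e₁ h1 e₂ h2 h3 h4 ?_
    by_cases h6 : e₁ = e <;> by_cases h7 : e₂ = e <;> simp [Data.flip, h6, h7] at h5 ⊢ <;> tauto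
  kind_le := h.kind_le
  par_a := by
    intro e' he hk
    have h1 := h.par_a e' he hk
    have h2 := h.par_b e' he hk
    by_cases h : e' = e
    · subst h; simpa [net, Data.flip] using h2
    · simpa [net, Data.flip, h] using h1
  par_b := by
    intro e' he hk
    have h1 := h.par_a e' he hk
    have h2 := h.par_b e' he hk
    by_cases h : e' = e
    · subst h; simpa [net, Data.flip] using h1
    · simpa [net, Data.flip, h] using h2
  dead_fresh := h.dead_fresh
  base_fresh := h.base_fresh

end flip

/-- Remove the leaf `x` at the target of the edge `e`. -/
def prune (D : Data) (x e : ℕ) : Data :=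
  { D with
    kind := update D.kind e 0
    dead := update D.dead x 1
    base := update D.base (D.src e) (max (D.base (D.src e)) (D.ws e))
    deg := update (update D.deg x 0) (D.src e) (D.deg (D.src e) - 1)
    inc := update (update D.inc x 0) (D.src e) (D.inc (D.src e) - e) }

section prune

variable {D : Data} {x e : ℕ}

theorem prune_V : (D.prune x e).net.V = D.net.V.erase x := by
  ext v
  simp only [Finset.mem_erase, mem_V]
  by_cases h : v = x <;> simp [prune, h]

theorem prune_E : (D.prune x e).net.E = D.net.E.erase e := by
  ext v
  simp only [Finset.mem_erase, mem_E]
  by_cases h : v = e <;> simp [prune, h]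

theorem prune_leaf (hD : D.Core) (he : e ∈ D.net.E) (hk : D.kind e = 1) (ht : D.tgt e = x)
    (ho : ∀ e' ∈ D.net.E, e' ≠ e → D.src e' ≠ x ∧ D.tgt e' ≠ x) :
    Net.Leaf D.net (D.prune x e).net x e (D.ws e) (D.wt e) where
  wf := hD.wf
  memV := ht ▸ (hD.wf e he).2
  mem := he
  tgt := ht
  src := ht ▸ hD.simple e he hk
  prof := by simp [net, hk]
  only := ho
  V_eq := prune_V
  E_eq := prune_E
  src_eq _ _ := rfl
  tgt_eq _ _ := rfl
  base_eq v _ hne := update_of_ne hne _ _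
  base_src := update_self ..
  prof_eq e' he' := by
    rw [prune_E, Finset.mem_erase] at he'
    simp [net, prune, he'.1]

theorem Core.prune (hD : D.Core) (he : e ∈ D.net.E) (hk : D.kind e = 1) (ht : D.tgt e = x)
    (ho : ∀ e' ∈ D.net.E, e' ≠ e → D.src e' ≠ x ∧ D.tgt e' ≠ x) : (D.prune x e).Core := by
  have hk' : ∀ {e' k}, k ≠ 0 → (D.prune x e).kind e' = k → D.kind e' = k := by
    intro e' k hk h
    by_cases h' : e' = e
    · simp [Data.prune, h'] at h; exact absurd h.symm hk
    · simpa [Data.prune, h'] using h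
  have hE : ∀ {e'}, e' ∈ (D.prune x e).net.E → e' ∈ D.net.E := fun h => by
    rw [prune_E] at h; exact Finset.mem_of_mem_erase h
  have hx := mem_V.1 (hD.wf e he).2
  have hs := mem_V.1 (hD.wf e he).1
  refine ⟨(prune_leaf hD he hk ht ho).wf', fun e' h1 h2 => hD.simple e' (hE h1) (hk' (by simp) h2),
    fun e₁ h1 e₂ h2 h3 h4 h5 => hD.par e₁ (hE h1) e₂ (hE h2) (hk' (by simp) h3) (hk' (by simp) h4)
      h5, ?_, fun e' h1 h2 => hD.par_a e' (hE h1) (hk' (by simp) h2),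
    fun e' h1 h2 => hD.par_b e' (hE h1) (hk' (by simp) h2), ?_, ?_⟩
  · intro e'
    by_cases h' : e' = e <;> simp [Data.prune, h', hD.kind_le]
  · intro v hv
    change D.nv ≤ v at hv
    have : v ≠ x := by rintro rfl; have := hx.1; simp only [net] at this; omega
    simpa [Data.prune, this] using hD.dead_fresh v hv
  · intro v hv
    change D.nv ≤ v at hv
    have : v ≠ D.src e := by rintro rfl; have := hs.1; simp only [net] at this; omega
    simpa [Data.prune, this] using hD.base_fresh v hv

theorem Degs.prune (h : D.Degs) (hD : D.Core) (he : e ∈ D.net.E) (hk : D.kind e = 1)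
    (ht : D.tgt e = x) (ho : ∀ e' ∈ D.net.E, e' ≠ e → D.src e' ≠ x ∧ D.tgt e' ≠ x) :
    (D.prune x e).Degs := by
  have hl := prune_leaf hD he hk ht ho
  have hsx : D.src e ≠ x := hl.src
  have hx : ∀ φ, (D.prune x e).net.load φ x = 0 := fun φ =>
    Net.load_eq_zero hl.wf' φ (by rw [prune_V]; simp)
  constructor <;> intro v <;> by_cases hv : v = x
  · rw [hv, hx]; simp [Data.prune, hsx.symm]
  · have h1 := hl.load (fun _ => 1) hv
    rw [← h.1 v] at h1
    change _ + 1 * (if D.src e = v then 1 else 0) = _ at h1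
    by_cases hs : D.src e = v
    · have : (D.prune x e).deg v = D.deg v - 1 := by subst hs; simp [Data.prune]
      rw [if_pos hs] at h1
      omega
    · simpa [Data.prune, Ne.symm hs, hv, hs] using h1.symm
  · rw [hv, hx]; simp [Data.prune, hsx.symm]
  · have h1 := hl.load id hv
    rw [← h.2 v] at h1
    change _ + e * (if D.src e = v then 1 else 0) = _ at h1
    by_cases hs : D.src e = v
    · have : (D.prune x e).inc v = D.inc v - e := by subst hs; simp [Data.prune]
      rw [if_pos hs] at h1
      omega
    · simpa [Data.prune, Ne.symm hs, hv, hs] using h1.symm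

end prune

end Data


/-! ### Joining stored edges, and replacing an edge by a path -/

namespace Data

open Function

variable {D : Data} {i e e' : ℕ}

/-- The least power of the target of `e`, if `e` is used backwards. -/
def need (D : Data) (e : ℕ) : ℕ := max (D.base (D.tgt e)) (D.wt e)

/-- The least power of the source of `e`, if `e` is used forwards. -/
def need' (D : Data) (e : ℕ) : ℕ := max (D.base (D.src e)) (D.ws e)

/-- Join the edge `e` to the edge `i`, whose target is the source of `e`. -/
def contract (D : Data) (i e : ℕ) : Data :=
  { D with
    kind := update (update D.kind i 2) e 0
    tgt := update D.tgt i (D.tgt e)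
    wt := update D.wt i (D.wt e)
    A := update D.A i (if D.kind i = 1 then D.need' e - D.need i
      else D.A i + (D.need' e - D.need i))
    B := update D.B i (if D.kind i = 1 then D.need i - D.need' e
      else D.B i + (D.need i - D.need' e))
    a₀ := update D.a₀ i (D.need' e - D.need i)
    b₀ := update D.b₀ i (if D.kind i = 1 then D.need i - D.need' e else D.b₀ i)
    a₁ := update D.a₁ i (if D.kind i = 1 then 0
      else if D.a₀ i + (D.need i - D.need' e) ≤ D.a₁ i + D.b₁ i then D.a₁ i else D.a₀ i)
    b₁ := update D.b₁ i (if D.kind i = 1 then 0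
      else if D.a₀ i + (D.need i - D.need' e) ≤ D.a₁ i + D.b₁ i then D.b₁ i
      else D.need i - D.need' e)
    dead := update D.dead (D.tgt i) 1
    deg := update D.deg (D.tgt i) 0
    inc := update (update D.inc (D.tgt i) 0) (D.tgt e) (D.inc (D.tgt e) + i - e) }

/-- The situation in which `contract` is used. -/
structure Contractible (D : Data) (i e : ℕ) : Prop where
  core : D.Core
  mem_i : i ∈ D.net.E
  mem_e : e ∈ D.net.E
  ne : i ≠ e
  kind_e : D.kind e = 1
  src_e : D.src e = D.tgt i
  src_i : D.src i ≠ D.tgt i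
  tgt_e : D.tgt e ≠ D.tgt i
  only : ∀ e' ∈ D.net.E, e' ≠ i → e' ≠ e → D.src e' ≠ D.tgt i ∧ D.tgt e' ≠ D.tgt i

theorem contract_V : (D.contract i e).net.V = D.net.V.erase (D.tgt i) := by
  ext v
  simp only [Finset.mem_erase, mem_V]
  by_cases h : v = D.tgt i <;> simp [contract, h]

namespace Contractible

variable (h : D.Contractible i e)

include h

theorem E_eq : (D.contract i e).net.E = D.net.E.erase e := by
  ext v
  have hi := (mem_E.1 h.mem_i).2
  simp only [Finset.mem_erase, mem_E]
  by_cases h1 : v = e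
  · simp [contract, h1]
  · by_cases h2 : v = i
    · subst h2; simp [contract, h1, hi]
    · simp [contract, h1, h2]

theorem series : Net.Series D.net (D.contract i e).net (D.tgt i) i e where
  wf := h.core.wf
  memV := (h.core.wf i h.mem_i).2
  mem₁ := h.mem_i
  mem₂ := h.mem_e
  ne := h.ne
  tgt₁ := rfl
  src₂ := h.src_e
  src₁ := h.src_i
  tgt₂ := h.tgt_e
  only := h.only
  V_eq := contract_V
  E_eq := h.E_eq
  src_eq _ _ := rfl
  tgt_eq e' _ hne := update_of_ne hne _ _
  tgt₁_eq := update_self ..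
  base_eq _ _ := rfl
  prof_eq e' he' hne := by
    rw [h.E_eq, Finset.mem_erase] at he'
    simp [net, contract, he'.1, hne]

/-- The updates made by `contract` are the parameters of `Profile.comp_single_single` or
`Profile.comp_long_single`, according to the kind of `i`. The bounds `par_a` and `par_b` supply the
hypotheses of the latter. -/
theorem reduces : D.net.Reduces (D.contract i e).net (min (D.need i) (D.need' e)) := by
  refine h.series.reduces ?_
  have h1 : D.net.prof e = .single (D.ws e) (D.wt e) := if_pos h.kind_e
  have h2 : (D.contract i e).net.prof i = .long (D.ws i) (D.wt e) ((D.contract i e).A i)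
      ((D.contract i e).B i) ((D.contract i e).a₀ i) ((D.contract i e).b₀ i)
      ((D.contract i e).a₁ i + (D.contract i e).b₁ i) := by
    simp [net, contract, h.ne]
  have hq : D.need i = max (D.base (D.tgt i)) (D.wt i) := rfl
  have hr : D.need' e = max (D.base (D.tgt i)) (D.ws e) := by rw [need', h.src_e]
  change (Profile.comp (D.base (D.tgt i)) _ _).Shift _ _
  rw [h1, h2]
  by_cases hk : D.kind i = 1
  · have h3 : D.net.prof i = .single (D.ws i) (D.wt i) := if_pos hk
    rw [h3]
    have := Profile.comp_single_single (D.base (D.tgt i)) (D.ws i) (D.wt i) (D.ws e) (D.wt e)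
    rw [← hq, ← hr] at this
    simpa [contract, hk] using this
  · have h3 : D.net.prof i = _ := if_neg hk
    have hk2 : D.kind i = 2 := by
      have := h.core.kind_le i
      have := (mem_E.1 h.mem_i).2
      omega
    have ha := h.core.par_a i h.mem_i hk2
    have hb := h.core.par_b i h.mem_i hk2
    rw [h3]
    have := Profile.comp_long_single (p := D.base (D.tgt i)) (w := D.ws i) (w' := D.wt i)
      (r := D.ws e) (r' := D.wt e) (A := D.A i) (B := D.B i) (a₀ := D.a₀ i) (b₀ := D.b₀ i)
      (m := D.a₁ i + D.b₁ i) (by omega) (by omega) (by omega)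
    rw [← hq, ← hr] at this
    convert this using 2
    · simp [contract, hk]
    · simp [contract, hk]
    · simp [contract]
    · simp [contract, hk]
    -- The inner gain is stored as a pair, one share for each end of the best inner edge; in both
    -- cases the pair sums to the maximum.
    · simp only [contract, hk, update_self, if_false]
      split_ifs <;> omega

theorem core' : (D.contract i e).Core := by
  have hne := h.ne
  have hk : ∀ {e'}, e' ≠ i → e' ≠ e → (D.contract i e).kind e' = D.kind e' := fun h1 h2 => by
    simp [contract, h1, h2]
  have hki : (D.contract i e).kind i = 2 := by simp [contract, hne]
  have hE : ∀ {e'}, e' ∈ (D.contract i e).net.E → e' ∈ D.net.E ∧ e' ≠ e := fun h1 => by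
    rw [h.E_eq] at h1; exact ⟨Finset.mem_of_mem_erase h1, Finset.ne_of_mem_erase h1⟩
  have hk1 : ∀ {e'}, e' ∈ (D.contract i e).net.E → (D.contract i e).kind e' = 1 →
      e' ∈ D.net.E ∧ D.kind e' = 1 ∧ e' ≠ i := by
    intro e' h1 h2
    have h3 : e' ≠ i := by rintro rfl; omega
    exact ⟨(hE h1).1, by rwa [hk h3 (hE h1).2] at h2, h3⟩
  have ht : ∀ {e'}, e' ≠ i → (D.contract i e).tgt e' = D.tgt e' := fun h1 => by
    simp [contract, h1]
  have hx := mem_V.1 (h.core.wf i h.mem_i).2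
  refine ⟨h.series.wf', ?_, ?_, ?_, ?_, ?_, ?_, h.core.base_fresh⟩
  · intro e' h1 h2
    obtain ⟨h3, h4, h5⟩ := hk1 h1 h2
    rw [ht h5]
    exact h.core.simple e' h3 h4
  · intro e₁ h1 e₂ h2 h3 h4 h5
    obtain ⟨h6, h7, h8⟩ := hk1 h1 h3
    obtain ⟨h9, h10, h11⟩ := hk1 h2 h4
    rw [ht h8, ht h11] at h5
    exact h.core.par e₁ h6 e₂ h9 h7 h10 h5
  · intro e'
    by_cases h1 : e' = e
    · simp [contract, h1]
    · by_cases h2 : e' = i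
      · rw [h2, hki]
      · rw [hk h2 h1]; exact h.core.kind_le e'
  · intro e' h1 h2
    obtain ⟨h3, h4⟩ := hE h1
    by_cases h5 : e' = i
    · subst h5
      have h6 := h.core.par_a e' h3
      have := h.core.kind_le e'
      have := (mem_E.1 h3).2
      simp only [contract, update_self]
      split_ifs <;> omega
    · rw [hk h5 h4] at h2
      simpa [contract, h5] using h.core.par_a e' h3 h2
  · intro e' h1 h2
    obtain ⟨h3, h4⟩ := hE h1
    by_cases h5 : e' = i
    · subst h5
      have h6 := h.core.par_b e' h3
      have := h.core.kind_le e'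
      have := (mem_E.1 h3).2
      simp only [contract, update_self]
      split_ifs <;> omega
    · rw [hk h5 h4] at h2
      simpa [contract, h5] using h.core.par_b e' h3 h2
  · intro v hv
    change D.nv ≤ v at hv
    have : v ≠ D.tgt i := by rintro rfl; have := hx.1; simp only [net] at this; omega
    simpa [contract, this] using h.core.dead_fresh v hv

/-- Apart from the vertex that disappears, no degree changes. Of the sums of edges, only the one at
the far end of `e` changes: there `i` replaces `e`. -/
theorem degs (hD : D.Degs) : (D.contract i e).Degs := by
  have hx : ∀ φ, (D.contract i e).net.load φ (D.tgt i) = 0 := fun φ =>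
    Net.load_eq_zero h.series.wf' φ (by rw [contract_V]; simp)
  have hne := h.tgt_e
  constructor <;> intro v <;> by_cases hv : v = D.tgt i
  · rw [hv, hx]; simp [contract]
  · have h1 := h.series.load (fun _ => 1) hv
    rw [← hD.1 v] at h1
    have : (D.contract i e).deg v = D.deg v := by simp [contract, hv]
    omega
  · rw [hv, hx]; simp [contract, hne.symm]
  · have h1 := h.series.load id hv
    rw [← hD.2 v] at h1
    change _ + e * (if D.tgt e = v then 1 else 0) = _ + i * (if D.tgt e = v then 1 else 0) at h1
    by_cases hs : D.tgt e = v
    · have : (D.contract i e).inc v = D.inc v + i - e := by subst hs; simp [contract]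
      rw [if_pos hs] at h1
      omega
    · simpa [contract, Ne.symm hs, hv, hs] using h1.symm

end Contractible

/-- Subdivide the edge `i` by a new vertex with weight `α` towards the target and weight `β`
towards the source. -/
def peel (D : Data) (i α β : ℕ) : Data :=
  { D with
    nv := D.nv + 1, ne := D.ne + 1
    kind := update D.kind D.ne 1
    src := update D.src D.ne D.nv
    tgt := update (update D.tgt D.ne (D.tgt i)) i D.nv
    ws := update D.ws D.ne α
    wt := update (update D.wt D.ne (D.wt i)) i β }

/-- Turn the edge `i` into a single edge. -/
def toSingle (D : Data) (i : ℕ) : Data := { D with kind := update D.kind i 1 }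

/-- The stored network with another profile of the edge `i`. -/
def netWith (D : Data) (i : ℕ) (O : Profile) : Net :=
  { D.net with prof := update D.net.prof i O }

theorem netWith_self : D.netWith i (D.net.prof i) = D.net := by
  simp [netWith]

theorem toSingle_net (hi : i ∈ D.net.E) :
    (D.toSingle i).net = D.netWith i (.single (D.ws i) (D.wt i)) := by
  have := (mem_E.1 hi).2
  ext1
  · rfl
  · ext e
    simp only [mem_E]
    change _ ↔ e ∈ D.net.E
    simp only [mem_E]
    by_cases h : e = i
    · subst h; simp [toSingle, this]
    · simp [toSingle, h]
  · rfl
  · rfl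
  · rfl
  · funext e
    by_cases h : e = i
    · subst h; simp [toSingle, net, netWith]
    · simp [toSingle, net, netWith, h]

theorem peel_net (hD : D.Core) (hi : i < D.ne) (α β : ℕ) (O O' : Profile) :
    (D.peel i α β).netWith i O' =
      (D.netWith i O).split i D.nv D.ne O' (.single α (D.wt i)) := by
  have hfi : D.ne ≠ i := by omega
  ext1
  · ext v
    change v ∈ (D.peel i α β).net.V ↔ v ∈ insert D.nv D.net.V
    rw [Finset.mem_insert, mem_V, mem_V]
    have := hD.dead_fresh v
    simp only [peel]
    omega
  · ext e
    change e ∈ (D.peel i α β).net.E ↔ e ∈ insert D.ne D.net.E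
    rw [Finset.mem_insert, mem_E, mem_E]
    simp only [peel]
    by_cases h : e = D.ne
    · simp [h]
    · simp only [update_of_ne h]
      omega
  · rfl
  · rfl
  · rfl
  · funext e
    by_cases h : e = i
    · subst h; simp [peel, net, netWith, Net.split]
    · by_cases h' : e = D.ne
      · subst h'; simp [peel, net, netWith, Net.split, h]
      · simp [peel, net, netWith, Net.split, h, h']

/-- While an edge is being subdivided its stored summary is out of date. The profile of `i` is
therefore a free parameter before (`O`) and after (`O'`) the step, and only the composition with the
new single edge matters. -/
theorem peel_reduces (hD : D.Core) (hi : i ∈ D.net.E) {α β : ℕ} {O O' : Profile}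
    (hO : (Profile.comp 0 O' (.single α (D.wt i))).Shift O 0) :
    ((D.peel i α β).netWith i O').Reduces (D.netWith i O) 0 := by
  rw [peel_net hD (mem_E.1 hi).1 α β O O']
  have hp : (D.netWith i O).prof i = O := by simp [netWith]
  refine Net.split_reduces (N := D.netWith i O) hD.wf hi ?_ ?_ (hD.base_fresh _ le_rfl)
      (by rwa [hp])
  · intro h
    have := (mem_V.1 (show D.nv ∈ D.net.V from h)).1
    omega
  · intro h
    have := (mem_E.1 (show D.ne ∈ D.net.E from h)).1
    omega

theorem mem_E_peel {α β : ℕ} :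
    e ∈ (D.peel i α β).net.E ↔ e = D.ne ∨ e ∈ D.net.E := by
  rw [mem_E, mem_E]
  simp only [peel]
  by_cases h : e = D.ne
  · simp [h]
  · simp only [update_of_ne h]
    omega

theorem lt_nv_of_mem {v : ℕ} (h : v ∈ D.net.V) : v < D.nv := (mem_V.1 h).1

/-- The new single edge has a fresh vertex as one end, so it is neither a loop nor parallel to
another single edge. The edge `i`, which may be a loop or have parallels, keeps kind `2` for now and
stays exempt from these conditions. -/
theorem Core.peel (hD : D.Core) (hi : i ∈ D.net.E) (hk : D.kind i = 2) (α β : ℕ) :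
    (D.peel i α β).Core ∧ i ∈ (D.peel i α β).net.E ∧ (D.peel i α β).kind i = 2 := by
  have hin := (mem_E.1 hi).1
  have hni : D.ne ≠ i := by omega
  have hlt : ∀ e ∈ D.net.E, e ≠ D.ne := fun e he => ((mem_E.1 he).1).ne
  have hV : ∀ v ∈ D.net.V, v ∈ (D.peel i α β).net.V := by
    intro v hv
    rw [mem_V] at hv ⊢
    exact ⟨hv.1.trans (Nat.lt_succ_self _), hv.2⟩
  have hnv : D.nv ∈ (D.peel i α β).net.V :=
    mem_V.2 ⟨Nat.lt_succ_self _, hD.dead_fresh _ le_rfl⟩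
  have hks : ∀ e ∈ D.net.E, (D.peel i α β).kind e = D.kind e := fun e he => by
    simp [Data.peel, hlt e he]
  have hss : ∀ e ∈ D.net.E, (D.peel i α β).src e = D.src e := fun e he => by
    simp [Data.peel, hlt e he]
  have hts : ∀ e ∈ D.net.E, e ≠ i → (D.peel i α β).tgt e = D.tgt e := fun e he h => by
    simp [Data.peel, hlt e he, h]
  have hsn : (D.peel i α β).src D.ne = D.nv := by simp [Data.peel]
  have htn : (D.peel i α β).tgt D.ne = D.tgt i := by simp [Data.peel, hni]
  have hkn : (D.peel i α β).kind D.ne = 1 := by simp [Data.peel]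
  have hti : D.tgt i < D.nv := lt_nv_of_mem (hD.wf i hi).2
  refine ⟨⟨?_, ?_, ?_, ?_, ?_, ?_, ?_, ?_⟩, mem_E_peel.2 (Or.inr hi), (hks i hi).trans hk⟩
  · intro e he
    change (D.peel i α β).src e ∈ _ ∧ (D.peel i α β).tgt e ∈ _
    rcases mem_E_peel.1 he with rfl | he
    · rw [hsn, htn]; exact ⟨hnv, hV _ (hD.wf i hi).2⟩
    · rw [hss e he]
      refine ⟨hV _ (hD.wf e he).1, ?_⟩
      by_cases h : e = i
      · subst h; simpa [Data.peel] using hnv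
      · rw [hts e he h]; exact hV _ (hD.wf e he).2
  · intro e he hke
    rcases mem_E_peel.1 he with rfl | he
    · rw [hsn, htn]; exact hti.ne'
    · rw [hks e he] at hke
      rw [hss e he, hts e he (by rintro rfl; omega)]
      exact hD.simple e he hke
  · have key : ∀ e ∈ D.net.E, D.kind e = 1 → D.nv ≠ (D.peel i α β).src e ∧
        D.nv ≠ (D.peel i α β).tgt e := by
      intro e he hke
      rw [hss e he, hts e he (by rintro rfl; omega)]
      exact ⟨(lt_nv_of_mem (hD.wf e he).1).ne', (lt_nv_of_mem (hD.wf e he).2).ne'⟩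
    intro e he e' he' hke hke' hp
    rcases mem_E_peel.1 he with rfl | he <;> rcases mem_E_peel.1 he' with rfl | he'
    · rfl
    · rw [hks e' he'] at hke'
      have := key e' he' hke'
      rw [hsn] at hp
      tauto
    · rw [hks e he] at hke
      have := key e he hke
      rw [hsn] at hp
      have h1 : D.nv = (D.peel i α β).src e → False := this.1
      have h2 : D.nv = (D.peel i α β).tgt e → False := this.2
      rcases hp with hp | hp
      · exact (h1 hp.1.symm).elim
      · exact (h2 hp.2.symm).elim
    · rw [hks e he] at hke
      rw [hks e' he'] at hke'
      rw [hss e he, hss e' he', hts e he (by rintro rfl; omega),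
        hts e' he' (by rintro rfl; omega)] at hp
      exact hD.par e he e' he' hke hke' hp
  · intro e
    by_cases h : e = D.ne
    · simp [Data.peel, h]
    · simpa [Data.peel, h] using hD.kind_le e
  · intro e he hke
    rcases mem_E_peel.1 he with rfl | he
    · omega
    · rw [hks e he] at hke
      exact hD.par_a e he hke
  · intro e he hke
    rcases mem_E_peel.1 he with rfl | he
    · omega
    · rw [hks e he] at hke
      exact hD.par_b e he hke
  · exact fun v hv => hD.dead_fresh v ((Nat.le_succ _).trans hv)
  · exact fun v hv => hD.base_fresh v ((Nat.le_succ _).trans hv)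

theorem Core.toSingle (hD : D.Core) (hi : i ∈ D.net.E) (hst : D.src i ≠ D.tgt i)
    (hp : ∀ e ∈ D.net.E, D.kind e = 1 → ¬ ((D.src e = D.src i ∧ D.tgt e = D.tgt i) ∨
      (D.src e = D.tgt i ∧ D.tgt e = D.src i))) : (D.toSingle i).Core := by
  have hE : (D.toSingle i).net.E = D.net.E := by rw [toSingle_net hi]; rfl
  have hk : ∀ {e k}, (D.toSingle i).kind e = k → e = i ∨ D.kind e = k := by
    intro e k h
    by_cases h' : e = i
    · exact Or.inl h'
    · right; simpa [Data.toSingle, h'] using h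
  refine ⟨?_, ?_, ?_, ?_, ?_, ?_, hD.dead_fresh, hD.base_fresh⟩
  · intro e he
    exact hD.wf e (hE ▸ he)
  · intro e he hke
    rcases hk hke with rfl | hke
    · exact hst
    · exact hD.simple e (hE ▸ he) hke
  · intro e he e' he' hke hke' h
    rw [hE] at he he'
    change (D.src e = D.src e' ∧ D.tgt e = D.tgt e') ∨
        (D.src e = D.tgt e' ∧ D.tgt e = D.src e') at h
    rcases hk hke with rfl | h1 <;> rcases hk hke' with rfl | h2
    · rfl
    · exact absurd (by rcases h with h | h <;> simp [h.1, h.2]) (hp e' he' h2)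
    · exact absurd h (hp e he h1)
    · exact hD.par e he e' he' h1 h2 h
  · intro e
    by_cases h' : e = i
    · simp [Data.toSingle, h']
    · simpa [Data.toSingle, h'] using hD.kind_le e
  all_goals
    intro e he hke
    have hne : e ≠ i := by rintro rfl; simp [Data.toSingle] at hke
    have hke : D.kind e = 2 := by simpa [Data.toSingle, hne] using hke
    rw [hE] at he
  · exact hD.par_a e he hke
  · exact hD.par_b e he hke

/-- Replace the path edge `i` by a path with six inner vertices. -/
def expand (D : Data) (i : ℕ) : Data :=
  ((((((D.peel i (D.a₀ i) 0).peel i (D.A i - D.a₀ i - D.a₁ i) 0).peel i 0 (D.b₁ i)).peel i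
    (D.a₁ i) 0).peel i 0 (D.B i - D.b₀ i - D.b₁ i)).peel i 0 (D.b₀ i)).toSingle i

/-- From source to target, the six new vertices get the (forward, backward) weights `(0, b₀)`, `(0,
B - b₀ - b₁)`, `(a₁, 0)`, `(0, b₁)`, `(A - a₀ - a₁, 0)`, `(a₀, 0)`. They sum to `A` and `B`, the
outer vertices give the gains `b₀` and `a₀`, and the middle edge gives `a₁ + b₁`. One weight of each
pair is zero, so no step adds a constant. Other inner edges gain at most `A` or `B`, which is
harmless by `Profile.long_shift_long`. -/
theorem Core.expand (hD : D.Core) (hi : i ∈ D.net.E) (hk : D.kind i = 2) :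
    (D.expand i).Core ∧ (D.expand i).net.Reduces D.net 0 := by
  have hin := (mem_E.1 hi).1
  have ha := hD.par_a i hi hk
  have hb := hD.par_b i hi hk
  obtain ⟨c₁, i₁, k₁⟩ := hD.peel hi hk (D.a₀ i) 0
  obtain ⟨c₂, i₂, k₂⟩ := c₁.peel i₁ k₁ (D.A i - D.a₀ i - D.a₁ i) 0
  obtain ⟨c₃, i₃, k₃⟩ := c₂.peel i₂ k₂ 0 (D.b₁ i)
  obtain ⟨c₄, i₄, k₄⟩ := c₃.peel i₃ k₃ (D.a₁ i) 0
  obtain ⟨c₅, i₅, k₅⟩ := c₄.peel i₄ k₄ 0 (D.B i - D.b₀ i - D.b₁ i)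
  obtain ⟨c₆, i₆, k₆⟩ := c₅.peel i₅ k₅ 0 (D.b₀ i)
  have hw : ∀ (D' : Data) α β, (D'.peel i α β).wt i = β := fun D' α β => by simp [Data.peel]
  have s₁ := fun O O' => peel_reduces (O := O) (O' := O') (α := D.a₀ i) (β := 0) hD hi
  have s₂ := fun O O' => peel_reduces (O := O) (O' := O') (α := D.A i - D.a₀ i - D.a₁ i)
    (β := 0) c₁ i₁
  have s₃ := fun O O' => peel_reduces (O := O) (O' := O') (α := 0) (β := D.b₁ i) c₂ i₂
  have s₄ := fun O O' => peel_reduces (O := O) (O' := O') (α := D.a₁ i) (β := 0) c₃ i₃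
  have s₅ := fun O O' => peel_reduces (O := O) (O' := O') (α := 0)
    (β := D.B i - D.b₀ i - D.b₁ i) c₄ i₄
  have s₆ := fun O O' => peel_reduces (O := O) (O' := O') (α := 0) (β := D.b₀ i) c₅ i₅
  rw [hw] at s₂ s₃ s₄ s₅ s₆
  constructor
  · refine c₆.toSingle i₆ ?_ ?_
    · have h1 := lt_nv_of_mem (c₅.wf i i₅).1
      have h2 := (mem_E.1 i₅).1
      have h3 : ∀ D' : Data, ∀ β, i < D'.ne → D'.src i < D'.nv →
          (D'.peel i 0 β).src i ≠ (D'.peel i 0 β).tgt i := by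
        intro D' β h h'
        have : i ≠ D'.ne := by omega
        simp only [Data.peel, update_of_ne this, update_self]
        omega
      exact h3 _ _ h2 h1
    -- Besides `i`, only the newest edge meets the newest vertex. Its other end is the former target
    -- of `i`, a vertex created one step earlier and hence not the source of `i`.
    · have key : ∀ D' : Data, D'.Core → i ∈ D'.net.E → D'.kind i = 2 → D'.src i ≠ D'.tgt i → ∀ β,
          ∀ e ∈ (D'.peel i 0 β).net.E, (D'.peel i 0 β).kind e = 1 →
          ¬ (((D'.peel i 0 β).src e = (D'.peel i 0 β).src i ∧
              (D'.peel i 0 β).tgt e = (D'.peel i 0 β).tgt i) ∨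
            ((D'.peel i 0 β).src e = (D'.peel i 0 β).tgt i ∧
              (D'.peel i 0 β).tgt e = (D'.peel i 0 β).src i)) := by
        intro D' hc hi' hk' hst β e he hke
        have h0 := (mem_E.1 hi').1
        have h1 : i ≠ D'.ne := by omega
        have h2 : (D'.peel i 0 β).src i = D'.src i := by simp [Data.peel, h1]
        have h3 : (D'.peel i 0 β).tgt i = D'.nv := by simp [Data.peel]
        rw [h2, h3]
        have h4 : D'.src i < D'.nv := lt_nv_of_mem (hc.wf i hi').1
        rcases mem_E_peel.1 he with rfl | he
        · have h5 : (D'.peel i 0 β).src D'.ne = D'.nv := by simp [Data.peel]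
          have h6 : (D'.peel i 0 β).tgt D'.ne = D'.tgt i := by simp [Data.peel, h1.symm]
          rw [h5, h6]
          rintro (⟨h7, _⟩ | ⟨_, h7⟩)
          · omega
          · exact hst h7.symm
        · have h8 : e ≠ D'.ne := ((mem_E.1 he).1).ne
          have h9 : e ≠ i := by
            rintro rfl
            simp [Data.peel, h8, hk'] at hke
          have h5 : (D'.peel i 0 β).src e = D'.src e := by simp [Data.peel, h8]
          have h6 : (D'.peel i 0 β).tgt e = D'.tgt e := by simp [Data.peel, h8, h9]
          have h10 : D'.src e < D'.nv := lt_nv_of_mem (hc.wf e he).1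
          have h11 : D'.tgt e < D'.nv := lt_nv_of_mem (hc.wf e he).2
          rw [h5, h6]
          omega
      refine key _ c₅ i₅ k₅ ?_ _
      have h1 := lt_nv_of_mem (c₄.wf i i₄).1
      have h2 := (mem_E.1 i₄).1
      have h3 : ∀ D' : Data, ∀ α β, i < D'.ne → D'.src i < D'.nv →
          (D'.peel i α β).src i ≠ (D'.peel i α β).tgt i := by
        intro D' α β h h'
        have : i ≠ D'.ne := by omega
        simp only [Data.peel, update_of_ne this, update_self]
        omega
      exact h3 _ _ _ h2 h1
  · have hws : ((((((D.peel i (D.a₀ i) 0).peel i (D.A i - D.a₀ i - D.a₁ i) 0).peel i 0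
        (D.b₁ i)).peel i (D.a₁ i) 0).peel i 0 (D.B i - D.b₀ i - D.b₁ i)).peel i 0 (D.b₀ i)).ws i =
        D.ws i := by
      have h3 : ∀ D' : Data, ∀ α β, i ∈ D'.net.E → (D'.peel i α β).ws i = D'.ws i := by
        intro D' α β h
        have : i ≠ D'.ne := ((mem_E.1 h).1).ne
        simp [Data.peel, this]
      rw [h3 _ _ _ i₅, h3 _ _ _ i₄, h3 _ _ _ i₃, h3 _ _ _ i₂, h3 _ _ _ i₁, h3 _ _ _ hi]
    unfold Data.expand
    rw [toSingle_net i₆, hws, hw]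
    have h0 : D.net.prof i = .long (D.ws i) (D.wt i) (D.A i) (D.B i) (D.a₀ i) (D.b₀ i)
        (D.a₁ i + D.b₁ i) := if_neg (by omega)
    rw [← netWith_self (D := D) (i := i), h0]
    generalize D.ws i = w at *
    generalize D.wt i = w' at *
    generalize D.A i = A at *
    generalize D.B i = B at *
    generalize D.a₀ i = a at *
    generalize D.b₀ i = b at *
    generalize D.a₁ i = a' at *
    generalize D.b₁ i = b' at *
    have eq : ∀ {w w' A B a₀ b₀ m A' B' a₀' b₀' m' : ℕ}, A = A' → B = B' → a₀ = a₀' → b₀ = b₀' →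
        m = m' → Profile.long w w' A B a₀ b₀ m = Profile.long w w' A' B' a₀' b₀' m' := by
      rintro _ _ _ _ _ _ _ _ _ _ _ _ rfl rfl rfl rfl rfl; rfl
    -- Each of `t₆`, …, `t₁` appends one edge to the part of the path that begins at the source. The
    -- summaries of these growing parts come from the composition lemmas with `p = 0`.
    have t₆ := s₆ (.long w (B - b - b') 0 b 0 b 0) (.single w b) (by
      refine cast ?_ (Profile.comp_single_single 0 w b 0 (B - b - b'))
      congr 1
      · exact eq (by omega) (by omega) (by omega) (by omega) (by omega)
      · omega)
    have t₅ := s₅ (.long w 0 0 (B - b') 0 b (B - b - b')) (.long w (B - b - b') 0 b 0 b 0) (by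
      refine cast ?_ (Profile.comp_long_single (p := 0) (w := w) (w' := B - b - b') (r := 0)
        (r' := 0) (A := 0) (B := b) (a₀ := 0) (b₀ := b) (m := 0) (by omega) (by omega) (by omega))
      congr 1
      · exact eq (by omega) (by omega) (by omega) (by omega) (by omega)
      · omega)
    have t₄ := s₄ (.long w b' a' (B - b') a' b (B - b - b')) (.long w 0 0 (B - b') 0 b (B - b - b'))
      (by
        refine cast ?_ (Profile.comp_long_single (p := 0) (w := w) (w' := 0) (r := a')
          (r' := b') (A := 0) (B := B - b') (a₀ := 0) (b₀ := b) (m := B - b - b') (by omega)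
          (by omega) (by omega))
        congr 1
        · exact eq (by omega) (by omega) (by omega) (by omega) (by omega))
    have t₃ := s₃ (.long w 0 a' B 0 b (max (B - b - b') (a' + b')))
      (.long w b' a' (B - b') a' b (B - b - b')) (by
        refine cast ?_ (Profile.comp_long_single (p := 0) (w := w) (w' := b') (r := 0)
          (r' := 0) (A := a') (B := B - b') (a₀ := a') (b₀ := b) (m := B - b - b') (by omega)
          (by omega) (by omega))
        congr 1
        · exact eq (by omega) (by omega) (by omega) (by omega) (by omega)
        · omega)
    have t₂ := s₂ (.long w 0 (A - a) B (A - a - a') b (max (B - b - b') (a' + b')))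
      (.long w 0 a' B 0 b (max (B - b - b') (a' + b'))) (by
        refine cast ?_ (Profile.comp_long_single (p := 0) (w := w) (w' := 0) (r := A - a - a')
          (r' := 0) (A := a') (B := B) (a₀ := 0) (b₀ := b) (m := max (B - b - b') (a' + b'))
          (by omega) (by omega) (by omega))
        congr 1
        · exact eq (by omega) (by omega) (by omega) (by omega) (by omega))
    -- The composition yields the inner gain `max (max (B - b - b') (a' + b')) (A - a - a')`. It
    -- lies between `a' + b'` and the largest of `a' + b'`, `A` and `B`, so it may be replaced by
    -- `a' + b'`.
    have t₁ := s₁ (.long w w' A B a b (a' + b'))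
      (.long w 0 (A - a) B (A - a - a') b (max (B - b - b') (a' + b'))) (by
        refine Profile.Shift.trans (d := 0) (d' := 0) ?_ (Profile.long_shift_long
          (m' := max (max (B - b - b') (a' + b')) (A - a - a')) (by omega) (by omega))
        refine cast ?_ (Profile.comp_long_single (p := 0) (w := w) (w' := 0) (r := a)
          (r' := w') (A := A - a) (B := B) (a₀ := A - a - a') (b₀ := b)
          (m := max (B - b - b') (a' + b')) (by omega) (by omega) (by omega))
        congr 1
        · exact eq (by omega) (by omega) (by omega) (by omega) (by omega))
    exact ((((t₆.trans t₅).trans t₄).trans t₃).trans t₂).trans t₁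

end Data


/-! ## The feedback edge number of a connected graph -/

/-- The edges outside a spanning tree form a feedback set. Conversely, the forest left by any
feedback set extends to a spanning tree, so it has at most `|V| - 1` edges. -/
theorem SimpleGraph.feedbackEdgeNumber_add_card {V : Type*} [Fintype V] {G : SimpleGraph V}
    (hG : G.Connected) :
    G.feedbackEdgeNumber + Fintype.card V = G.edgeSet.ncard + 1 := by
  classical
  obtain ⟨T, hTG, hT⟩ := hG.exists_isTree_le
  have hcard : ∀ T : SimpleGraph V, T.IsTree → T.edgeSet.ncard + 1 = Fintype.card V := by
    intro T hT
    rw [← hT.card_edgeFinset, ← SimpleGraph.coe_edgeFinset, Set.ncard_coe_finset]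
  have hsub : ∀ F : Finset (Sym2 V), (F : Set (Sym2 V)) ⊆ G.edgeSet →
      (G.edgeSet \ F).ncard + F.card = G.edgeSet.ncard := by
    intro F hF
    rw [← Set.ncard_coe_finset, Set.ncard_sdiff_add_ncard_of_subset hF (Set.toFinite _)]
  have hmem : G.edgeSet.ncard + 1 - Fintype.card V ∈
      {k | ∃ F : Finset (Sym2 V), (F : Set (Sym2 V)) ⊆ G.edgeSet ∧ F.card = k ∧
        (G.deleteEdges (F : Set (Sym2 V))).IsAcyclic} := by
    refine ⟨G.edgeFinset \ T.edgeFinset, ?_, ?_, ?_⟩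
    · simp
    · have h1 := hcard T hT
      have h2 : (G.edgeFinset \ T.edgeFinset).card + T.edgeFinset.card = G.edgeFinset.card :=
        Finset.card_sdiff_add_card_eq_card (SimpleGraph.edgeFinset_mono hTG)
      rw [← SimpleGraph.coe_edgeFinset, Set.ncard_coe_finset] at h1 ⊢
      omega
    · refine hT.2.anti fun u v huv => ?_
      rw [SimpleGraph.deleteEdges_adj] at huv
      by_contra h
      exact huv.2 (by simp [huv.1, h])
  have hle : G.feedbackEdgeNumber ≤ _ := Nat.sInf_le hmem
  obtain ⟨F, hF, hFc, hFa⟩ : G.feedbackEdgeNumber ∈ _ := Nat.sInf_mem ⟨_, hmem⟩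
  obtain ⟨T', hT', hT'G, hT't⟩ := hG.exists_isTree_le_of_le_of_isAcyclic
    (SimpleGraph.deleteEdges_le _) hFa
  have h1 := hcard T' hT't
  have h2 : (G.edgeSet \ F).ncard ≤ T'.edgeSet.ncard := by
    refine Set.ncard_le_ncard ?_ (Set.toFinite _)
    rw [← SimpleGraph.edgeSet_deleteEdges]
    exact SimpleGraph.edgeSet_mono (by assumption)
  have h3 := hsub F hF
  have h4 := hcard T hT
  have h5 : T.edgeSet.ncard ≤ G.edgeSet.ncard :=
    Set.ncard_le_ncard (SimpleGraph.edgeSet_mono hTG) (Set.toFinite _)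
  omega

/-! ### Solutions of instances and strongly connecting choices -/

namespace MinPAC

/-- The whole graph is a solution, and a maximum is at most a sum. This makes one plus the sum of
all weights a safe weight for missing arcs. -/
theorem opt_le_sum_weight {V : Type*} [Fintype V] (I : MinPAC V) :
    I.opt ≤ ∑ a ∈ I.arcs, I.weight a.1 a.2 := by
  classical
  refine (I.opt_isLeast.2 ⟨I.graph, ⟨fun _ _ h => h, I.strong⟩, rfl⟩).trans ?_
  unfold cost arcs
  rw [Finset.sum_filter, Fintype.sum_prod_type]
  refine Finset.sum_le_sum fun v _ => ?_
  rw [← Finset.sum_filter]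
  refine Finset.sup_le fun u hu => ?_
  convert Finset.single_le_sum (f := fun u => I.weight v u) (fun _ _ => Nat.zero_le _) hu

theorem connected {V : Type*} (I : MinPAC V) : I.graph.toSimpleGraphInclusive.Connected := by
  have := I.nonempty
  refine ⟨fun u v => ?_⟩
  have := I.strong u v
  induction this with
  | refl => exact .rfl
  | @tail y z _ h ih =>
    refine ih.trans (SimpleGraph.Adj.reachable ?_)
    rw [Digraph.toSimpleGraphInclusive, SimpleGraph.fromRel_adj]
    exact ⟨by rintro rfl; exact I.loopless _ h, Or.inl h⟩

end MinPAC

namespace Net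

open Relation

section MinPAC

variable {V : Type*} [Fintype V] {N : Net} {I : MinPAC V} {φ : V → ℕ} {ws wt : ℕ → ℕ}

/-- A solution of an instance is a strongly connecting choice for a network that contains it. -/
theorem ach_of_isSolution (hφ : Function.Injective φ) (hV : N.V = Finset.univ.image φ)
    (hprof : ∀ e ∈ N.E, N.prof e = .single (ws e) (wt e))
    (harc : ∀ u v, I.graph.Adj u v → ∃ e ∈ N.E,
      (N.src e = φ u ∧ N.tgt e = φ v ∧ ws e ≤ I.weight u v + N.base (φ u)) ∨
      (N.tgt e = φ u ∧ N.src e = φ v ∧ wt e ≤ I.weight u v + N.base (φ u)))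
    {H : Digraph V} (hH : I.IsSolution H) : N.Ach (I.cost H + ∑ v ∈ N.V, N.base v) := by
  classical
  let c : V → ℕ := fun v => (Finset.univ.filter fun u => H.Adj v u).sup fun u => I.weight v u
  have hc : ∀ u v, H.Adj u v → I.weight u v ≤ c u := fun u v h =>
    Finset.le_sup (f := fun v => I.weight u v) (by simpa using h)
  -- The power that the solution needs at a vertex is spent on top of its minimum power. This
  -- explains the allowance `N.base (φ u)` in `harc` and the extra sum in the cost.
  let ext : ℕ → ℕ := Function.extend φ c 0
  have hext : ∀ u, ext (φ u) = c u := fun u => hφ.extend_apply _ _ _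
  refine ⟨fun x => N.base x + ext x,
    fun e => decide (∃ u v, H.Adj u v ∧ N.src e = φ u ∧ N.tgt e = φ v ∧
      ws e ≤ I.weight u v + N.base (φ u)),
    fun e => decide (∃ u v, H.Adj u v ∧ N.tgt e = φ u ∧ N.src e = φ v ∧
      wt e ≤ I.weight u v + N.base (φ u)), 0, fun v _ => Nat.le_add_right _ _, ?_, ?_, ?_⟩
  · intro e he
    rw [hprof e he]
    simp only [Profile.single, decide_eq_true_eq]
    constructor
    · rintro ⟨u, v, h1, h2, h3, h4⟩
      have := hc u v h1
      rw [h2, hext]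
      omega
    · rintro ⟨u, v, h1, h2, h3, h4⟩
      have := hc u v h1
      rw [h2, hext]
      omega
  · intro x hx y hy
    rw [hV, Finset.mem_image] at hx hy
    obtain ⟨u, -, rfl⟩ := hx
    obtain ⟨v, -, rfl⟩ := hy
    refine ReflTransGen.lift φ ?_ _ _ (hH.2 u v)
    intro u v huv
    obtain ⟨e, he, ⟨h1, h2, h3⟩ | ⟨h1, h2, h3⟩⟩ := harc u v (hH.1 u v huv)
    · exact ⟨e, he, Or.inl ⟨by simpa using ⟨u, v, huv, h1, h2, h3⟩, h1, h2⟩⟩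
    · exact ⟨e, he, Or.inr ⟨by simpa using ⟨u, v, huv, h1, h2, h3⟩, h1, h2⟩⟩
  · rw [Finset.sum_add_distrib]
    have : ∑ x ∈ N.V, ext x = I.cost H := by
      rw [hV, Finset.sum_image fun _ _ _ _ h => hφ h]
      exact Finset.sum_congr rfl fun u _ => by rw [hext u]
    simp [this, add_comm]

/-- A strongly connecting choice of small cost for a network gives a solution of an instance that
contains the network except for expensive arcs. -/
theorem exists_isSolution_of_ach (hN : N.WF) (hφ : Function.Injective φ)
    (hV : N.V = Finset.univ.image φ)
    (hprof : ∀ e ∈ N.E, N.prof e = .single (ws e) (wt e)) {W : ℕ}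
    (hsrc : ∀ e ∈ N.E, ∀ u v, N.src e = φ u → N.tgt e = φ v → W ≤ ws e - N.base (φ u) ∨
      (I.graph.Adj u v ∧ I.weight u v ≤ ws e - N.base (φ u)))
    (htgt : ∀ e ∈ N.E, ∀ u v, N.tgt e = φ u → N.src e = φ v → W ≤ wt e - N.base (φ u) ∨
      (I.graph.Adj u v ∧ I.weight u v ≤ wt e - N.base (φ u)))
    {k : ℕ} (hk : N.Ach (k + ∑ v ∈ N.V, N.base v)) (hkW : k < W) :
    ∃ H, I.IsSolution H ∧ I.cost H ≤ k := by
  classical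
  obtain ⟨π, f, b, c, h1, h2, h3, h4⟩ := hk
  have hsum : ∑ v, (π (φ v) - N.base (φ v)) ≤ k := by
    have : ∑ v ∈ N.V, π v = ∑ v ∈ N.V, (π v - N.base v) + ∑ v ∈ N.V, N.base v := by
      rw [← Finset.sum_add_distrib]
      exact Finset.sum_congr rfl fun v hv => by have := h1 v hv; omega
    have h5 : ∑ v ∈ N.V, (π v - N.base v) = ∑ v, (π (φ v) - N.base (φ v)) := by
      rw [hV, Finset.sum_image fun _ _ _ _ h => hφ h]
    omega
  -- No vertex spends more than `k < W` above its minimum power, so no direction of weight at least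
  -- `W` above it can be in use.
  have hle : ∀ u, π (φ u) - N.base (φ u) ≤ k := fun u =>
    (Finset.single_le_sum (f := fun u => π (φ u) - N.base (φ u)) (fun _ _ => Nat.zero_le _)
      (Finset.mem_univ u)).trans hsum
  -- The solution contains every arc that its tail can afford with the power above the minimum.
  let H : Digraph V := ⟨fun u v => I.graph.Adj u v ∧ I.weight u v ≤ π (φ u) - N.base (φ u)⟩
  have hmem : ∀ v, φ v ∈ N.V := fun v => by rw [hV]; simp
  have hstep : ∀ x y, N.Step f b x y → ∀ u v, x = φ u → y = φ v → H.Adj u v := by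
    rintro x y ⟨e, he, ⟨h5, rfl, rfl⟩ | ⟨h5, rfl, rfl⟩⟩ u v hu hv
    · have h6 := (h2 e he)
      rw [hprof e he] at h6
      have h7 := h6.1 h5
      rw [hu] at h7
      have h8 := hle u
      rcases hsrc e he u v hu hv with h9 | h9
      · omega
      · exact ⟨h9.1, h9.2.trans (by omega)⟩
    · have h6 := (h2 e he)
      rw [hprof e he] at h6
      have h7 := h6.2 h5
      rw [hu] at h7
      have h8 := hle u
      rcases htgt e he u v hu hv with h9 | h9
      · omega
      · exact ⟨h9.1, h9.2.trans (by omega)⟩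
  have hend : ∀ x y, N.Step f b x y → ∀ u, x = φ u → ∃ v, y = φ v ∧ H.Adj u v := by
    intro x y hxy u hu
    have hy := (hxy.mem_ends hN).2
    rw [hV, Finset.mem_image] at hy
    obtain ⟨v, -, rfl⟩ := hy
    exact ⟨v, rfl, hstep _ _ hxy u v hu rfl⟩
  refine ⟨H, ⟨fun u v h => h.1, ?_⟩, ?_⟩
  · intro u v
    have key : ∀ y, ReflTransGen (N.Step f b) (φ u) y → ∃ v, y = φ v ∧ ReflTransGen H.Adj u v := by
      intro y hy
      induction hy with
      | refl => exact ⟨u, rfl, .refl⟩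
      | tail _ hyz ih =>
        obtain ⟨v, rfl, hv⟩ := ih
        obtain ⟨w, rfl, hw⟩ := hend _ _ hyz v rfl
        exact ⟨w, rfl, hv.tail hw⟩
    obtain ⟨v', h5, h6⟩ := key _ (h3 _ (hmem u) _ (hmem v))
    rwa [hφ h5]
  · refine le_trans ?_ hsum
    refine Finset.sum_le_sum fun u _ => Finset.sup_le fun v hv => ?_
    exact ((@Finset.mem_filter _ _ (_) _ _).1 hv).2.2

end MinPAC

/-! ### Counting vertices and edges by degrees -/

section counting

variable {N : Net}

theorem exists_card_E_le_one_of_singleton (hN : N.WF) {x : ℕ} (hV : N.V = {x}) :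
    N.load (fun _ => 1) x = 2 * N.E.card := by
  rw [← sum_load hN, hV, Finset.sum_singleton]

/-- A loop uses up the whole degree, so by `Conn.eq_singleton` the network would be one vertex with
one loop. This contradicts `|V| < |E|`, which is where `g ≥ 2` enters. -/
theorem src_ne_of_load_eq_two (hN : N.WF) {k : ℕ} (hk : N.Ach k)
    (hcard : N.V.card < N.E.card) {x e : ℕ} (he : e ∈ N.E) (ht : N.tgt e = x)
    (h2 : N.load (fun _ => 1) x = 2) : N.src e ≠ x := by
  intro hs
  obtain ⟨π, f, b, c, -, -, hc, -⟩ := hk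
  have h3 := N.load_eq_add (fun _ => 1) x he
  rw [h2, hs, ht] at h3
  simp only [if_true] at h3
  have h4 : ∀ e' ∈ N.E, e' ≠ e → N.src e' ≠ x ∧ N.tgt e' ≠ x := by
    have : ∑ e ∈ N.E.erase e, 1 * ((if N.src e = x then 1 else 0) +
        if N.tgt e = x then 1 else 0) = 0 := by omega
    intro e' he' hne'
    have := Finset.sum_eq_zero_iff.1 this e' (Finset.mem_erase.2 ⟨hne', he'⟩)
    constructor <;> intro h3 <;> simp [h3] at this
  have hV := hc.eq_singleton (ht ▸ (hN e he).2) fun e' he' => by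
    by_cases h : e' = e
    · subst h; simp [hs, ht]
    · simp [h4 e' he' h]
  have := exists_card_E_le_one_of_singleton hN hV
  rw [hV, Finset.card_singleton] at hcard
  omega

/-- An isolated vertex would be the only vertex of a network without edges, against `|V| < |E|`. A
vertex of degree two is an end of some edge, which `h2` forbids. -/
theorem three_le_load (hN : N.WF) {k : ℕ} (hk : N.Ach k)
    (hcard : N.V.card < N.E.card) {v : ℕ} (hv : v ∈ N.V) (h1 : N.load (fun _ => 1) v ≠ 1)
    (h2 : ∀ e ∈ N.E, N.load (fun _ => 1) (N.src e) ≠ 2 ∧ N.load (fun _ => 1) (N.tgt e) ≠ 2) :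
    3 ≤ N.load (fun _ => 1) v := by
  by_contra h
  by_cases h0 : N.load (fun _ => 1) v = 0
  · obtain ⟨π, f, b, c, -, -, hc, -⟩ := hk
    have hV := hc.eq_singleton hv fun e' he' => by
      have := Finset.sum_eq_zero_iff.1 h0 e' he'
      constructor <;> intro h3 <;> simp [h3] at this
    have := exists_card_E_le_one_of_singleton hN hV
    omega
  · obtain ⟨e, he, hne⟩ := Finset.exists_ne_zero_of_sum_ne_zero h0
    have := h2 e he
    have h3 : N.src e = v ∨ N.tgt e = v := by
      by_contra h4
      push Not at h4
      simp [h4] at hne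
    rcases h3 with h3 | h3 <;> rw [h3] at this <;> omega

/-- Handshake lemma: `3 |V| ≤ 2 |E| = 2 (|V| + g - 1)`. -/
theorem card_le_of_three_le (hN : N.WF) (h : ∀ v ∈ N.V, 3 ≤ N.load (fun _ => 1) v) {g : ℕ}
    (hg : N.E.card + 1 = N.V.card + g) :
    N.V.card + 2 ≤ 2 * g ∧ N.E.card + 3 ≤ 3 * g := by
  have h1 := sum_load hN
  have h2 := Finset.card_nsmul_le_sum N.V _ 3 h
  rw [h1, smul_eq_mul] at h2
  omega

end counting

end Net


/-! ### The stored network of an instance -/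

namespace Data

/-- `D` represents the instance `I`: every pair of adjacent vertices is joined by a single edge,
and missing arcs have weight `W`. -/
structure Represents (D : Data) {n : ℕ} (I : MinPAC (Fin n)) (W : ℕ) : Prop where
  nv : D.nv = n
  dead : ∀ v, D.dead v = 0
  base : ∀ v, D.base v = 0
  kind : ∀ e, D.kind e = if e < D.ne then 1 else 0
  edge : ∀ e < D.ne, ∃ u v : Fin n, D.src e = u ∧ D.tgt e = v ∧ I.graph.Adj u v ∧
    D.ws e = I.weight u v ∧
    (I.graph.Adj v u ∧ D.wt e = I.weight v u ∨ ¬ I.graph.Adj v u ∧ D.wt e = W)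
  arc : ∀ u v : Fin n, I.graph.Adj u v → ∃ e < D.ne,
    (D.src e = u ∧ D.tgt e = v) ∨ (D.tgt e = u ∧ D.src e = v)
  par : ∀ e < D.ne, ∀ e' < D.ne, (D.src e = D.src e' ∧ D.tgt e = D.tgt e') ∨
    (D.src e = D.tgt e' ∧ D.tgt e = D.src e') → e = e'

namespace Represents

variable {D : Data} {n W : ℕ} {I : MinPAC (Fin n)} (h : D.Represents I W)

include h

theorem net_V : D.net.V = Finset.range n := by
  ext v; simp [mem_V, h.nv, h.dead]

theorem net_E : D.net.E = Finset.range D.ne := by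
  ext v; simp [mem_E, h.kind]

theorem kind_eq_one {e : ℕ} (he : e ∈ D.net.E) : D.kind e = 1 := by
  rw [h.net_E, Finset.mem_range] at he
  simp [h.kind, he]

theorem core : D.Core where
  wf e he := by
    rw [h.net_E, Finset.mem_range] at he
    obtain ⟨u, v, h1, h2, -⟩ := h.edge e he
    rw [h.net_V, Finset.mem_range, Finset.mem_range]
    exact ⟨h1.trans_lt u.2, h2.trans_lt v.2⟩
  simple e he _ := by
    rw [h.net_E, Finset.mem_range] at he
    obtain ⟨u, v, h1, h2, h3, -⟩ := h.edge e he
    rw [h1, h2]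
    intro h4
    rw [Fin.ext h4] at h3
    exact I.loopless _ h3
  par e he e' he' _ _ := by
    rw [h.net_E, Finset.mem_range] at he he'
    exact h.par e he e' he'
  kind_le e := by rw [h.kind]; split_ifs <;> omega
  par_a e he hk := by rw [h.kind_eq_one he] at hk; omega
  par_b e he hk := by rw [h.kind_eq_one he] at hk; omega
  dead_fresh v _ := h.dead v
  base_fresh v _ := h.base v

/-- All minimum powers are zero, so solutions translate directly into choices. A choice cheaper than
`I.opt` would cost less than `W`, hence use no missing arc, and would give a solution that is too
cheap. -/
theorem isLeast (hW : I.opt < W) : IsLeast {k | D.net.Ach k} I.opt := by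
  have hV : D.net.V = Finset.univ.image (Fin.val : Fin n → ℕ) := by
    rw [h.net_V]; ext v; simp [Fin.exists_iff]
  have hprof : ∀ e ∈ D.net.E, D.net.prof e = .single (D.ws e) (D.wt e) := fun e he =>
    if_pos (h.kind_eq_one he)
  have hbase : ∀ v, D.net.base v = 0 := h.base
  constructor
  · obtain ⟨H, hH, hc⟩ := I.opt_isLeast.1
    have := Net.ach_of_isSolution Fin.val_injective hV hprof (fun u v huv => by
      obtain ⟨e, he, h1⟩ := h.arc u v huv
      refine ⟨e, by rwa [h.net_E, Finset.mem_range], ?_⟩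
      obtain ⟨u', v', h2, h3, h4, h5, h6⟩ := h.edge e he
      rcases h1 with ⟨h1, h1'⟩ | ⟨h1, h1'⟩
      · have hu : u' = u := Fin.ext (h2.symm.trans h1)
        have hv : v' = v := Fin.ext (h3.symm.trans h1')
        subst hu hv
        exact Or.inl ⟨h1, h1', by omega⟩
      · have hu : u' = v := Fin.ext (h2.symm.trans h1')
        have hv : v' = u := Fin.ext (h3.symm.trans h1)
        subst hu hv
        refine Or.inr ⟨h1, h1', ?_⟩
        rcases h6 with h6 | h6
        · omega
        · exact absurd huv h6.1) hH
    simpa [hbase, hc] using this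
  · intro k hk
    by_contra hlt
    push Not at hlt
    obtain ⟨H, hH, hc⟩ := Net.exists_isSolution_of_ach (I := I) (k := k) (W := W) h.core.wf
      Fin.val_injective hV hprof (fun e he u v hu hv => by
        rw [h.net_E, Finset.mem_range] at he
        obtain ⟨u', v', h2, h3, h4, h5, h6⟩ := h.edge e he
        obtain rfl : u' = u := Fin.ext (h2.symm.trans hu)
        obtain rfl : v' = v := Fin.ext (h3.symm.trans hv)
        rw [hbase]
        exact Or.inr ⟨h4, by omega⟩)
      (fun e he u v hu hv => by
        rw [h.net_E, Finset.mem_range] at he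
        obtain ⟨u', v', h2, h3, h4, h5, h6⟩ := h.edge e he
        obtain rfl : u' = v := Fin.ext (h2.symm.trans hv)
        obtain rfl : v' = u := Fin.ext (h3.symm.trans hu)
        rw [hbase]
        rcases h6 with h6 | h6
        · exact Or.inr ⟨h6.1, by omega⟩
        · exact Or.inl (by omega)) (by simpa [hbase] using hk) (hlt.trans hW)
    have := I.opt_isLeast.2 ⟨H, hH, rfl⟩
    omega

/-- Stored edges correspond to edges of the underlying connected graph, so this is
`SimpleGraph.feedbackEdgeNumber_add_card`. -/
theorem card_E : D.net.E.card + 1 = D.net.V.card + I.feedbackEdgeNumber := by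
  have h1 := SimpleGraph.feedbackEdgeNumber_add_card I.connected
  rw [Fintype.card_fin] at h1
  have h2 : I.graph.toSimpleGraphInclusive.edgeSet.ncard = D.ne := by
    -- The comparison takes place in `Sym2 ℕ`, since the ends of stored edges are plain numbers.
    have h3 : Sym2.map Fin.val '' I.graph.toSimpleGraphInclusive.edgeSet =
        ((Finset.range D.ne).image fun e => s(D.src e, D.tgt e) : Finset (Sym2 ℕ)) := by
      ext x
      simp only [Set.mem_image, Finset.coe_image, Finset.coe_range, Set.mem_Iio]
      constructor
      · rintro ⟨y, hy, rfl⟩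
        induction y with | _ u v
        rw [SimpleGraph.mem_edgeSet, Digraph.toSimpleGraphInclusive, SimpleGraph.fromRel_adj] at hy
        rcases hy.2 with hy | hy
        · obtain ⟨e, he, h1 | h1⟩ := h.arc _ _ hy
          · exact ⟨e, he, by rw [h1.1, h1.2]; rfl⟩
          · exact ⟨e, he, by rw [h1.1, h1.2, Sym2.eq_swap]; rfl⟩
        · obtain ⟨e, he, h1 | h1⟩ := h.arc _ _ hy
          · exact ⟨e, he, by rw [h1.1, h1.2, Sym2.eq_swap]; rfl⟩
          · exact ⟨e, he, by rw [h1.1, h1.2]; rfl⟩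
      · rintro ⟨e, he, rfl⟩
        obtain ⟨u, v, h1, h2, h3, -⟩ := h.edge e he
        refine ⟨s(u, v), ?_, by rw [h1, h2]; rfl⟩
        rw [SimpleGraph.mem_edgeSet, Digraph.toSimpleGraphInclusive, SimpleGraph.fromRel_adj]
        exact ⟨by rintro rfl; exact I.loopless _ h3, Or.inl h3⟩
    rw [← Set.ncard_image_of_injective _ (Sym2.map.injective Fin.val_injective), h3,
      Set.ncard_coe_finset, Finset.card_image_of_injOn, Finset.card_range]
    intro e he e' he' hee
    simp only [Finset.coe_range, Set.mem_Iio] at he he'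
    exact h.par e he e' he' (by simpa using hee)
  rw [h.net_E, h.net_V, Finset.card_range, Finset.card_range]
  unfold MinPAC.feedbackEdgeNumber
  omega

end Represents

/-- The two arcs of an edge, with ends renamed by `idx` and weights reduced by the minimum
powers. -/
def arcPair (D : Data) (idx : ℕ → ℕ) (e : ℕ) : List (ℕ × ℕ × ℕ) :=
  [(idx (D.src e), idx (D.tgt e), D.ws e - D.base (D.src e)),
    (idx (D.tgt e), idx (D.src e), D.wt e - D.base (D.tgt e))]

/-- The arcs of the edges below `j`. -/
def arcList (D : Data) (idx : ℕ → ℕ) (j : ℕ) : List (ℕ × ℕ × ℕ) :=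
  ((List.range j).filter fun e => D.kind e ≠ 0).flatMap (D.arcPair idx)

/-- `idx` numbers the vertices of the stored network by `0, …, n - 1`. -/
structure Numbering (D : Data) (idx : ℕ → ℕ) (n : ℕ) : Prop where
  lt : ∀ v ∈ D.net.V, idx v < n
  inj : ∀ v ∈ D.net.V, ∀ v' ∈ D.net.V, idx v = idx v' → v = v'
  surj : ∀ i < n, ∃ v ∈ D.net.V, idx v = i

/-! ### From the stored network back to an instance -/

section output

variable {D : Data} {idx : ℕ → ℕ} {n : ℕ}

theorem mem_arcList {a : ℕ × ℕ × ℕ} :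
    a ∈ D.arcList idx D.ne ↔ ∃ e ∈ D.net.E, a ∈ D.arcPair idx e := by
  simp [arcList, mem_E, and_assoc]

theorem length_arcList : (D.arcList idx D.ne).length = 2 * D.net.E.card := by
  have h1 : D.net.E = ((List.range D.ne).filter fun e => D.kind e ≠ 0).toFinset := by
    ext e; simp [mem_E]
  rw [h1, List.toFinset_card_of_nodup (List.nodup_range.filter _), arcList, List.length_flatMap]
  have : ∀ l : List ℕ, (l.map fun e => (D.arcPair idx e).length).sum = 2 * l.length := by
    intro l
    induction l with
    | nil => rfl
    | cons a l ih => rw [List.map_cons, List.sum_cons, ih, List.length_cons]; simp [arcPair]; ring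
  exact this _

/-- The numbering is injective and parallel single edges are absent, so the ends determine the edge;
as the edge is no loop, they also determine which of its two arcs is meant. -/
theorem Core.ends_of_mem (hD : D.Core) (hk : ∀ e ∈ D.net.E, D.kind e = 1)
    (hidx : D.Numbering idx n) {e e' : ℕ} (he : e ∈ D.net.E) (he' : e' ∈ D.net.E)
    {a a' : ℕ × ℕ × ℕ} (ha : a ∈ D.arcPair idx e) (ha' : a' ∈ D.arcPair idx e')
    (h : (a.1, a.2.1) = (a'.1, a'.2.1)) : e = e' ∧ a = a' := by
  have h1 := hD.wf e he
  have h2 := hD.wf e' he'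
  have i1 := hidx.inj _ h1.1 _ h2.1
  have i2 := hidx.inj _ h1.1 _ h2.2
  have i3 := hidx.inj _ h1.2 _ h2.1
  have i4 := hidx.inj _ h1.2 _ h2.2
  have p := hD.par e he e' he' (hk e he) (hk e' he')
  have s := hD.simple e' he' (hk e' he')
  simp only [arcPair, List.mem_cons, List.not_mem_nil, or_false] at ha ha'
  rcases ha with rfl | rfl <;> rcases ha' with rfl | rfl <;> simp only [Prod.mk.injEq] at h
  · obtain rfl := p (Or.inl ⟨i1 h.1, i4 h.2⟩); exact ⟨rfl, rfl⟩
  · obtain rfl := p (Or.inr ⟨i2 h.1, i3 h.2⟩); exact absurd (i2 h.1) s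
  · obtain rfl := p (Or.inr ⟨i2 h.2, i3 h.1⟩); exact absurd (i2 h.2) s
  · obtain rfl := p (Or.inl ⟨i1 h.2, i4 h.1⟩); exact ⟨rfl, rfl⟩

theorem Core.nodup_arcList (hD : D.Core) (hk : ∀ e ∈ D.net.E, D.kind e = 1)
    (hidx : D.Numbering idx n) : ((D.arcList idx D.ne).map fun a => (a.1, a.2.1)).Nodup := by
  unfold arcList
  rw [List.map_flatMap, List.nodup_flatMap]
  have hmem : ∀ e ∈ (List.range D.ne).filter fun e => D.kind e ≠ 0, e ∈ D.net.E := by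
    intro e he; simpa [mem_E] using he
  constructor
  · intro e he
    have h1 := hD.wf e (hmem e he)
    have h2 := hD.simple e (hmem e he) (hk e (hmem e he))
    have h3 := hidx.inj _ h1.1 _ h1.2
    simp only [arcPair, List.map_cons, List.map_nil, List.nodup_cons, List.mem_cons,
      List.not_mem_nil, or_false, Prod.mk.injEq, not_false_eq_true, List.nodup_nil, and_true]
    exact fun h4 => h2 (h3 h4.1)
  · refine ((List.nodup_range.filter _)).imp_of_mem ?_
    intro e e' he he' hne
    simp only [Function.onFun, List.disjoint_left, List.mem_map]
    rintro b ⟨a, ha, rfl⟩ ⟨a', ha', h⟩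
    exact hne (hD.ends_of_mem hk hidx (hmem e he) (hmem e' he') ha ha' h.symm).1

/-- Every edge becomes two opposite arcs whose weights are reduced by the minimum powers of their
tails. The minimum powers are paid in any case, so the optimum drops by exactly their sum. Strong
connectivity is inherited from any strongly connecting choice. -/
theorem Core.exists_minPAC (hD : D.Core) (hk : ∀ e ∈ D.net.E, D.kind e = 1)
    (hidx : D.Numbering idx n) (hne : D.net.V.Nonempty) {k : ℕ}
        (hopt : IsLeast {k | D.net.Ach k} k) :
    ∃ I : MinPAC (Fin n), I.arcs.card = 2 * D.net.E.card ∧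
      k = I.opt + ∑ v ∈ D.net.V, D.base v ∧
      ∀ s : RAM.State, s.reg 0 = n → s.reg 1 = (D.arcList idx D.ne).length →
        (∀ i (h : i < (D.arcList idx D.ne).length), s.arr 0 i = (D.arcList idx D.ne)[i].1 ∧
          s.arr 1 i = (D.arcList idx D.ne)[i].2.1 ∧ s.arr 2 i = (D.arcList idx D.ne)[i].2.2) →
        s.Stores I := by
  classical
  choose! φ' hφV hφi using hidx.surj
  let φ : Fin n → ℕ := fun i => φ' i
  have hφi' : ∀ i : Fin n, idx (φ i) = i := fun i => hφi i i.2
  have hφV' : ∀ i : Fin n, φ i ∈ D.net.V := fun i => hφV i i.2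
  have hφ : Function.Injective φ := fun i j hij => Fin.ext (by rw [← hφi' i, hij, hφi' j])
  have hφidx : ∀ v (hv : v ∈ D.net.V), φ ⟨idx v, hidx.lt v hv⟩ = v := fun v hv =>
    hidx.inj _ (hφV' _) _ hv (hφi' _)
  have hV : D.net.V = Finset.univ.image φ := by
    ext v
    simp only [Finset.mem_image, Finset.mem_univ, true_and]
    exact ⟨fun hv => ⟨_, hφidx v hv⟩, fun ⟨i, hi⟩ => hi ▸ hφV' i⟩
  obtain ⟨v₀, hv₀⟩ := hne
  have hn : n ≠ 0 := by have := hidx.lt v₀ hv₀; omega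
  have : NeZero n := ⟨hn⟩
  set L := D.arcList idx D.ne with hL
  have hmemL : ∀ a ∈ L, ∃ e ∈ D.net.E, a ∈ D.arcPair idx e := fun a ha => mem_arcList.1 ha
  have hlt : ∀ a ∈ L, a.1 < n ∧ a.2.1 < n := by
    intro a ha
    obtain ⟨e, he, ha⟩ := hmemL a ha
    have := hD.wf e he
    simp only [arcPair, List.mem_cons, List.not_mem_nil, or_false] at ha
    rcases ha with rfl | rfl
    · exact ⟨hidx.lt _ this.1, hidx.lt _ this.2⟩
    · exact ⟨hidx.lt _ this.2, hidx.lt _ this.1⟩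
  have huniq : ∀ a ∈ L, ∀ a' ∈ L, a.1 = a'.1 → a.2.1 = a'.2.1 → a = a' := by
    intro a ha a' ha' h1 h2
    obtain ⟨e, he, ha⟩ := hmemL a ha
    obtain ⟨e', he', ha'⟩ := hmemL a' ha'
    exact (hD.ends_of_mem hk hidx he he' ha ha' (by rw [h1, h2])).2
  let adj : Digraph (Fin n) := ⟨fun i j => ∃ w, ((i : ℕ), (j : ℕ), w) ∈ L⟩
  let wgt : Fin n → Fin n → ℕ := fun i j =>
    if h : ∃ w, ((i : ℕ), (j : ℕ), w) ∈ L then h.choose else 0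
  have hwgt : ∀ (i j : Fin n) w, ((i : ℕ), (j : ℕ), w) ∈ L → wgt i j = w := by
    intro i j w hw
    have h : ∃ w, ((i : ℕ), (j : ℕ), w) ∈ L := ⟨w, hw⟩
    have := huniq _ h.choose_spec _ hw rfl rfl
    simp only [wgt, dif_pos h]
    exact congrArg (fun a : ℕ × ℕ × ℕ => a.2.2) this
  have hloop : ∀ i, ¬ adj.Adj i i := by
    rintro i ⟨w, hw⟩
    obtain ⟨e, he, ha⟩ := hmemL _ hw
    have h1 := hD.wf e he
    have h2 := hD.simple e he (hk e he)
    simp only [arcPair, List.mem_cons, List.not_mem_nil, or_false, Prod.mk.injEq] at ha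
    rcases ha with ha | ha
    · exact h2 (hidx.inj _ h1.1 _ h1.2 (ha.1.symm.trans ha.2.1))
    · exact h2 (hidx.inj _ h1.1 _ h1.2 (ha.2.1.symm.trans ha.1))
  have hsrc : ∀ e ∈ D.net.E, ∀ i j, D.src e = φ i → D.tgt e = φ j →
      ((i : ℕ), (j : ℕ), D.ws e - D.base (φ i)) ∈ L ∧
      ((j : ℕ), (i : ℕ), D.wt e - D.base (φ j)) ∈ L := by
    intro e he i j hi hj
    rw [← hφi' i, ← hφi' j, ← hi, ← hj]
    exact ⟨mem_arcList.2 ⟨e, he, by simp [arcPair]⟩, mem_arcList.2 ⟨e, he, by simp [arcPair]⟩⟩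
  have hends : ∀ e ∈ D.net.E, ∃ i j, D.src e = φ i ∧ D.tgt e = φ j := fun e he =>
    ⟨_, _, (hφidx _ (hD.wf e he).1).symm, (hφidx _ (hD.wf e he).2).symm⟩
  have hstrong : IsStronglyConnected adj := by
    obtain ⟨π, f, b, c, -, -, hc, -⟩ := hopt.1
    intro i j
    have key : ∀ y, Relation.ReflTransGen (D.net.Step f b) (φ i) y →
        ∃ j, y = φ j ∧ Relation.ReflTransGen adj.Adj i j := by
      intro y hy
      induction hy with
      | refl => exact ⟨i, rfl, .refl⟩
      | tail _ hyz ih =>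
        obtain ⟨j, rfl, hj⟩ := ih
        obtain ⟨e, he, h1⟩ := hyz
        obtain ⟨i', j', h2, h3⟩ := hends e he
        have h4 := hsrc e he i' j' h2 h3
        rcases h1 with ⟨-, h1, rfl⟩ | ⟨-, h1, rfl⟩
        · obtain rfl := hφ (h2.symm.trans h1)
          exact ⟨j', h3, hj.tail ⟨_, h4.1⟩⟩
        · obtain rfl := hφ (h3.symm.trans h1)
          exact ⟨i', h2, hj.tail ⟨_, h4.2⟩⟩
    obtain ⟨j', h1, h2⟩ := key _ (hc _ (hφV' i) _ (hφV' j))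
    rwa [hφ h1]
  let I : MinPAC (Fin n) := ⟨⟨0⟩, adj, hloop, hstrong, wgt⟩
  -- `Fin.ofNat` reduces modulo `n`, which has no effect here because all ends in `L` are below `n`.
  let toFin : ℕ × ℕ × ℕ → Fin n × Fin n := fun a => (Fin.ofNat n a.1, Fin.ofNat n a.2.1)
  have htoFin : ∀ a ∈ L, ((toFin a).1 : ℕ) = a.1 ∧ ((toFin a).2 : ℕ) = a.2.1 := fun a ha =>
    ⟨Nat.mod_eq_of_lt (hlt a ha).1, Nat.mod_eq_of_lt (hlt a ha).2⟩
  have hnodup : (L.map toFin).Nodup := by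
    refine List.Nodup.map_on (fun a ha a' ha' h => huniq a ha a' ha' ?_ ?_)
      (List.Nodup.of_map _ (hD.nodup_arcList hk hidx))
    · rw [← (htoFin a ha).1, h, (htoFin a' ha').1]
    · rw [← (htoFin a ha).2, h, (htoFin a' ha').2]
  have hadj : ∀ u v, (u, v) ∈ L.map toFin ↔ I.graph.Adj u v := by
    intro u v
    rw [List.mem_map]
    constructor
    · rintro ⟨a, ha, h⟩
      refine ⟨a.2.2, ?_⟩
      have h1 := htoFin a ha
      rw [h] at h1
      rw [h1.1, h1.2]
      exact ha
    · rintro ⟨w, hw⟩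
      exact ⟨_, hw, Prod.ext (Fin.ext (htoFin _ hw).1) (Fin.ext (htoFin _ hw).2)⟩
  have hprof : ∀ e ∈ D.net.E, D.net.prof e = .single (D.ws e) (D.wt e) := fun e he =>
    if_pos (hk e he)
  refine ⟨I, ?_, ?_, ?_⟩
  · have : I.arcs = (L.map toFin).toFinset := by
      ext ⟨u, v⟩
      rw [List.mem_toFinset, hadj]
      simp [MinPAC.arcs]
    rw [this, List.toFinset_card_of_nodup hnodup, List.length_map, length_arcList]
  · apply le_antisymm
    · obtain ⟨H, hH, hc⟩ := I.opt_isLeast.1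
      refine hopt.2 ?_
      rw [← hc]
      refine Net.ach_of_isSolution hφ hV hprof ?_ hH
      rintro u v ⟨w, hw⟩
      obtain ⟨e, he, ha⟩ := hmemL _ hw
      obtain ⟨i, j, h1, h2⟩ := hends e he
      have h3 := hsrc e he i j h1 h2
      refine ⟨e, he, ?_⟩
      simp only [arcPair, List.mem_cons, List.not_mem_nil, or_false, Prod.mk.injEq, h1, h2,
        hφi'] at ha
      rcases ha with ha | ha
      · obtain rfl := Fin.ext ha.1
        obtain rfl := Fin.ext ha.2.1
        refine Or.inl ⟨h1, h2, ?_⟩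
        change _ ≤ wgt u v + D.base (φ u)
        rw [hwgt u v _ h3.1]
        omega
      · obtain rfl := Fin.ext ha.1
        obtain rfl := Fin.ext ha.2.1
        refine Or.inr ⟨h2, h1, ?_⟩
        change _ ≤ wgt u v + D.base (φ u)
        rw [hwgt u v _ h3.2]
        omega
    · have hb := hopt.1.sum_base_le
      obtain ⟨H, hH, hc⟩ := Net.exists_isSolution_of_ach (I := I)
        -- All arcs are present in the new instance, so the alternative of expensive arcs never
        -- occurs and `W` only has to exceed the cost.
        (k := k - ∑ v ∈ D.net.V, D.net.base v) (W := k + 1) hD.wf hφ hV hprof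
        (fun e he u v hu hv => Or.inr ⟨⟨_, (hsrc e he u v hu hv).1⟩,
          (hwgt u v _ (hsrc e he u v hu hv).1).le⟩)
        (fun e he u v hu hv => Or.inr ⟨⟨_, (hsrc e he v u hv hu).2⟩,
          (hwgt u v _ (hsrc e he v u hv hu).2).le⟩)
        (by rw [Nat.sub_add_cancel hb]; exact hopt.1) (by omega)
      have h1 := I.opt_isLeast.2 ⟨H, hH, rfl⟩
      change _ + ∑ v ∈ D.net.V, D.net.base v ≤ k
      omega
  · intro s h0 h1 h2
    refine ⟨h0, L.map toFin, hnodup, hadj, by rw [h1, List.length_map], ?_⟩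
    intro i hi
    have hi' : i < L.length := by rwa [List.length_map] at hi
    obtain ⟨h3, h4, h5⟩ := h2 i hi'
    have h6 := htoFin _ (List.getElem_mem hi')
    rw [List.getElem_map, h3, h4, h5, h6.1, h6.2]
    refine ⟨rfl, rfl, (hwgt _ _ _ ?_).symm⟩
    rw [h6.1, h6.2]
    exact List.getElem_mem hi'

end output

end Data


/-! ### Code for the elementary operations on the stored network -/

namespace RAM

open Function

infixr:30 " ;; " => Stmt.seq

/-- The data structure in memory. -/
def view (s : State) : Data where
  nv := s.reg 5
  ne := s.reg 4
  kind := s.arr 3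
  src := s.arr 4
  tgt := s.arr 5
  ws := s.arr 6
  wt := s.arr 7
  A := s.arr 8
  B := s.arr 9
  a₀ := s.arr 10
  b₀ := s.arr 11
  a₁ := s.arr 12
  b₁ := s.arr 13
  dead := s.arr 14
  base := s.arr 15
  deg := s.arr 16
  inc := s.arr 17

/-- Exchange the entries of two arrays at the index in register `r`. -/
def swapStmt (a b r : ℕ) : Stmt :=
  .assign 20 (.load a (.var r)) ;; .store a (.var r) (.load b (.var r)) ;; .store b (.var r)
      (.var 20)

/-- Reverse the edge in register `r`. -/
def flipStmt (r : ℕ) : Stmt :=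
  swapStmt 4 5 r ;; swapStmt 6 7 r ;; swapStmt 8 9 r ;; swapStmt 10 11 r ;; swapStmt 12 13 r

theorem wp_flipStmt {B r : ℕ} {Q : State → Prop} {s : State} (hr : r ≠ 20)
    (h : ∀ s', view s' = (view s).flip (s.reg r) → (∀ x, x ≠ 20 → s'.reg x = s.reg x) → Q s') :
    (flipStmt r).wp B Q s := by
  simp only [flipStmt, swapStmt, Stmt.wp, Expr.Safe, Expr.eval, State.reg_setReg, State.reg_setArr,
    State.arr_setReg, State.arr_setArr, true_and, if_neg hr, reduceIte, Nat.reduceEqDiff]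
  apply h
  · simp [view, Data.flip, State.reg_setReg, State.reg_setArr, State.arr_setReg, State.arr_setArr]
  · intro x hx
    simp [State.reg_setReg, State.reg_setArr, hx]

/-- Remove the leaf in register `8`, which is the target of the edge in register `9`. -/
def pruneStmt : Stmt :=
  .assign 10 (.load 4 (.var 9)) ;;
  .assign 2 (.add (.var 2) (.max (.load 15 (.var 8)) (.load 7 (.var 9)))) ;;
  .store 15 (.var 10) (.max (.load 15 (.var 10)) (.load 6 (.var 9))) ;;
  .store 3 (.var 9) (.const 0) ;;
  .store 14 (.var 8) (.const 1) ;;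
  .store 16 (.var 8) (.const 0) ;;
  .store 16 (.var 10) (.sub (.load 16 (.var 10)) (.const 1)) ;;
  .store 17 (.var 8) (.const 0) ;;
  .store 17 (.var 10) (.sub (.load 17 (.var 10)) (.var 9)) ;;
  .assign 8 (.var 10)

theorem Expr.eval_max (s : State) (a b : Expr) :
    (a.max b).eval s = Max.max (a.eval s) (b.eval s) := by
  simp only [Expr.max, Expr.eval]; omega

theorem Expr.safe_max {B : ℕ} {s : State} {a b : Expr} :
    (a.max b).Safe B s ↔ a.Safe B s ∧ b.Safe B s ∧ Max.max (a.eval s) (b.eval s) ≤ B := by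
  simp only [Expr.max, Expr.Safe, Expr.eval]
  have : a.eval s + (b.eval s - a.eval s) = Max.max (a.eval s) (b.eval s) := by omega
  rw [this]
  tauto

theorem wp_pruneStmt {B : ℕ} {Q : State → Prop} {s : State} {x e : ℕ} (hx : s.reg 8 = x)
    (he : s.reg 9 = e) (hne : (view s).src e ≠ x)
    (hB : s.reg 2 + max ((view s).base x) ((view s).wt e) ≤ B)
    (hB' : max ((view s).base ((view s).src e)) ((view s).ws e) ≤ B) (hB'' : 1 ≤ B)
    (h : ∀ s', view s' = (view s).prune x e →
      s'.reg 2 = s.reg 2 + max ((view s).base x) ((view s).wt e) → s'.reg 8 = (view s).src e →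
      s'.reg 3 = s.reg 3 → Q s') :
    pruneStmt.wp B Q s := by
  subst hx he
  simp only [view] at hB hB' hne
  simp only [pruneStmt, Stmt.wp, Expr.Safe, Expr.eval, Expr.safe_max, Expr.eval_max,
    State.reg_setReg, State.reg_setArr,
    State.arr_setReg, State.arr_setArr, true_and, reduceIte, Nat.reduceEqDiff]
  refine ⟨⟨by omega, by omega⟩, by omega, by omega, by omega, by omega, by omega, by omega, ?_⟩
  apply h
  · simp [view, Data.prune, State.reg_setReg, State.reg_setArr, State.arr_setReg, State.arr_setArr,
      hne]
  · simp [State.reg_setReg, State.reg_setArr, view]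
  · simp [State.reg_setReg, view]
  · simp [State.reg_setReg, State.reg_setArr]

/-- Update the summary of the edge in register `3` for the join with the edge in register `9` at
the vertex in register `8`. -/
def summaryStmt : Stmt :=
  .assign 12 (.max (.load 15 (.var 8)) (.load 7 (.var 3))) ;;
  .assign 13 (.max (.load 15 (.var 8)) (.load 6 (.var 9))) ;;
  .assign 2 (.add (.var 2) (.sub (.var 12) (.sub (.var 12) (.var 13)))) ;;
  .assign 14 (.sub (.var 13) (.var 12)) ;;
  .assign 15 (.sub (.var 12) (.var 13)) ;;
  .ifEq (.load 3 (.var 3)) (.const 1)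
    (.store 8 (.var 3) (.var 14) ;; .store 9 (.var 3) (.var 15) ;; .store 11 (.var 3) (.var 15) ;;
      .store 12 (.var 3) (.const 0) ;; .store 13 (.var 3) (.const 0))
    (.ifLe (.add (.load 10 (.var 3)) (.var 15)) (.add (.load 12 (.var 3)) (.load 13 (.var 3)))
        .skip (.store 12 (.var 3) (.load 10 (.var 3)) ;; .store 13 (.var 3) (.var 15)) ;;
      .store 8 (.var 3) (.add (.load 8 (.var 3)) (.var 14)) ;;
      .store 9 (.var 3) (.add (.load 9 (.var 3)) (.var 15))) ;;
  .store 10 (.var 3) (.var 14)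

/-- Join the edge in register `9` to the edge in register `3` at the vertex in register `8`. -/
def contractStmt : Stmt :=
  summaryStmt ;;
  .store 3 (.var 3) (.const 2) ;;
  .store 3 (.var 9) (.const 0) ;;
  .assign 10 (.load 5 (.var 9)) ;;
  .store 5 (.var 3) (.var 10) ;;
  .store 7 (.var 3) (.load 7 (.var 9)) ;;
  .store 14 (.var 8) (.const 1) ;;
  .store 16 (.var 8) (.const 0) ;;
  .store 17 (.var 8) (.const 0) ;;
  .store 17 (.var 10) (.sub (.add (.load 17 (.var 10)) (.var 3)) (.var 9))

theorem wp_contractStmt {B : ℕ} {Q : State → Prop} {s : State} {i e : ℕ} (hi : s.reg 3 = i)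
    (he : s.reg 9 = e) (hx : s.reg 8 = (view s).tgt i) (hc : (view s).Contractible i e)
    (hB₁ : s.reg 2 + (view s).need i ≤ B) (hB₂ : (view s).need' e ≤ B)
    (hB₃ : (view s).a₀ i + (view s).need i ≤ B) (hB₄ : (view s).a₁ i + (view s).b₁ i ≤ B)
    (hB₅ : (view s).A i + (view s).need' e ≤ B) (hB₆ : (view s).B i + (view s).need i ≤ B)
    (hB₇ : (view s).inc ((view s).tgt e) + i ≤ B) (hB₈ : 2 ≤ B)
    (h : ∀ s', view s' = (view s).contract i e →
      s'.reg 2 = s.reg 2 + min ((view s).need i) ((view s).need' e) →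
      s'.reg 3 = s.reg 3 → Q s') :
    contractStmt.wp B Q s := by
  have hne := hc.tgt_e
  have hie := hc.ne
  have hk2 : (view s).kind i ≠ 1 → (view s).kind i = 2 := by
    have := hc.core.kind_le i
    have := (Data.mem_E.1 hc.mem_i).2
    omega
  simp only [Data.need, Data.need', hc.src_e] at hB₁ hB₂ hB₃ hB₅ hB₆ h
  subst hi he
  -- The code computes minima by two truncated subtractions.
  have hmin : ∀ q r : ℕ, q - (q - r) = min q r := fun q r => by omega
  simp only [contractStmt, summaryStmt, Stmt.wp, Expr.Safe, Expr.eval, Expr.safe_max,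
    Expr.eval_max, State.reg_setReg, State.reg_setArr,
    State.arr_setReg, State.arr_setArr, true_and, reduceIte, Nat.reduceEqDiff, and_true, hx, hmin]
  have hs : (view s).src (s.reg 9) = (view s).tgt (s.reg 3) := hc.src_e
  simp only [view] at *
  set q := max (s.arr 15 (s.arr 5 (s.reg 3))) (s.arr 7 (s.reg 3)) with hq
  set r := max (s.arr 15 (s.arr 5 (s.reg 3))) (s.arr 6 (s.reg 9)) with hr
  have hinc : update (s.arr 17) (s.arr 5 (s.reg 3)) 0 (s.arr 5 (s.reg 9)) + s.reg 3 ≤ B := by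
    rwa [update_of_ne hne]
  refine ⟨by omega, by omega, by omega, by omega, fun hk => ⟨by omega, by omega, by omega, by omega,
    by omega, by omega,
    by omega, hinc, ?_⟩, fun hk => ⟨by omega, by omega, fun hle => ⟨by omega, by omega, by omega,
    by omega, by omega, by omega,
    by omega, hinc, ?_⟩, fun hlt => ⟨by omega, by omega, by omega,
    by omega, by omega, by omega,
    by omega, hinc, ?_⟩⟩⟩
  all_goals
    apply h
    · simp only [Data.contract, Data.need, Data.need', State.reg_setReg, State.reg_setArr,
        State.arr_setReg, State.arr_setArr, Nat.reduceEqDiff, reduceIte, hs, ← hq, ← hr]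
      first
      | (simp only [hk, reduceIte, update_of_ne hne]; done)
      | simp only [hk, hle, reduceIte, update_of_ne hne, update_eq_self]
      | simp only [hk, reduceIte, update_of_ne hne, if_neg hlt.not_ge, update_eq_self]
    · simp [State.reg_setReg, State.reg_setArr]
    · simp [State.reg_setReg, State.reg_setArr]

/-- Subdivide the edge in register `3`, with the weights in the registers `a` and `b`. -/
def peelStmt (a b : ℕ) : Stmt :=
  .store 3 (.var 4) (.const 1) ;;
  .store 4 (.var 4) (.var 5) ;;
  .store 5 (.var 4) (.load 5 (.var 3)) ;;
  .store 5 (.var 3) (.var 5) ;;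
  .store 6 (.var 4) (.var a) ;;
  .store 7 (.var 4) (.load 7 (.var 3)) ;;
  .store 7 (.var 3) (.var b) ;;
  .assign 4 (.add (.var 4) (.const 1)) ;;
  .assign 5 (.add (.var 5) (.const 1))

theorem wp_peelStmt {B a b : ℕ} {Q : State → Prop} {s : State} (ha : 20 < a) (hb : 20 < b)
    (hB₁ : s.reg 4 + 1 ≤ B) (hB₂ : s.reg 5 + 1 ≤ B)
    (h : ∀ s', view s' = (view s).peel (s.reg 3) (s.reg a) (s.reg b) →
      (∀ x, x ≠ 4 → x ≠ 5 → s'.reg x = s.reg x) → Q s') :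
    (peelStmt a b).wp B Q s := by
  have ha' : a ≠ 4 ∧ a ≠ 5 := by omega
  have hb' : b ≠ 4 ∧ b ≠ 5 := by omega
  simp only [peelStmt, Stmt.wp, Expr.Safe, Expr.eval, State.reg_setReg, State.reg_setArr,
    State.arr_setArr, true_and, reduceIte, Nat.reduceEqDiff]
  refine ⟨by omega, by omega, by omega, ?_⟩
  apply h
  · simp only [view, Data.peel, State.reg_setReg, State.reg_setArr, State.arr_setReg,
      State.arr_setArr, Nat.reduceEqDiff, reduceIte]
  · intro x h4 h5
    simp [State.reg_setReg, State.reg_setArr, h4, h5]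

/-- Replace the path edge in register `3` by a path with six inner vertices. -/
def expandStmt : Stmt :=
  .assign 21 (.load 10 (.var 3)) ;;
  .assign 22 (.sub (.sub (.load 8 (.var 3)) (.var 21)) (.load 12 (.var 3))) ;;
  .assign 23 (.load 13 (.var 3)) ;;
  .assign 24 (.load 12 (.var 3)) ;;
  .assign 26 (.load 11 (.var 3)) ;;
  .assign 25 (.sub (.sub (.load 9 (.var 3)) (.var 26)) (.var 23)) ;;
  .assign 27 (.const 0) ;;
  peelStmt 21 27 ;; peelStmt 22 27 ;; peelStmt 27 23 ;; peelStmt 24 27 ;; peelStmt 27 25 ;;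
  peelStmt 27 26 ;;
  .store 3 (.var 3) (.const 1)

theorem wp_expandStmt {B : ℕ} {Q : State → Prop} {s : State}
    (hB₁ : s.reg 4 + 6 ≤ B) (hB₂ : s.reg 5 + 6 ≤ B)
    (h : ∀ s', view s' = (view s).expand (s.reg 3) →
      (∀ x, x ≠ 4 → x ≠ 5 → x < 21 → s'.reg x = s.reg x) → Q s') :
    expandStmt.wp B Q s := by
  simp only [expandStmt, Stmt.wp, Expr.Safe, Expr.eval, State.reg_setReg,
    State.arr_setReg, true_and, and_true, reduceIte, Nat.reduceEqDiff]
  refine ⟨by omega, ?_⟩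
  set s₀ := ((((((s.setReg 21 (s.arr 10 (s.reg 3))).setReg 22
    (s.arr 8 (s.reg 3) - s.arr 10 (s.reg 3) - s.arr 12 (s.reg 3))).setReg 23
    (s.arr 13 (s.reg 3))).setReg 24 (s.arr 12 (s.reg 3))).setReg 26 (s.arr 11 (s.reg 3))).setReg 25
    (s.arr 9 (s.reg 3) - s.arr 11 (s.reg 3) - s.arr 13 (s.reg 3))).setReg 27 0 with hs₀
  have hv : view s₀ = view s := by simp [hs₀, view, State.reg_setReg, State.arr_setReg]
  have hlow : ∀ x < 21, s₀.reg x = s.reg x := by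
    intro x hx
    simp only [hs₀, State.reg_setReg]
    repeat rw [if_neg (by omega)]
  have h3 := hlow 3 (by omega)
  have h4 := hlow 4 (by omega)
  have h5 := hlow 5 (by omega)
  have e21 : s₀.reg 21 = (view s).a₀ (s.reg 3) := by simp [hs₀, view, State.reg_setReg]
  have e22 : s₀.reg 22 = (view s).A (s.reg 3) - (view s).a₀ (s.reg 3) - (view s).a₁ (s.reg 3) := by
    simp [hs₀, view, State.reg_setReg]
  have e23 : s₀.reg 23 = (view s).b₁ (s.reg 3) := by simp [hs₀, view, State.reg_setReg]
  have e24 : s₀.reg 24 = (view s).a₁ (s.reg 3) := by simp [hs₀, view, State.reg_setReg]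
  have e26 : s₀.reg 26 = (view s).b₀ (s.reg 3) := by simp [hs₀, view, State.reg_setReg]
  have e25 : s₀.reg 25 = (view s).B (s.reg 3) - (view s).b₀ (s.reg 3) - (view s).b₁ (s.reg 3) := by
    simp [hs₀, view, State.reg_setReg]
  have e27 : s₀.reg 27 = 0 := by simp [hs₀, State.reg_setReg]
  clear_value s₀
  have c4 : ∀ {s s' : State} {i α β}, view s' = (view s).peel i α β → s'.reg 4 = s.reg 4 + 1 :=
    fun h => congrArg Data.ne h
  have c5 : ∀ {s s' : State} {i α β}, view s' = (view s).peel i α β → s'.reg 5 = s.reg 5 + 1 :=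
    fun h => congrArg Data.nv h
  refine wp_peelStmt (by omega) (by omega) (by omega) (by omega) fun s₁ v₁ r₁ => ?_
  have := c4 v₁; have := c5 v₁
  refine wp_peelStmt (by omega) (by omega) (by omega) (by omega) fun s₂ v₂ r₂ => ?_
  have := c4 v₂; have := c5 v₂
  refine wp_peelStmt (by omega) (by omega) (by omega) (by omega) fun s₃ v₃ r₃ => ?_
  have := c4 v₃; have := c5 v₃
  refine wp_peelStmt (by omega) (by omega) (by omega) (by omega) fun s₄ v₄ r₄ => ?_
  have := c4 v₄; have := c5 v₄
  refine wp_peelStmt (by omega) (by omega) (by omega) (by omega) fun s₅ v₅ r₅ => ?_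
  have := c4 v₅; have := c5 v₅
  refine wp_peelStmt (by omega) (by omega) (by omega) (by omega) fun s₆ v₆ r₆ => ?_
  have hr : ∀ x, x ≠ 4 → x ≠ 5 → s₆.reg x = s₀.reg x := fun x h h' => by
    rw [r₆ x h h', r₅ x h h', r₄ x h h', r₃ x h h', r₂ x h h', r₁ x h h']
  refine ⟨by omega, h _ ?_ ?_⟩
  · have : view (s₆.setArr 3 (s₆.reg 3) 1) = (view s₆).toSingle (s₆.reg 3) := by
      simp [view, Data.toSingle, State.reg_setArr, State.arr_setArr]
    rw [this, v₆, v₅, v₄, v₃, v₂, v₁, hv]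
    simp only [r₆, r₅, r₄, r₃, r₂, r₁, ne_eq, Nat.reduceEqDiff, not_false_eq_true, h3, e21, e22,
      e23, e24, e25, e26, e27]
    rfl
  · intro x hx4 hx5 hx
    simp only [State.reg_setArr, hr x hx4 hx5, hlow x hx]

end RAM


/-! ## Removing the leaves and contracting the paths -/

namespace Data

open Function

/-- Every edge contributes at most twice to a vertex. The bounds are crude, and serve to keep `deg`
and `inc` within a machine word. -/
theorem Degs.le {D : Data} (h : D.Degs) (v : ℕ) :
    D.deg v ≤ 2 * D.ne ∧ D.inc v ≤ 2 * D.ne * D.ne := by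
  have hE : D.net.E.card ≤ D.ne := 
    (Finset.card_le_card (Finset.filter_subset _ _)).trans (Finset.card_range _).le
  have key : ∀ (φ : ℕ → ℕ) (c : ℕ), (∀ e < D.ne, φ e ≤ c) →
      D.net.load φ v ≤ 2 * c * D.ne := by
    intro φ c hc
    calc _ ≤ ∑ e ∈ D.net.E, 2 * c := Finset.sum_le_sum fun e he => by
          have := hc e (mem_E.1 he).1
          split_ifs <;> omega
      _ ≤ 2 * c * D.ne := by
        rw [Finset.sum_const, smul_eq_mul, mul_comm]
        exact Nat.mul_le_mul_left _ hE
  rw [h.1, h.2]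
  exact ⟨by simpa using key (fun _ => 1) 1 fun _ _ => le_rfl, key id D.ne fun e he => he.le⟩

/-- The invariants of the reduction from the network `N₀`, with `n` vertices and `m` edges of
weights at most `K`, to the stored network. -/
structure Stage (D : Data) (N₀ : Net) (n m g K d : ℕ) : Prop where
  core : D.Core
  degs : D.Degs
  reduces : N₀.Reduces D.net d
  card : D.net.E.card + 1 = D.net.V.card + g
  nv : D.nv = n
  ne : D.ne = m
  base_le : ∀ v, D.base v ≤ K
  ws_le : ∀ e, D.ws e ≤ K
  wt_le : ∀ e, D.wt e ≤ K
  gains_le : ∀ e, D.A e + K * D.net.V.card ≤ K * n ∧ D.B e + K * D.net.V.card ≤ K * n ∧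
    D.a₀ e + K * D.net.V.card ≤ K * n ∧ D.b₀ e + K * D.net.V.card ≤ K * n ∧
    D.a₁ e + K * D.net.V.card ≤ K * n ∧ D.b₁ e + K * D.net.V.card ≤ K * n

theorem update_le {f : ℕ → ℕ} {M i a : ℕ} (hf : ∀ j, f j ≤ M) (ha : a ≤ M) (j : ℕ) :
    update f i a j ≤ M := by
  rw [update_apply]
  split_ifs
  exacts [ha, hf j]

namespace Stage

variable {D : Data} {N₀ : Net} {n m g K d k₀ : ℕ} (h : D.Stage N₀ n m g K d)

include h

theorem flip (e : ℕ) : (D.flip e).Stage N₀ n m g K d where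
  core := h.core.flip
  degs := h.degs.flip
  reduces := h.reduces.trans flip_reduces
  card := h.card
  nv := h.nv
  ne := h.ne
  base_le := h.base_le
  ws_le := update_le h.ws_le (h.wt_le e)
  wt_le := update_le h.wt_le (h.ws_le e)
  gains_le e' := by
    change _ + K * D.net.V.card ≤ _ ∧ _ + K * D.net.V.card ≤ _ ∧ _ + K * D.net.V.card ≤ _ ∧
      _ + K * D.net.V.card ≤ _ ∧ _ + K * D.net.V.card ≤ _ ∧ _ + K * D.net.V.card ≤ _
    have h1 := h.gains_le e'
    by_cases h2 : e' = e
    · subst h2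
      simp only [Data.flip, update_self]
      tauto
    · simpa only [Data.flip, update_of_ne h2] using h1

theorem prune {x e : ℕ} (he : e ∈ D.net.E) (hk : D.kind e = 1) (ht : D.tgt e = x)
    (ho : ∀ e' ∈ D.net.E, e' ≠ e → D.src e' ≠ x ∧ D.tgt e' ≠ x) :
    (D.prune x e).Stage N₀ n m g K (d + max (D.base x) (D.wt e)) := by
  have hx : x ∈ D.net.V := ht ▸ (h.core.wf e he).2
  have hV : (D.prune x e).net.V.card + 1 = D.net.V.card := by
    rw [prune_V, Finset.card_erase_add_one hx]
  have hE : (D.prune x e).net.E.card + 1 = D.net.E.card := by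
    rw [prune_E, Finset.card_erase_add_one he]
  have hc := h.card
  refine ⟨h.core.prune he hk ht ho, h.degs.prune h.core he hk ht ho,
    h.reduces.trans (prune_leaf h.core he hk ht ho).reduces, by omega, h.nv, h.ne,
    update_le h.base_le (max_le (h.base_le _) (h.ws_le _)), h.ws_le, h.wt_le, fun e' => ?_⟩
  have h1 := h.gains_le e'
  have h2 : K * (D.prune x e).net.V.card ≤ K * D.net.V.card := Nat.mul_le_mul_left _ (by omega)
  simp only [Data.prune] at h2 ⊢
  omega

theorem need_le (e : ℕ) : D.need e ≤ K := max_le (h.base_le _) (h.wt_le _)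

theorem need'_le (e : ℕ) : D.need' e ≤ K := max_le (h.base_le _) (h.ws_le _)

/-- A contraction removes one vertex and raises no stored cost or gain by more than `K`. So these
numbers stay within `K` times the number of removed vertices, which is `gains_le` written without
subtraction. -/
theorem contract {i e : ℕ} (hc : D.Contractible i e) :
    (D.contract i e).Stage N₀ n m g K (d + min (D.need i) (D.need' e)) := by
  have hx : D.tgt i ∈ D.net.V := (h.core.wf i hc.mem_i).2
  have hV : (D.contract i e).net.V.card + 1 = D.net.V.card := by
    rw [contract_V, Finset.card_erase_add_one hx]
  have hE : (D.contract i e).net.E.card + 1 = D.net.E.card := by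
    rw [hc.E_eq, Finset.card_erase_add_one hc.mem_e]
  have hcard := h.card
  refine ⟨hc.core', hc.degs h.degs, h.reduces.trans hc.reduces, by omega, h.nv, h.ne, h.base_le,
    h.ws_le, update_le h.wt_le (h.wt_le _), fun e' => ?_⟩
  have h1 := h.gains_le e'
  have h2 := h.need_le i
  have h3 := h.need'_le e
  have h4 : K * D.net.V.card = K * (D.contract i e).net.V.card + K := by rw [← hV, mul_add_one]
  rw [h4] at h1
  generalize K * (D.contract i e).net.V.card = M at *
  by_cases h5 : e' = i
  · subst h5
    simp only [Data.contract, update_self]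
    split_ifs <;> omega
  · simp only [Data.contract, update_of_ne h5]
    omega

theorem le_of_ach (hk : N₀.Ach k₀) : d ≤ k₀ := by
  obtain ⟨k, -, h1⟩ := (h.reduces k₀).1 hk
  omega

theorem exists_ach (hk : N₀.Ach k₀) : ∃ k, D.net.Ach k := by
  obtain ⟨k, h1, -⟩ := (h.reduces k₀).1 hk
  exact ⟨k, h1⟩

theorem inc_le (v : ℕ) : D.inc v ≤ 2 * m * m := h.ne ▸ (h.degs.le v).2

theorem prune_ends {x : ℕ} (hx : D.deg x = 1) : D.inc x ∈ D.net.E ∧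
    (D.src (D.inc x) = x ∧ D.tgt (D.inc x) ≠ x ∨ D.src (D.inc x) ≠ x ∧ D.tgt (D.inc x) = x) ∧
    ∀ e' ∈ D.net.E, e' ≠ D.inc x → D.src e' ≠ x ∧ D.tgt e' ≠ x := by
  rw [h.degs.1] at hx
  obtain ⟨e, h1, h2, h3, h4⟩ := Net.exists_of_load_eq_one hx
  rw [h.degs.2, h2]
  exact ⟨h1, h3, h4⟩

/-- `2 ≤ g` means more edges than vertices, so `i` is not a loop; subtracting `i` from the stored
sum then gives the other edge at its target. -/
theorem contract_ends (hg : 2 ≤ g) (hk : N₀.Ach k₀) {i : ℕ} (hi : i ∈ D.net.E)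
    (h2 : D.deg (D.tgt i) = 2) : D.src i ≠ D.tgt i ∧ ∃ e ∈ D.net.E, e ≠ i ∧
      D.inc (D.tgt i) - i = e ∧
      (D.src e = D.tgt i ∧ D.tgt e ≠ D.tgt i ∨ D.src e ≠ D.tgt i ∧ D.tgt e = D.tgt i) ∧
      ∀ e' ∈ D.net.E, e' ≠ i → e' ≠ e → D.src e' ≠ D.tgt i ∧ D.tgt e' ≠ D.tgt i := by
  rw [h.degs.1] at h2
  obtain ⟨k, hk⟩ := h.exists_ach hk
  have hcard := h.card
  have hs : D.net.src i ≠ D.net.tgt i :=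
    Net.src_ne_of_load_eq_two h.core.wf hk (by omega) hi rfl h2
  obtain ⟨e, he, h3, h4, h5, h6⟩ := Net.exists_of_load_eq_two h2 hi rfl hs
  refine ⟨hs, e, he, h3, ?_, h5, h6⟩
  rw [h.degs.2, h4]
  omega

end Stage

/-- All edges after `i` are single, and the ends of the edges before `i` do not have
degree two. -/
structure Scan (D : Data) (i : ℕ) : Prop where
  single : ∀ e, i < e → D.kind e ≤ 1
  deg_ne_one : ∀ v, D.deg v ≠ 1
  deg_ne_two : ∀ e ∈ D.net.E, e < i → D.deg (D.src e) ≠ 2 ∧ D.deg (D.tgt e) ≠ 2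

namespace Scan

variable {D : Data} {i : ℕ} (h : D.Scan i)

include h

theorem flip (e : ℕ) : (D.flip e).Scan i where
  single := h.single
  deg_ne_one := h.deg_ne_one
  deg_ne_two e' he' hlt := by
    have h1 := h.deg_ne_two e' he' hlt
    by_cases h2 : e' = e
    · subst h2; simpa [Data.flip] using h1.symm
    · simpa [Data.flip, h2] using h1

theorem succ (hi : i ∈ D.net.E → D.deg (D.src i) ≠ 2 ∧ D.deg (D.tgt i) ≠ 2) : D.Scan (i + 1) where
  single e he := h.single e (by omega)
  deg_ne_one := h.deg_ne_one
  deg_ne_two e he hlt := by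
    obtain hlt | rfl := Nat.lt_succ_iff_lt_or_eq.1 hlt
    exacts [h.deg_ne_two e he hlt, hi he]

/-- Only the vertex that disappears changes its degree, and edges before `i` other than `e` do not
meet it; so the edges already scanned stay finished. -/
theorem contract {e : ℕ} (hc : D.Contractible i e) : (D.contract i e).Scan i where
  single e' he' := by
    have h1 := h.single e' he'
    by_cases h2 : e' = e <;> simp [Data.contract, h2, he'.ne', h1]
  deg_ne_one v := by
    have h1 := h.deg_ne_one v
    by_cases h2 : v = D.tgt i <;> simp [Data.contract, h2, h1]
  deg_ne_two e' he' hlt := by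
    rw [hc.E_eq, Finset.mem_erase] at he'
    have h1 := h.deg_ne_two e' he'.2 hlt
    have h2 := hc.only e' he'.2 hlt.ne he'.1
    simpa [Data.contract, hlt.ne, h2.1, h2.2] using h1

end Scan

end Data

/-! ### The loops that prune leaves and contract paths -/

namespace RAM

open Function Data

/-- Remove the vertex in register `8` if it is a leaf; go on to the next vertex otherwise. -/
def pruneBody : Stmt :=
  .ifEq (.load 16 (.var 8)) (.const 1)
    (.assign 9 (.load 17 (.var 8)) ;; .ifEq (.load 4 (.var 9)) (.var 8) (flipStmt 9) .skip ;;
      pruneStmt)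
    (.assign 3 (.add (.var 3) (.const 1)) ;; .assign 8 (.var 3))

/-- The invariant of the loop that removes the leaves. -/
structure PruneInv (N₀ : Net) (n m g K : ℕ) (s : State) : Prop where
  stage : (view s).Stage N₀ n m g K (s.reg 2)
  single : ∀ e, (view s).kind e ≤ 1
  deg_ne_one : ∀ y ≤ s.reg 3, y ≠ s.reg 8 → (view s).deg y ≠ 1
  lt_or_eq : s.reg 3 < s.reg 5 ∨ s.reg 8 = s.reg 3

/-- A bound for the vertices left to be treated. -/
def prunePotential (s : State) : ℕ := (view s).net.V.card + (s.reg 5 - s.reg 3)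

/-- Removing a leaf lowers the degree of its neighbour only, so this neighbour is the next candidate
in register `8`, wherever it lies relative to the scan in register `3`. Each round either removes a
vertex or advances the scan. -/
theorem wp_pruneBody {B k₀ n m g K : ℕ} {N₀ : Net} (hk : N₀.Ach k₀) (hB : k₀ + K + n + 1 ≤ B)
    {s : State} (hs : PruneInv N₀ n m g K s) (hlt : s.reg 3 < s.reg 5) :
    pruneBody.wp B (fun s' => PruneInv N₀ n m g K s' ∧ prunePotential s' < prunePotential s) s := by
  have hn : s.reg 5 = n := hs.stage.nv
  simp only [pruneBody, Stmt.wp, Expr.Safe, Expr.eval, true_and, State.reg_setReg,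
    State.arr_setReg, reduceIte, Nat.reduceEqDiff]
  refine ⟨by omega, fun h1 => ?_, fun h1 => ⟨by omega, ?_, ?_⟩⟩
  · change (view s).deg (s.reg 8) = 1 at h1
    obtain ⟨h2, h3, h4⟩ := hs.stage.prune_ends h1
    set x := s.reg 8 with hx
    set e := (view s).inc x with he
    -- The state `s'` is `s` itself or `s` with the edge reversed, so that the leaf is the target.
    have key : ∀ s' : State, (view s').Stage N₀ n m g K (s'.reg 2) →
        (∀ e, (view s').kind e ≤ 1) → e ∈ (view s').net.E → (view s').net.V = (view s).net.V →
        (view s').deg = (view s).deg → s'.reg 5 = s.reg 5 → s'.reg 3 = s.reg 3 → s'.reg 8 = x →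
        s'.reg 9 = e → (view s').src e ≠ x → (view s').tgt e = x →
        (∀ e' ∈ (view s').net.E, e' ≠ e → (view s').src e' ≠ x ∧ (view s').tgt e' ≠ x) →
        pruneStmt.wp B (fun s' => PruneInv N₀ n m g K s' ∧
          prunePotential s' < prunePotential s) s' := by
      intro s' i1 i2 i3 i4 i5 i6 i7 i8 i9 i10 i11 i12
      have hd := i1.le_of_ach hk
      have hk1 : (view s').kind e = 1 := by
        have := i2 e
        have := (mem_E.1 i3).2
        omega
      have hp := i1.prune i3 hk1 i11 i12
      have hmax := max_le (i1.base_le x) (i1.wt_le e)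
      refine wp_pruneStmt i8 i9 i10 (by omega)
        ((max_le (i1.base_le _) (i1.ws_le e)).trans (by omega)) (by omega)
        fun s'' v'' r2 r8 r3 => ?_
      have r5 : s''.reg 5 = s'.reg 5 := congrArg Data.nv v''
      refine ⟨⟨by rw [v'', r2]; exact hp, ?_, ?_, ?_⟩, ?_⟩
      · intro e'
        rw [v'']
        exact update_le i2 zero_le_one e'
      · rw [v'', r8, r3, i7]
        intro y hy hne
        by_cases hyx : y = x
        · simp [Data.prune, hyx, i10.symm]
        · simpa [Data.prune, hne, hyx, i5] using hs.deg_ne_one y hy hyx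
      · left; omega
      · have hxV : x ∈ (view s').net.V := i11 ▸ (i1.core.wf e i3).2
        have := Finset.card_erase_lt_of_mem hxV
        unfold prunePotential
        rw [v'', prune_V, ← i4]
        omega
    refine ⟨fun h5 => ?_, fun h5 => ?_⟩
    · have h6 : (view s).src e = x ∧ (view s).tgt e ≠ x := by
        rcases h3 with h3 | h3
        · exact h3
        · exact absurd h5 h3.1
      refine wp_flipStmt (by norm_num) fun s' v' r' => ?_
      have v' : view s' = (view s).flip e := v'
      refine key s' ?_ ?_ ?_ ?_ ?_ (r' 5 (by norm_num)) (r' 3 (by norm_num)) (r' 8 (by norm_num))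
        (r' 9 (by norm_num)) ?_ ?_ ?_
      · rw [v', r' 2 (by norm_num)]
        exact hs.stage.flip e
      · rw [v']; exact hs.single
      · rw [v']; exact h2
      · rw [v']; rfl
      · rw [v']; rfl
      · rw [v']; simpa [Data.flip] using h6.2
      · rw [v']; simpa [Data.flip] using h6.1
      · rw [v']
        intro e' he' hne
        have := h4 e' he' hne
        simpa [Data.flip, hne] using this
    · have h6 : (view s).src e ≠ x ∧ (view s).tgt e = x := by
        rcases h3 with h3 | h3
        · exact absurd h3.1 h5
        · exact h3
      exact key _ hs.stage hs.single h2 rfl rfl rfl rfl rfl rfl h6.1 h6.2 h4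
  · refine ⟨hs.stage, hs.single, fun y hy hne => ?_, Or.inr rfl⟩
    simp only [State.reg_setReg, reduceIte, Nat.reduceEqDiff] at hy hne
    by_cases hyx : y = s.reg 8
    · exact hyx ▸ h1
    · exact hs.deg_ne_one y (by omega) hyx
  · change (view s).net.V.card + (s.reg 5 - (s.reg 3 + 1)) < _
    unfold prunePotential
    omega

/-- Contract the target of the edge in register `3` if its degree is two; go on to the next edge
otherwise. -/
def contractStep : Stmt :=
  .ifEq (.load 16 (.load 5 (.var 3))) (.const 2)
    (.assign 8 (.load 5 (.var 3)) ;; .assign 9 (.sub (.load 17 (.var 8)) (.var 3)) ;;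
      .ifEq (.load 4 (.var 9)) (.var 8) .skip (flipStmt 9) ;; contractStmt)
    (.assign 3 (.add (.var 3) (.const 1)))

/-- Contract a vertex of degree two at an end of the edge in register `3`, or go on to the next
edge if there is none. -/
def contractBody : Stmt :=
  .ifEq (.load 3 (.var 3)) (.const 0) (.assign 3 (.add (.var 3) (.const 1)))
    (.ifEq (.load 16 (.load 5 (.var 3))) (.const 2) .skip (flipStmt 3) ;; contractStep)

/-- The invariant of the loop that contracts the paths. -/
structure ContractInv (N₀ : Net) (n m g K : ℕ) (s : State) : Prop where
  stage : (view s).Stage N₀ n m g K (s.reg 2)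
  scan : (view s).Scan (s.reg 3)

/-- A bound for the edges left to be treated. -/
def contractPotential (s : State) : ℕ := (view s).net.E.card + (s.reg 4 - s.reg 3)

/-- A path edge is grown from edge `i` until neither end has degree two; only then does the scan
move on. Each round removes an edge or advances the scan. -/
theorem wp_contractBody {B k₀ n m g K : ℕ} {N₀ : Net} (hg : 2 ≤ g) (hk : N₀.Ach k₀)
    (hB : k₀ + K * (2 * n + 1) + 2 * m * m + m + 2 ≤ B)
    {s : State} (hs : ContractInv N₀ n m g K s) (hlt : s.reg 3 < s.reg 4) :
    contractBody.wp B
      (fun s' => ContractInv N₀ n m g K s' ∧ contractPotential s' < contractPotential s) s := by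
  have hm : s.reg 4 = m := hs.stage.ne
  have hnext : ∀ s' : State, s'.reg 3 = s.reg 3 → s'.reg 4 = s.reg 4 →
      (view s').Stage N₀ n m g K (s'.reg 2) →
      (view s').net.E.card = (view s).net.E.card → (view s').Scan (s.reg 3 + 1) →
      ContractInv N₀ n m g K (s'.setReg 3 (s'.reg 3 + 1)) ∧
        contractPotential (s'.setReg 3 (s'.reg 3 + 1)) < contractPotential s := by
    intro s' h3 h4 h h' hsc
    refine ⟨⟨h, h3 ▸ hsc⟩, ?_⟩
    change (view s').net.E.card + (s'.reg 4 - (s'.reg 3 + 1)) < _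
    unfold contractPotential
    omega
  simp only [contractBody, Stmt.wp, Expr.Safe, Expr.eval, true_and]
  refine ⟨by omega, fun h0 => ⟨⟨by omega, by omega⟩, hnext s rfl rfl hs.stage rfl
    (hs.scan.succ fun h => absurd h0 (mem_E.1 h).2)⟩, fun h0 => ⟨by omega, ?_⟩⟩
  have hi : s.reg 3 ∈ (view s).net.E := mem_E.2 ⟨hlt, h0⟩
  -- The edge has already been turned so that an end of degree two, if there is one, is its target;
  -- the last hypothesis records this.
  have key : ∀ s' : State, s'.reg 3 = s.reg 3 → s'.reg 4 = s.reg 4 →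
      (view s').Stage N₀ n m g K (s'.reg 2) → (view s').net.E = (view s).net.E →
      (view s').Scan (s.reg 3) →
      ((view s').deg ((view s').tgt (s.reg 3)) ≠ 2 →
        (view s').deg ((view s').src (s.reg 3)) ≠ 2) →
      contractStep.wp B
        (fun s' => ContractInv N₀ n m g K s' ∧ contractPotential s' < contractPotential s) s' := by
    intro s' h3 h4 hst hE hsc hdeg
    simp only [contractStep, Stmt.wp, Expr.Safe, Expr.eval, true_and, State.reg_setReg,
      State.arr_setReg, reduceIte, Nat.reduceEqDiff]
    refine ⟨by omega, fun h2 => ?_, fun h2 => ⟨⟨by omega, by omega⟩,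
      hnext s' h3 h4 hst (by rw [hE]) (hsc.succ fun _ => ?_)⟩⟩
    swap
    · rw [h3] at h2
      exact ⟨hdeg h2, h2⟩
    rw [h3] at h2 ⊢
    change (view s').deg ((view s').tgt (s.reg 3)) = 2 at h2
    set i := s.reg 3 with hi'
    rw [← hE] at hi
    obtain ⟨h5, e, h6, h7, h8, h9, h10⟩ := hst.contract_ends hg hk hi h2
    change (view s').inc ((view s').tgt i) - i = e at h8
    -- The other edge meets a vertex of degree two, so it cannot lie before `i`; and all edges after
    -- `i` are still single.
    have hek : (view s').kind e = 1 := by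
      have := (mem_E.1 h6).2
      rcases lt_or_gt_of_ne h7 with h11 | h11
      · have := hsc.deg_ne_two e h6 h11
        rcases h9 with h9 | h9
        · rw [h9.1] at this; exact absurd h2 this.1
        · rw [h9.2] at this; exact absurd h2 this.2
      · have := hsc.single e h11
        omega
    have main : ∀ s'' : State, (view s'').Stage N₀ n m g K (s''.reg 2) → (view s'').Scan i →
        (view s'').net.E = (view s').net.E → s''.reg 4 = s.reg 4 → s''.reg 3 = i →
        s''.reg 8 = (view s'').tgt i →
        s''.reg 9 = e → (view s'').Contractible i e →
        contractStmt.wp B (fun s' => ContractInv N₀ n m g K s' ∧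
          contractPotential s' < contractPotential s) s'' := by
      intro s'' i1 i2 i3 i4 i5 i6 i7 hc
      have hd := i1.le_of_ach hk
      have hn1 := i1.need_le i
      have hn2 := i1.need'_le e
      have hga := i1.gains_le i
      have hin := i1.inc_le ((view s'').tgt e)
      have hKn : K * (2 * n + 1) = K * n + K * n + K := by ring
      rw [hKn] at hB
      generalize K * n = Kn at hB hga
      refine wp_contractStmt i5 i7 i6 hc (by omega) (by omega) (by omega) (by omega) (by omega)
        (by omega) (by omega) (by omega) fun t vt rt2 rt3 => ?_
      refine ⟨⟨by rw [vt, rt2]; exact i1.contract hc,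
        by rw [vt, rt3, i5]; exact i2.contract hc⟩, ?_⟩
      have rt4 : t.reg 4 = s''.reg 4 := congrArg Data.ne vt
      have := Finset.card_erase_lt_of_mem hc.mem_e
      unfold contractPotential
      rw [vt, hc.E_eq, ← hE, ← i3]
      omega
    change ((view s').src ((view s').inc ((view s').tgt i) - i) = (view s').tgt i → _) ∧
      ((view s').src ((view s').inc ((view s').tgt i) - i) ≠ (view s').tgt i → _)
    rw [h8]
    refine ⟨fun h11 => ?_, fun h11 => ?_⟩
    · have h12 := h9.resolve_right fun h => h.1 h11
      exact main _ hst hsc rfl h4 h3 rfl h8 ⟨hst.core, hi, h6, h7.symm, hek, h12.1, h5, h12.2, h10⟩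
    · have h12 := h9.resolve_left fun h => h11 h.1
      refine wp_flipStmt (by norm_num) fun s'' v'' r'' => ?_
      have v'' : view s'' = (view s').flip e := by rw [← h8]; exact v''
      have ht : (view s'').tgt i = (view s').tgt i := by rw [v'']; simp [Data.flip, h7.symm]
      refine main s'' ?_ ?_ ?_ ((r'' 4 (by norm_num)).trans h4) ((r'' 3 (by norm_num)).trans h3)
        ?_ ((r'' 9 (by norm_num)).trans h8) ?_
      · rw [v'', r'' 2 (by norm_num)]
        exact hst.flip e
      · rw [v'']; exact hsc.flip e
      · rw [v'']; rfl
      · rw [ht]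
        exact r'' 8 (by norm_num)
      · refine ⟨v'' ▸ hst.core.flip, v'' ▸ hi, v'' ▸ h6, h7.symm, by rw [v'']; exact hek, ?_,
            ?_, ?_,
          ?_⟩ <;> rw [ht, v'']
        · simpa [Data.flip] using h12.2
        · simpa [Data.flip, h7.symm] using h5
        · simpa [Data.flip] using h12.1
        · intro e' he' hn1 hn2
          simpa [Data.flip, hn2] using h10 e' he' hn1 hn2
  refine ⟨fun h2 => key s rfl rfl hs.stage rfl hs.scan fun h => absurd h2 h, fun h2 =>
    wp_flipStmt (by norm_num) fun s' v' r' => key s' (r' 3 (by norm_num)) (r' 4 (by norm_num))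
      ?_ ?_ ?_ fun _ => ?_⟩
  · rw [v', r' 2 (by norm_num)]
    exact hs.stage.flip _
  · rw [v']; rfl
  · rw [v']; exact hs.scan.flip _
  · rw [v', show ((view s).flip (s.reg 3)).src (s.reg 3) = (view s).tgt (s.reg 3) by
      simp [Data.flip]]
    exact h2

end RAM


/-! ## Expanding the path edges -/

namespace Data

open Function

/-- The edges that stand for paths. -/
def longEdges (D : Data) : Finset ℕ := D.net.E.filter fun e => D.kind e = 2

variable {D : Data} {i : ℕ}

theorem mem_longEdges {e : ℕ} : e ∈ D.longEdges ↔ e < D.ne ∧ D.kind e = 2 := by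
  rw [longEdges, Finset.mem_filter, mem_E]
  exact ⟨fun h => ⟨h.1.1, h.2⟩, fun h => ⟨⟨h.1, by omega⟩, h.2⟩⟩

theorem card_V_peel_le (α β : ℕ) : (D.peel i α β).net.V.card ≤ D.net.V.card + 1 := by
  refine (Finset.card_le_card (t := insert D.nv D.net.V) fun v hv => ?_).trans
    (Finset.card_insert_le _ _)
  rw [mem_V] at hv
  rw [Finset.mem_insert, mem_V]
  have h1 : v < D.nv + 1 := hv.1
  have h2 : D.dead v = 0 := hv.2
  omega

theorem card_E_peel_le (α β : ℕ) : (D.peel i α β).net.E.card ≤ D.net.E.card + 1 := by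
  refine (Finset.card_le_card (t := insert D.ne D.net.E) fun v hv => ?_).trans
    (Finset.card_insert_le _ _)
  rwa [Finset.mem_insert, ← mem_E_peel]

theorem longEdges_peel_subset (α β : ℕ) : (D.peel i α β).longEdges ⊆ D.longEdges := by
  intro e he
  rw [mem_longEdges] at he ⊢
  have h1 : e < D.ne + 1 := he.1
  have h2 : update D.kind D.ne 1 e = 2 := he.2
  have h3 : e ≠ D.ne := by rintro rfl; simp at h2
  rw [update_of_ne h3] at h2
  exact ⟨by omega, h2⟩

/-- Whatever is bounded in terms of the number of subdivisions can be tracked through the six of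
them; the final change of kind is left to the caller. -/
theorem expand_rec (P : ℕ → Data → Prop) (h0 : P 0 D)
    (hs : ∀ k D' α β, P k D' → P (k + 1) (D'.peel i α β)) :
    ∃ D', D.expand i = D'.toSingle i ∧ P 6 D' :=
  ⟨_, rfl, hs _ _ _ _ (hs _ _ _ _ (hs _ _ _ _ (hs _ _ _ _ (hs _ _ _ _ (hs _ _ _ _ h0)))))⟩

theorem card_V_expand_le : (D.expand i).net.V.card ≤ D.net.V.card + 6 := by
  obtain ⟨D', h1, h2⟩ := expand_rec (D := D) (i := i)
    (fun k D' => D'.net.V.card ≤ D.net.V.card + k) le_rfl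
    fun k D' α β h => (card_V_peel_le α β).trans (by omega)
  rw [h1]
  exact h2

theorem card_E_expand_le (hi : i ∈ D.net.E) : (D.expand i).net.E.card ≤ D.net.E.card + 6 := by
  obtain ⟨D', h1, h2, h3⟩ := expand_rec (D := D) (i := i)
    (fun k D' => D'.net.E.card ≤ D.net.E.card + k ∧ i ∈ D'.net.E) ⟨le_rfl, hi⟩
    fun k D' α β h => ⟨(card_E_peel_le α β).trans (by omega), mem_E_peel.2 (Or.inr h.2)⟩
  rw [h1]
  refine (Finset.card_le_card fun e he => ?_).trans h2
  by_cases h4 : e = i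
  · exact h4 ▸ h3
  · rw [mem_E] at he ⊢
    simpa [toSingle, h4] using he

theorem longEdges_expand_subset : (D.expand i).longEdges ⊆ D.longEdges.erase i := by
  obtain ⟨D', h1, h2⟩ := expand_rec (D := D) (i := i)
    (fun k D' => D'.longEdges ⊆ D.longEdges) subset_rfl
    fun k D' α β h => (longEdges_peel_subset α β).trans h
  rw [h1]
  intro e he
  rw [mem_longEdges] at he
  have h3 : e ≠ i := by rintro rfl; simp [toSingle] at he
  refine Finset.mem_erase.2 ⟨h3, h2 (mem_longEdges.2 ?_)⟩
  simpa [toSingle, h3] using he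

end Data

namespace RAM

open Function Data

/-- Expand the edge in register `3` if it stands for a path, and go on to the next edge. -/
def expandBody : Stmt :=
  .ifEq (.load 3 (.var 3)) (.const 2) expandStmt .skip ;; .assign 3 (.add (.var 3) (.const 1))

/-- The invariant of the loop that expands the path edges. -/
structure ExpandInv (N₀ : Net) (n m a b d : ℕ) (s : State) : Prop where
  core : (view s).Core
  reduces : N₀.Reduces (view s).net d
  reg_two : s.reg 2 = d
  reg_sixteen : s.reg 16 = m
  card_V : (view s).net.V.card + 6 * (view s).longEdges.card ≤ a
  card_E : (view s).net.E.card + 6 * (view s).longEdges.card ≤ b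
  long : ∀ e ∈ (view s).longEdges, s.reg 3 ≤ e ∧ e < m
  nv_le : s.reg 5 ≤ n + 6 * s.reg 3
  ne_le : s.reg 4 ≤ m + 6 * s.reg 3
  le : s.reg 3 ≤ m
  le_ne : m ≤ s.reg 4
  nonempty : ∃ v < s.reg 5, s.arr 14 v = 0

/-- New edges are single and are appended after the first `m`, so the scan stops at the old count in
register `16`. The six vertices and six edges of an expansion are paid for by the disappearance of
one path edge. -/
theorem wp_expandBody {B n m a b d : ℕ} {N₀ : Net} (hB : n + 7 * m + 6 ≤ B) {s : State}
    (hs : ExpandInv N₀ n m a b d s) (hlt : s.reg 3 < s.reg 16) :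
    expandBody.wp B
      (fun s' => ExpandInv N₀ n m a b d s' ∧ m - s'.reg 3 < m - s.reg 3) s := by
  obtain ⟨h1, h2, h3, h4, h5, h6, h7, h8, h9, h10, h11, v, h12, h13⟩ := hs
  simp only [expandBody, Stmt.wp, Expr.Safe, Expr.eval, true_and]
  refine ⟨by omega, fun h0 => ?_, fun h0 => ⟨⟨by omega, by omega⟩, ⟨h1, h2, h3, h4, h5, h6,
    fun e he => ?_, h8.trans ?_, h9.trans ?_, ?_, h11, v, h12, h13⟩, ?_⟩⟩
  · have hL : s.reg 3 ∈ (view s).longEdges :=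
      mem_longEdges.2 ⟨(by omega : s.reg 3 < s.reg 4), h0⟩
    have hi : s.reg 3 ∈ (view s).net.E := (Finset.mem_filter.1 hL).1
    refine wp_expandStmt (by omega) (by omega) fun s' v' r' => ?_
    have r2 := r' 2 (by norm_num) (by norm_num) (by norm_num)
    have r3 := r' 3 (by norm_num) (by norm_num) (by norm_num)
    have r16 := r' 16 (by norm_num) (by norm_num) (by norm_num)
    have r4 : s'.reg 4 = s.reg 4 + 6 := congrArg Data.ne v'
    have r5 : s'.reg 5 = s.reg 5 + 6 := congrArg Data.nv v'
    obtain ⟨c1, c2⟩ := h1.expand hi h0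
    have c3 := card_V_expand_le (D := view s) (i := s.reg 3)
    have c4 := card_E_expand_le hi
    have c5 := Finset.card_le_card (longEdges_expand_subset (D := view s) (i := s.reg 3))
    have c6 := Finset.card_erase_add_one hL
    rw [← v'] at c1 c2 c3 c4 c5
    refine ⟨⟨by omega, by omega⟩, ⟨c1, ?_, r2.trans h3, r16.trans h4, ?_, ?_, fun e he => ?_,
        ?_, ?_,
      ?_, ?_, v, ?_, ?_⟩, ?_⟩
    · have := h2.trans c2.symm_zero
      exact this
    · change (view s').net.V.card + 6 * (view s').longEdges.card ≤ a
      omega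
    · change (view s').net.E.card + 6 * (view s').longEdges.card ≤ b
      omega
    · change e ∈ (view s').longEdges at he
      rw [v'] at he
      have := Finset.mem_erase.1 (longEdges_expand_subset he)
      have := h7 e this.2
      simp only [State.reg_setReg, reduceIte]
      omega
    case refine_10 => exact (congrFun (congrArg Data.dead v') v).trans h13
    all_goals
      simp only [State.reg_setReg, reduceIte, Nat.reduceEqDiff]
      omega
  · have := h7 e he
    have h12 : e ≠ s.reg 3 := by
      rintro rfl
      exact h0 (mem_longEdges.1 he).2
    simp only [State.reg_setReg, reduceIte]
    omega
  all_goals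
    simp only [State.reg_setReg, reduceIte]
    omega

end RAM


/-! ## Writing the output -/

namespace Data

open Function

/-- The part of the data structure with the vertices below `i`. -/
def below (D : Data) (i : ℕ) : Data := { D with nv := i }

variable {D : Data} {idx : ℕ → ℕ} {i c : ℕ}

theorem mem_below {v : ℕ} : v ∈ (D.below i).net.V ↔ v < i ∧ D.dead v = 0 := mem_V

theorem below_succ_of_dead (h : D.dead i ≠ 0) : (D.below (i + 1)).net.V = (D.below i).net.V := by
  ext v
  rw [mem_below, mem_below]
  constructor
  · rintro ⟨h1, h2⟩
    exact ⟨by rcases Nat.lt_succ_iff_lt_or_eq.1 h1 with h3 | rfl; exacts [h3, absurd h2 h], h2⟩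
  · exact fun h => ⟨by omega, h.2⟩

theorem below_succ (h : D.dead i = 0) : (D.below (i + 1)).net.V = insert i (D.below i).net.V := by
  ext v
  rw [Finset.mem_insert, mem_below, mem_below]
  constructor
  · rintro ⟨h1, h2⟩
    omega
  · rintro (rfl | h1)
    exacts [⟨by omega, h⟩, ⟨by omega, h1.2⟩]

theorem notMem_below : i ∉ (D.below i).net.V := fun h => absurd (mem_below.1 h).1 (lt_irrefl _)

theorem Numbering.congr {D' : Data} (h : D.Numbering idx c) (hV : D'.net.V = D.net.V) :
    D'.Numbering idx c :=
  ⟨hV ▸ h.lt, hV ▸ h.inj, hV ▸ h.surj⟩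

theorem Numbering.succ (h : (D.below i).Numbering idx c) (hi : D.dead i = 0) :
    (D.below (i + 1)).Numbering (update idx i c) (c + 1) := by
  have key : ∀ v ∈ (D.below i).net.V, update idx i c v = idx v := fun v hv =>
    update_of_ne (fun hvi => notMem_below (hvi ▸ hv)) ..
  constructor
  · intro v hv
    rw [below_succ hi, Finset.mem_insert] at hv
    rcases hv with rfl | hv
    · simp
    · rw [key v hv]
      exact (h.lt v hv).trans (by omega)
  · intro v hv v' hv'
    rw [below_succ hi, Finset.mem_insert] at hv hv'
    rcases hv with rfl | hv <;> rcases hv' with rfl | hv'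
    · simp
    · rw [key v' hv', update_self]
      intro h1
      have := h.lt v' hv'
      omega
    · rw [key v hv, update_self]
      intro h1
      have := h.lt v hv
      omega
    · rw [key v hv, key v' hv']
      exact h.inj v hv v' hv'
  · intro j hj
    rw [below_succ hi]
    rcases Nat.lt_succ_iff_lt_or_eq.1 hj with hj | rfl
    · obtain ⟨v, hv, h1⟩ := h.surj j hj
      exact ⟨v, Finset.mem_insert_of_mem hv, by rw [key v hv, h1]⟩
    · exact ⟨i, Finset.mem_insert_self .., update_self ..⟩

theorem arcList_succ (hi : D.kind i ≠ 0) :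
    D.arcList idx (i + 1) = D.arcList idx i ++ D.arcPair idx i := by
  simp [arcList, List.range_succ, List.filter_append, hi]

theorem arcList_succ_of_eq_zero (hi : D.kind i = 0) : D.arcList idx (i + 1) = D.arcList idx i := by
  simp [arcList, List.range_succ, List.filter_append, hi]

theorem length_arcList_le : (D.arcList idx i).length ≤ 2 * i := by
  induction i with
  | zero => simp [arcList]
  | succ i ih =>
    by_cases hi : D.kind i = 0
    · rw [arcList_succ_of_eq_zero hi]
      omega
    · rw [arcList_succ hi, List.length_append]
      simp only [arcPair, List.length_cons, List.length_nil]
      omega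

end Data

namespace RAM

open Function Data

/-- Number the vertex in register `3` if it is present, add its minimum power to register `2`, and
go on to the next vertex. -/
def numberBody : Stmt :=
  .ifEq (.load 14 (.var 3)) (.const 0)
    (.store 20 (.var 3) (.var 7) ;; .assign 2 (.add (.var 2) (.load 15 (.var 3))) ;;
      .assign 7 (.add (.var 7) (.const 1)))
    .skip ;;
  .assign 3 (.add (.var 3) (.const 1))

/-- The invariant of the loop that numbers the vertices. -/
structure NumberInv (D : Data) (d : ℕ) (s : State) : Prop where
  view_eq : view s = D
  numbering : (D.below (s.reg 3)).Numbering (s.arr 20) (s.reg 7)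
  card : s.reg 7 = (D.below (s.reg 3)).net.V.card
  reg_two : s.reg 2 = d + ∑ v ∈ (D.below (s.reg 3)).net.V, D.base v
  le : s.reg 3 ≤ D.nv

theorem wp_numberBody {B d : ℕ} {D : Data} (hB : D.nv + 1 ≤ B)
    (hB' : d + ∑ v ∈ D.net.V, D.base v ≤ B) {s : State} (hs : NumberInv D d s)
    (hlt : s.reg 3 < s.reg 5) :
    numberBody.wp B (fun s' => NumberInv D d s' ∧ D.nv - s'.reg 3 < D.nv - s.reg 3) s := by
  obtain ⟨h1, h2, h3, h4, h5⟩ := hs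
  have hnv : s.reg 5 = D.nv := congrArg Data.nv h1
  have hdead : s.arr 14 = D.dead := congrArg Data.dead h1
  have hbase : s.arr 15 = D.base := congrArg Data.base h1
  have hcard : (D.below (s.reg 3)).net.V.card ≤ s.reg 3 := by
    refine (Finset.card_le_card fun v hv => ?_).trans (Finset.card_range (s.reg 3)).le
    exact Finset.mem_range.2 (mem_below.1 hv).1
  simp only [numberBody, Stmt.wp, Expr.Safe, Expr.eval, true_and, State.reg_setReg,
    State.reg_setArr, State.arr_setArr, reduceIte, Nat.reduceEqDiff,
    hdead, hbase]
  refine ⟨by omega, fun h0 => ?_, fun h0 => ⟨⟨by omega, by omega⟩, ?_, by omega⟩⟩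
  · have hsum : ∑ v ∈ (D.below (s.reg 3 + 1)).net.V, D.base v =
        D.base (s.reg 3) + ∑ v ∈ (D.below (s.reg 3)).net.V, D.base v := by
      rw [below_succ h0, Finset.sum_insert notMem_below]
    have hle : ∑ v ∈ (D.below (s.reg 3 + 1)).net.V, D.base v ≤ ∑ v ∈ D.net.V, D.base v := by
      refine Finset.sum_le_sum_of_subset fun v hv => ?_
      rw [mem_below] at hv
      exact mem_V.2 ⟨by omega, hv.2⟩
    refine ⟨by omega, ⟨by omega, by omega⟩, ⟨by omega, by omega⟩, ?_, by omega⟩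
    refine ⟨?_, ?_, ?_, ?_, ?_⟩
    · rw [← h1]
      simp [view, State.reg_setReg, State.reg_setArr, State.arr_setReg, State.arr_setArr]
    · simpa [State.reg_setReg, State.reg_setArr, State.arr_setReg, State.arr_setArr]
          using h2.succ h0
    · simp only [State.reg_setReg, State.reg_setArr, reduceIte, Nat.reduceEqDiff]
      rw [below_succ h0, Finset.card_insert_of_notMem notMem_below, h3]
    · simp only [State.reg_setReg, State.reg_setArr, reduceIte, Nat.reduceEqDiff]
      omega
    · simp only [State.reg_setReg, State.reg_setArr, reduceIte, Nat.reduceEqDiff]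
      omega
  · refine ⟨h1, ?_, ?_, ?_, ?_⟩ <;>
      simp only [State.reg_setReg, State.arr_setReg, reduceIte, Nat.reduceEqDiff]
    · exact h2.congr (below_succ_of_dead h0)
    · rw [below_succ_of_dead h0, h3]
    · rw [below_succ_of_dead h0, h4]
    · omega

/-- Append an arc to the output. -/
def writeArc (x y z : Expr) : Stmt :=
  .store 0 (.var 1) x ;; .store 1 (.var 1) y ;; .store 2 (.var 1) z ;;
  .assign 1 (.add (.var 1) (.const 1))

/-- Write the arcs of the edge in register `3`, and go on to the next edge. -/
def writeBody : Stmt :=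
  .ifEq (.load 3 (.var 3)) (.const 0) .skip
    (.assign 8 (.load 4 (.var 3)) ;; .assign 9 (.load 5 (.var 3)) ;;
      writeArc (.load 20 (.var 8)) (.load 20 (.var 9))
        (.sub (.load 6 (.var 3)) (.load 15 (.var 8))) ;;
      writeArc (.load 20 (.var 9)) (.load 20 (.var 8))
        (.sub (.load 7 (.var 3)) (.load 15 (.var 9)))) ;;
  .assign 3 (.add (.var 3) (.const 1))

/-- The arrays `0`, `1`, `2` and register `1` hold the list. -/
def State.Lists (s : State) (l : List (ℕ × ℕ × ℕ)) : Prop :=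
  s.reg 1 = l.length ∧
    ∀ i (h : i < l.length), s.arr 0 i = l[i].1 ∧ s.arr 1 i = l[i].2.1 ∧ s.arr 2 i = l[i].2.2

/-- The invariant of the loop that writes the output. -/
structure WriteInv (D : Data) (idx : ℕ → ℕ) (c d : ℕ) (s : State) : Prop where
  view_eq : view s = D
  arr_twenty : s.arr 20 = idx
  reg_zero : s.reg 0 = c
  reg_two : s.reg 2 = d
  lists : s.Lists (D.arcList idx (s.reg 3))
  le : s.reg 3 ≤ D.ne

/-- The three expressions are evaluated between the stores, so `hx` asks for their values in every
state that differs from `s` in the output arrays only. -/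
theorem wp_writeArc {B : ℕ} {Q : State → Prop} {s : State} {x y z : Expr}
    {l : List (ℕ × ℕ × ℕ)} {a : ℕ × ℕ × ℕ} (hs : s.Lists l) (hB : l.length + 1 ≤ B)
    (hx : ∀ s', s'.reg = s.reg → (∀ a, 3 ≤ a → s'.arr a = s.arr a) →
      x.Safe B s' ∧ y.Safe B s' ∧ z.Safe B s' ∧ (x.eval s', y.eval s', z.eval s') = a)
    (h : ∀ s', s'.Lists (l ++ [a]) → (∀ x, x ≠ 1 → s'.reg x = s.reg x) →
      (∀ a, 3 ≤ a → s'.arr a = s.arr a) → Q s') : (writeArc x y z).wp B Q s := by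
  obtain ⟨h1, h2⟩ := hs
  set i := s.reg 1 with hi
  obtain ⟨x0, y0, z0, e0⟩ := hx s rfl fun _ _ => rfl
  set s₁ := s.setArr 0 i (x.eval s) with hs₁
  obtain ⟨x1, y1, z1, e1⟩ := hx s₁ rfl fun a ha => by
    rw [hs₁, State.arr_setArr, if_neg (by omega)]
  set s₂ := s₁.setArr 1 i (y.eval s₁) with hs₂
  obtain ⟨x2, y2, z2, e2⟩ := hx s₂ rfl fun a ha => by
    rw [hs₂, State.arr_setArr, if_neg (by omega), hs₁, State.arr_setArr, if_neg (by omega)]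
  have E0 : x.eval s = a.1 := congrArg Prod.fst e0
  have E1 : y.eval s₁ = a.2.1 := congrArg (fun a => a.2.1) e1
  have E2 : z.eval s₂ = a.2.2 := congrArg (fun a => a.2.2) e2
  have hs₁' : s₁ = s.setArr 0 i a.1 := by rw [hs₁, E0]
  have hs₂' : s₂ = s₁.setArr 1 i a.2.1 := by rw [hs₂, E1]
  refine ⟨trivial, x0, trivial, y1, trivial, z2, ⟨trivial, (by omega : 1 ≤ B), ?_⟩, ?_⟩
  · change i + 1 ≤ B
    omega
  change Q ((s₂.setArr 2 i (z.eval s₂)).setReg 1 (i + 1))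
  refine h _ ⟨?_, ?_⟩ ?_ ?_
  · rw [List.length_append, ← h1]
    simp [State.reg_setReg]
  · intro j hj
    rw [E2, State.arr_setReg]
    simp only [State.arr_setArr, hs₂', hs₁', reduceIte, Nat.reduceEqDiff]
    by_cases hji : j = i
    · subst hji
      simp [h1]
    · have hjl : j < l.length := by
        rw [List.length_append, List.length_singleton] at hj
        omega
      simpa [hji, List.getElem_append_left hjl] using h2 j hjl
  · intro x hx
    simp [State.reg_setReg, hx, hs₂, hs₁, State.reg_setArr]
  · intro a ha
    simp only [State.arr_setReg, State.arr_setArr, hs₂, hs₁]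
    rw [if_neg (by omega), if_neg (by omega), if_neg (by omega)]

theorem wp_writeBody {B c d : ℕ} {D : Data} {idx : ℕ → ℕ} (hB : 2 * D.ne + 2 ≤ B) {s : State}
    (hs : WriteInv D idx c d s) (hlt : s.reg 3 < s.reg 4) :
    writeBody.wp B (fun s' => WriteInv D idx c d s' ∧ D.ne - s'.reg 3 < D.ne - s.reg 3) s := by
  obtain ⟨h1, h2, h3, h4, h5, h6⟩ := hs
  have hne : s.reg 4 = D.ne := congrArg Data.ne h1
  have hkind : s.arr 3 = D.kind := congrArg Data.kind h1
  have hsrc : s.arr 4 = D.src := congrArg Data.src h1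
  have htgt : s.arr 5 = D.tgt := congrArg Data.tgt h1
  have hws : s.arr 6 = D.ws := congrArg Data.ws h1
  have hwt : s.arr 7 = D.wt := congrArg Data.wt h1
  have hbase : s.arr 15 = D.base := congrArg Data.base h1
  have hlen := length_arcList_le (D := D) (idx := idx) (i := s.reg 3)
  simp only [writeBody, Stmt.wp, Expr.Safe, Expr.eval, true_and, State.reg_setReg,
    State.arr_setReg, reduceIte, Nat.reduceEqDiff, hkind, hsrc, htgt]
  refine ⟨by omega, fun h0 => ⟨⟨by omega, by omega⟩, ⟨h1, h2, h3, h4, ?_, ?_⟩, by omega⟩,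
    fun h0 => ?_⟩
  · rw [State.reg_setReg, if_pos rfl, arcList_succ_of_eq_zero h0]
    exact h5
  · rw [State.reg_setReg, if_pos rfl]
    omega
  refine wp_writeArc (l := D.arcList idx (s.reg 3)) h5 (by omega)
    (a := (idx (D.src (s.reg 3)), idx (D.tgt (s.reg 3)),
      D.ws (s.reg 3) - D.base (D.src (s.reg 3)))) (fun s' hr ha => ?_) fun s' hl hr ha => ?_
  · simp only [Expr.Safe, Expr.eval, hr, ha 20 (by norm_num), ha 6 (by norm_num),
      ha 15 (by norm_num), State.reg_setReg, State.arr_setReg, reduceIte, Nat.reduceEqDiff, h2,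
      hws, hbase, and_self]
  refine wp_writeArc hl (by simp only [List.length_append, List.length_singleton]; omega)
    (a := (idx (D.tgt (s.reg 3)), idx (D.src (s.reg 3)),
      D.wt (s.reg 3) - D.base (D.tgt (s.reg 3)))) (fun s'' hr' ha' => ?_) fun s'' hl' hr' ha' => ?_
  · simp only [Expr.Safe, Expr.eval, hr', hr 8 (by norm_num), hr 9 (by norm_num),
      hr 3 (by norm_num), ha' 20 (by norm_num), ha' 7 (by norm_num),
      ha' 15 (by norm_num), ha 20 (by norm_num), ha 7 (by norm_num),
      ha 15 (by norm_num), State.reg_setReg, State.arr_setReg, reduceIte, Nat.reduceEqDiff, h2,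
      hwt, hbase, and_self]
  have hr'' : ∀ x, x ≠ 1 → x ≠ 8 → x ≠ 9 → s''.reg x = s.reg x := fun x i1 i2 i3 => by
    rw [hr' x i1, hr x i1, State.reg_setReg, if_neg i3, State.reg_setReg, if_neg i2]
  have ha'' : ∀ a, 3 ≤ a → s''.arr a = s.arr a := fun a i1 => by
    rw [ha' a i1, ha a i1]; rfl
  have r3 : s''.reg 3 = s.reg 3 := hr'' 3 (by norm_num) (by norm_num) (by norm_num)
  rw [r3]
  refine ⟨⟨by omega, by omega⟩, ⟨?_, ?_, ?_, ?_, ?_, ?_⟩, by omega⟩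
  · rw [← h1]
    simp only [view, State.reg_setReg, State.arr_setReg, reduceIte, Nat.reduceEqDiff]
    congr 1
    any_goals exact hr'' _ (by norm_num) (by norm_num) (by norm_num)
    all_goals exact ha'' _ (by norm_num)
  · exact (ha'' 20 (by norm_num)).trans h2
  · exact (hr'' 0 (by norm_num) (by norm_num) (by norm_num)).trans h3
  · exact (hr'' 2 (by norm_num) (by norm_num) (by norm_num)).trans h4
  · rw [State.reg_setReg, if_pos rfl, arcList_succ h0]
    rw [List.append_assoc] at hl'
    exact hl'
  · rw [State.reg_setReg, if_pos rfl]
    omega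

end RAM


/-! ## Reading the input -/

namespace Data

open Function

/-- Add a single edge from `u` to `v`. -/
def addEdge (D : Data) (u v w W : ℕ) : Data :=
  { D with
    ne := D.ne + 1
    kind := update D.kind D.ne 1
    src := update D.src D.ne u
    tgt := update D.tgt D.ne v
    ws := update D.ws D.ne w
    wt := update D.wt D.ne W
    deg := update (update D.deg u (D.deg u + 1)) v (D.deg v + 1)
    inc := update (update D.inc u (D.inc u + D.ne)) v (D.inc v + D.ne) }

/-- Change the weight at the target of the edge `e`. -/
def setWt (D : Data) (e w : ℕ) : Data := { D with wt := update D.wt e w }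

variable {D : Data}

theorem notMem_E_ne : D.ne ∉ D.net.E := fun h => absurd (mem_E.1 h).1 (lt_irrefl _)

theorem addEdge_E {u v w W : ℕ} : (D.addEdge u v w W).net.E = insert D.ne D.net.E := by
  ext e
  rw [Finset.mem_insert, mem_E, mem_E]
  simp only [addEdge]
  by_cases h : e = D.ne
  · simp [h]
  · simp only [update_of_ne h]
    omega

theorem addEdge_load {u v w W : ℕ} (φ : ℕ → ℕ) (x : ℕ) :
    (D.addEdge u v w W).net.load φ x = D.net.load φ x +
      φ D.ne * ((if u = x then 1 else 0) + if v = x then 1 else 0) := by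
  rw [Net.load, addEdge_E, Finset.sum_insert notMem_E_ne, add_comm, Net.load]
  congr 1
  · refine Finset.sum_congr rfl fun e he => ?_
    have : e ≠ D.ne := by rintro rfl; exact notMem_E_ne he
    simp [net, addEdge, this]
  · simp [net, addEdge]

theorem Degs.addEdge (h : D.Degs) {u v w W : ℕ} (huv : u ≠ v) : (D.addEdge u v w W).Degs := by
  constructor <;> intro x <;> rw [addEdge_load]
  · rw [← h.1]
    by_cases h1 : x = v
    · subst h1; simp [Data.addEdge, huv]
    · by_cases h2 : x = u
      · subst h2; simp [Data.addEdge, huv, huv.symm]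
      · simp [Data.addEdge, h1, h2, Ne.symm h1, Ne.symm h2]
  · rw [← h.2]
    by_cases h1 : x = v
    · subst h1; simp [Data.addEdge, huv]
    · by_cases h2 : x = u
      · subst h2; simp [Data.addEdge, huv, huv.symm]
      · simp [Data.addEdge, h1, h2, Ne.symm h1, Ne.symm h2]

/-- The data structure after reading the arcs in `l`; `M u v` is one more than the edge
from `u` to `v`, or zero. -/
structure Built (D : Data) {n : ℕ} (I : MinPAC (Fin n)) (W : ℕ) (M : Fin n → Fin n → ℕ)
    (l : List (Fin n × Fin n)) : Prop where
  nv : D.nv = n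
  dead : ∀ v, D.dead v = 0
  base : ∀ v, D.base v = 0
  kind : ∀ e, D.kind e = if e < D.ne then 1 else 0
  gains : ∀ e, D.A e = 0 ∧ D.B e = 0 ∧ D.a₀ e = 0 ∧ D.b₀ e = 0 ∧ D.a₁ e = 0 ∧ D.b₁ e = 0
  degs : D.Degs
  ne_le : D.ne ≤ l.length
  ws_le : ∀ e, D.ws e ≤ W
  wt_le : ∀ e, D.wt e ≤ W
  edge : ∀ e < D.ne, ∃ u v : Fin n, D.src e = u ∧ D.tgt e = v ∧ (u, v) ∈ l ∧
    D.ws e = I.weight u v ∧ ((v, u) ∈ l ∧ D.wt e = I.weight v u ∨ (v, u) ∉ l ∧ D.wt e = W) ∧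
    M u v = e + 1
  table : ∀ u v, M u v ≠ 0 → ∃ e < D.ne, M u v = e + 1 ∧ D.src e = u ∧ D.tgt e = v
  arc : ∀ u v, (u, v) ∈ l → M u v ≠ 0 ∨ M v u ≠ 0
  asymm : ∀ u v, M u v ≠ 0 → M v u = 0

namespace Built

variable {n W : ℕ} {I : MinPAC (Fin n)} {M : Fin n → Fin n → ℕ} {l : List (Fin n × Fin n)}
  (h : D.Built I W M l)

include h

theorem mem_of_table {u v : Fin n} (hM : M u v ≠ 0) : (u, v) ∈ l := by
  obtain ⟨e, he, h1, h2, h3⟩ := h.table u v hM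
  obtain ⟨u', v', h4, h5, h6, -⟩ := h.edge e he
  rwa [Fin.ext (h2.symm.trans h4), Fin.ext (h3.symm.trans h5)]

theorem represents (hl : ∀ u v, (u, v) ∈ l ↔ I.graph.Adj u v) : D.Represents I W where
  nv := h.nv
  dead := h.dead
  base := h.base
  kind := h.kind
  edge e he := by
    obtain ⟨u, v, h1, h2, h3, h4, h5, -⟩ := h.edge e he
    rw [hl] at h3 h5
    exact ⟨u, v, h1, h2, h3, h4, h5⟩
  arc u v huv := by
    rcases h.arc u v ((hl u v).2 huv) with h1 | h1
    · obtain ⟨e, he, -, h2⟩ := h.table _ _ h1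
      exact ⟨e, he, Or.inl h2⟩
    · obtain ⟨e, he, -, h2⟩ := h.table _ _ h1
      exact ⟨e, he, Or.inr h2.symm⟩
  par e he e' he' := by
    obtain ⟨u, v, h1, h2, -, -, -, h3⟩ := h.edge e he
    obtain ⟨u', v', h1', h2', -, -, -, h3'⟩ := h.edge e' he'
    rw [h1, h2, h1', h2']
    rintro (⟨h4, h5⟩ | ⟨h4, h5⟩) <;> have h4 := Fin.ext h4 <;> have h5 := Fin.ext h5 <;> subst h4 h5
    · omega
    · have := h.asymm _ _ (by omega : M u v ≠ 0)
      omega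

theorem stage (hl : ∀ u v, (u, v) ∈ l ↔ I.graph.Adj u v) :
    D.Stage D.net n D.ne I.feedbackEdgeNumber W 0 where
  core := (h.represents hl).core
  degs := h.degs
  reduces k := ⟨fun hk => ⟨k, hk, le_rfl⟩, fun ⟨_, hk, hle⟩ => hk.mono hle⟩
  card := (h.represents hl).card_E
  nv := h.nv
  ne := rfl
  base_le v := by rw [h.base]; exact Nat.zero_le _
  ws_le := h.ws_le
  wt_le := h.wt_le
  gains_le e := by
    obtain ⟨h1, h2, h3, h4, h5, h6⟩ := h.gains e
    rw [h1, h2, h3, h4, h5, h6, (h.represents hl).net_V, Finset.card_range]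
    simp

/-- The reverse arc has not been read, since the table has no entry for either orientation. The new
edge therefore gets the weight `W` at its target. -/
theorem addEdge {u v : Fin n} (huv : u ≠ v) (hl : (u, v) ∉ l) (hM : M v u = 0)
    (hW : I.weight u v ≤ W) {M' : Fin n → Fin n → ℕ}
    (hM' : ∀ u' v', M' u' v' = if u' = u ∧ v' = v then D.ne + 1 else M u' v') :
    (D.addEdge u v (I.weight u v) W).Built I W M' (l ++ [(u, v)]) := by
  have hM₀ : M u v = 0 := by
    by_contra h1
    exact hl (h.mem_of_table h1)
  have hl' : (v, u) ∉ l := fun h1 => by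
    rcases h.arc _ _ h1 with h2 | h2
    exacts [h2 hM, h2 hM₀]
  have hvu : M' v u = 0 := by rw [hM', if_neg fun h1 => huv h1.2, hM]
  have hM₁ : M' u v = D.ne + 1 := by rw [hM', if_pos ⟨rfl, rfl⟩]
  constructor
  case nv => exact h.nv
  case dead => exact h.dead
  case base => exact h.base
  case gains => exact h.gains
  case degs => exact h.degs.addEdge fun h1 => huv (Fin.ext h1)
  case ws_le => exact update_le h.ws_le hW
  case wt_le => exact update_le h.wt_le le_rfl
  case kind =>
    intro e
    change update D.kind D.ne 1 e = if e < D.ne + 1 then 1 else 0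
    by_cases h1 : e = D.ne
    · simp [h1]
    · rw [update_of_ne h1, h.kind]
      exact if_congr (by omega) rfl rfl
  case ne_le =>
    have := h.ne_le
    change D.ne + 1 ≤ _
    simpa using this
  case edge =>
    intro e he
    change e < D.ne + 1 at he
    by_cases h1 : e = D.ne
    · subst h1
      exact ⟨u, v, update_self .., update_self .., by simp, update_self ..,
        Or.inr ⟨by simp [hl', huv.symm], update_self ..⟩, hM₁⟩
    · obtain ⟨u', v', h2, h3, h4, h5, h6, h7⟩ := h.edge e (by omega)
      -- Equality would give `M v u = e + 1`, against `hM`; so the new arc does not complete an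
      -- older edge.
      have h8 : (v', u') ≠ (u, v) := fun h8 => by
        obtain ⟨rfl, rfl⟩ := Prod.mk.inj h8
        omega
      have h9 : (u', v') ≠ (u, v) := fun h8 => by
        obtain ⟨rfl, rfl⟩ := Prod.mk.inj h8
        omega
      refine ⟨u', v', ?_, ?_, by simp [h4], ?_, ?_, ?_⟩
      · simpa [Data.addEdge, h1] using h2
      · simpa [Data.addEdge, h1] using h3
      · simpa [Data.addEdge, h1] using h5
      · simpa only [Data.addEdge, update_of_ne h1, List.mem_append, List.mem_singleton, h8,
          or_false] using h6
      · rw [hM', if_neg fun h10 => h9 (Prod.ext h10.1 h10.2), h7]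
  case table =>
    intro u' v' h1
    by_cases h2 : u' = u ∧ v' = v
    · obtain ⟨rfl, rfl⟩ := h2
      exact ⟨D.ne, Nat.lt_succ_self _, hM₁, update_self .., update_self ..⟩
    · rw [hM', if_neg h2] at h1 ⊢
      obtain ⟨e, he, h3, h4, h5⟩ := h.table u' v' h1
      exact ⟨e, he.trans (Nat.lt_succ_self _), h3, by simpa [Data.addEdge, he.ne] using h4,
        by simpa [Data.addEdge, he.ne] using h5⟩
  case arc =>
    intro u' v' h1
    rw [List.mem_append, List.mem_singleton] at h1
    rcases h1 with h1 | h1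
    · rw [hM', hM']
      rcases h.arc u' v' h1 with h2 | h2
      · left; split_ifs <;> omega
      · right; split_ifs <;> omega
    · obtain ⟨rfl, rfl⟩ := Prod.mk.inj h1
      exact Or.inl (by omega)
  case asymm =>
    intro u' v' h1
    by_cases h2 : u' = u ∧ v' = v
    · obtain ⟨rfl, rfl⟩ := h2
      exact hvu
    · rw [hM', if_neg h2] at h1
      have h3 : ¬ (v' = u ∧ u' = v) := by
        rintro ⟨rfl, rfl⟩
        omega
      rw [hM', if_neg h3]
      exact h.asymm _ _ h1

/-- The table shows that the reverse arc has its edge already, so the new arc only replaces the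
provisional weight `W` at the target of that edge. -/
theorem setWt {u v : Fin n} (hM : M v u ≠ 0) (hW : I.weight u v ≤ W) :
    (D.setWt (M v u - 1) (I.weight u v)).Built I W M (l ++ [(u, v)]) := by
  obtain ⟨e, he, h1, h2, h3⟩ := h.table v u hM
  rw [h1, Nat.add_sub_cancel]
  constructor
  case nv => exact h.nv
  case dead => exact h.dead
  case base => exact h.base
  case gains => exact h.gains
  case degs => exact h.degs
  case ws_le => exact h.ws_le
  case wt_le => exact update_le h.wt_le hW
  case kind => exact h.kind
  case ne_le =>
    have := h.ne_le
    rw [List.length_append]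
    exact this.trans (Nat.le_add_right _ _)
  case edge =>
    intro e' he'
    obtain ⟨u', v', h4, h5, h6, h7, h8, h9⟩ := h.edge e' he'
    refine ⟨u', v', h4, h5, by simp [h6], h7, ?_, h9⟩
    change _ ∧ update D.wt e _ e' = _ ∨ _ ∧ update D.wt e _ e' = _
    by_cases h10 : e' = e
    · subst h10
      obtain rfl := Fin.ext (h4.symm.trans h2)
      obtain rfl := Fin.ext (h5.symm.trans h3)
      exact Or.inl ⟨by simp, update_self ..⟩
    · have h11 : (v', u') ≠ (u, v) := fun h11 => by
        obtain ⟨rfl, rfl⟩ := Prod.mk.inj h11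
        omega
      simpa only [update_of_ne h10, List.mem_append, List.mem_singleton, h11, or_false] using h8
  case table => exact h.table
  case arc =>
    intro u' v' h4
    rw [List.mem_append, List.mem_singleton] at h4
    rcases h4 with h4 | h4
    · exact h.arc u' v' h4
    · obtain ⟨rfl, rfl⟩ := Prod.mk.inj h4
      exact Or.inr hM
  case asymm => exact h.asymm

end Built

end Data


namespace Data

open Function

/-- The data structure with `n` vertices and no edges. -/
def init (n : ℕ) : Data where
  nv := n
  ne := 0
  kind _ := 0
  src _ := 0
  tgt _ := 0
  ws _ := 0
  wt _ := 0
  A _ := 0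
  B _ := 0
  a₀ _ := 0
  b₀ _ := 0
  a₁ _ := 0
  b₁ _ := 0
  dead _ := 0
  base _ := 0
  deg _ := 0
  inc _ := 0

theorem init_built {n : ℕ} (I : MinPAC (Fin n)) (W : ℕ) :
    (init n).Built I W (fun _ _ => 0) [] := by
  have hE : (init n).net.E = ∅ := by simp [net, init]
  have hd : (init n).Degs := by
    constructor <;> intro v <;> rw [Net.load, hE, Finset.sum_empty] <;> rfl
  constructor
  case degs => exact hd
  all_goals simp [init]

end Data

namespace RAM

open Function Data

/-- The state holds the list of arcs of `I`. -/
structure State.Holds (s : State) {n : ℕ} (I : MinPAC (Fin n)) (l : List (Fin n × Fin n)) :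
    Prop where
  reg_zero : s.reg 0 = n
  reg_one : s.reg 1 = l.length
  entry : ∀ i (h : i < l.length), s.arr 0 i = l[i].1 ∧ s.arr 1 i = l[i].2 ∧
    s.arr 2 i = I.weight l[i].1 l[i].2

theorem State.Holds.congr {s s' : State} {n : ℕ} {I : MinPAC (Fin n)} {l : List (Fin n × Fin n)}
    (h : s.Holds I l) (h0 : s'.reg 0 = s.reg 0) (h1 : s'.reg 1 = s.reg 1)
    (ha : ∀ a < 3, s'.arr a = s.arr a) : s'.Holds I l where
  reg_zero := h0.trans h.reg_zero
  reg_one := h1.trans h.reg_one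
  entry := by
    rw [ha 0 (by omega), ha 1 (by omega), ha 2 (by omega)]
    exact h.entry

/-- Store the multiples of the number of vertices. -/
def tableBody : Stmt :=
  .store 18 (.var 3) (.var 7) ;; .assign 7 (.add (.var 7) (.var 0)) ;;
  .assign 3 (.add (.var 3) (.const 1))

/-- The invariant of the loop that stores the multiples of the number of vertices. -/
structure TableInv {n : ℕ} (I : MinPAC (Fin n)) (l : List (Fin n × Fin n)) (s : State) : Prop where
  holds : s.Holds I l
  view_eq : view s = init n
  reg_two : s.reg 2 = 0
  table : ∀ i, s.arr 19 i = 0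
  row : ∀ u < s.reg 3, s.arr 18 u = u * n
  reg_seven : s.reg 7 = s.reg 3 * n
  le : s.reg 3 ≤ n

/-- The machine has no multiplication, so the row offsets `u * n` of the table are produced by
repeated addition. -/
theorem wp_tableBody {B n : ℕ} {I : MinPAC (Fin n)} {l : List (Fin n × Fin n)} {s : State}
    (hB : n * n + n + 1 ≤ B) (hs : TableInv I l s) (hlt : s.reg 3 < s.reg 0) :
    tableBody.wp B (fun s' => TableInv I l s' ∧ n - s'.reg 3 < n - s.reg 3) s := by
  obtain ⟨h1, h2, h3, h4, h5, h6, h7⟩ := hs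
  have hn := h1.reg_zero
  have h8 : (s.reg 3 + 1) * n ≤ n * n := Nat.mul_le_mul_right _ (by omega)
  rw [add_one_mul] at h8
  refine ⟨trivial, trivial, ⟨trivial, trivial, ?_⟩, ⟨trivial, (by omega : 1 ≤ B), ?_⟩, ⟨?_, ?_,
      ?_, ?_, ?_, ?_, ?_⟩, ?_⟩
  · change s.reg 7 + s.reg 0 ≤ B
    omega
  · change s.reg 3 + 1 ≤ B
    omega
  · refine h1.congr rfl rfl fun a ha => ?_
    simp only [State.arr_setReg, State.arr_setArr]
    rw [if_neg (by omega)]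
  · rw [← h2]
    simp [view, State.reg_setReg, State.reg_setArr, State.arr_setReg, State.arr_setArr]
  · exact h3
  · simpa [State.arr_setReg, State.arr_setArr] using h4
  · intro u hu
    change u < s.reg 3 + 1 at hu
    simp only [State.arr_setReg, State.arr_setArr, if_true, update_apply, Expr.eval]
    split_ifs with h9
    · rw [h6, h9]
    · exact h5 u (by omega)
  · change s.reg 7 + s.reg 0 = (s.reg 3 + 1) * n
    rw [h6, hn, add_one_mul]
  · change s.reg 3 + 1 ≤ n
    omega
  · change n - (s.reg 3 + 1) < n - s.reg 3
    omega

/-- Add up the weights. -/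
def sumBody : Stmt :=
  .assign 6 (.add (.var 6) (.load 2 (.var 3))) ;; .assign 3 (.add (.var 3) (.const 1))

/-- The invariant of the loop that adds up the weights. -/
structure SumInv {n : ℕ} (I : MinPAC (Fin n)) (l : List (Fin n × Fin n)) (s : State) : Prop where
  holds : s.Holds I l
  view_eq : view s = init n
  reg_two : s.reg 2 = 0
  table : ∀ i, s.arr 19 i = 0
  row : ∀ u < n, s.arr 18 u = u * n
  reg_six : s.reg 6 = 1 + ((l.take (s.reg 3)).map fun a => I.weight a.1 a.2).sum
  le : s.reg 3 ≤ l.length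

theorem wp_sumBody {B n : ℕ} {I : MinPAC (Fin n)} {l : List (Fin n × Fin n)} {s : State}
    (hB : 1 + (l.map fun a => I.weight a.1 a.2).sum ≤ B) (hB' : l.length ≤ B)
    (hs : SumInv I l s) (hlt : s.reg 3 < s.reg 1) :
    sumBody.wp B (fun s' => SumInv I l s' ∧ l.length - s'.reg 3 < l.length - s.reg 3) s := by
  obtain ⟨h1, h2, h3, h4, h5, h6, h7⟩ := hs
  rw [h1.reg_one] at hlt
  have h8 : s.reg 6 + s.arr 2 (s.reg 3) =
      1 + ((l.take (s.reg 3 + 1)).map fun a => I.weight a.1 a.2).sum := by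
    rw [← List.take_append_getElem hlt, List.map_append, List.sum_append, List.map_singleton,
      List.sum_singleton, h6, (h1.entry _ hlt).2.2, add_assoc]
  have h9 : ((l.take (s.reg 3 + 1)).map fun a => I.weight a.1 a.2).sum ≤
      (l.map fun a => I.weight a.1 a.2).sum :=
    ((List.take_sublist _ _).map _).sum_le_sum fun _ _ => Nat.zero_le _
  refine ⟨⟨trivial, trivial, ?_⟩, ⟨trivial, (by omega : 1 ≤ B), ?_⟩, ⟨?_, h2, h3, h4, h5, h8,
      ?_⟩, ?_⟩
  · change s.reg 6 + s.arr 2 (s.reg 3) ≤ B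
    omega
  · change s.reg 3 + 1 ≤ B
    omega
  · exact h1.congr rfl rfl fun a ha => rfl
  · change s.reg 3 + 1 ≤ l.length
    omega
  · change l.length - (s.reg 3 + 1) < l.length - s.reg 3
    omega

/-- Add an edge for the arc in register `3`, whose ends are in the registers `8` and `9`. -/
def addEdgeStmt : Stmt :=
  .store 3 (.var 4) (.const 1) ;; .store 4 (.var 4) (.var 8) ;; .store 5 (.var 4) (.var 9) ;;
  .store 6 (.var 4) (.load 2 (.var 3)) ;; .store 7 (.var 4) (.var 6) ;;
  .store 16 (.var 8) (.add (.load 16 (.var 8)) (.const 1)) ;;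
  .store 16 (.var 9) (.add (.load 16 (.var 9)) (.const 1)) ;;
  .store 17 (.var 8) (.add (.load 17 (.var 8)) (.var 4)) ;;
  .store 17 (.var 9) (.add (.load 17 (.var 9)) (.var 4)) ;;
  .store 19 (.add (.load 18 (.var 8)) (.var 9)) (.add (.var 4) (.const 1)) ;;
  .assign 4 (.add (.var 4) (.const 1))

theorem wp_addEdgeStmt {B : ℕ} {Q : State → Prop} {s : State} (hne : s.reg 8 ≠ s.reg 9)
    (hB : ∀ v, (view s).deg v + 1 ≤ B) (hB' : ∀ v, (view s).inc v + s.reg 4 ≤ B)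
    (hB₁ : s.arr 18 (s.reg 8) + s.reg 9 ≤ B) (hB₂ : s.reg 4 + 1 ≤ B)
    (h : ∀ s', view s' = (view s).addEdge (s.reg 8) (s.reg 9) (s.arr 2 (s.reg 3)) (s.reg 6) →
      s'.arr 19 = update (s.arr 19) (s.arr 18 (s.reg 8) + s.reg 9) (s.reg 4 + 1) →
      s'.arr 18 = s.arr 18 → (∀ a < 3, s'.arr a = s.arr a) →
      (∀ x, x ≠ 4 → s'.reg x = s.reg x) → Q s') :
    addEdgeStmt.wp B Q s := by
  simp only [view] at hB hB'
  have h8 := hB (s.reg 8)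
  have h9 := hB (s.reg 9)
  have h8' := hB' (s.reg 8)
  have h9' := hB' (s.reg 9)
  simp only [addEdgeStmt, Stmt.wp, Expr.Safe, Expr.eval, true_and,
    State.reg_setArr, State.arr_setArr, reduceIte, Nat.reduceEqDiff,
    update_of_ne hne.symm]
  refine ⟨by omega, ⟨by omega, by omega⟩, ⟨by omega, by omega⟩, by omega, by omega,
    hB₁, ⟨by omega, hB₂⟩, ⟨by omega, hB₂⟩, h _ ?_ ?_ ?_ ?_ ?_⟩
  · simp [view, Data.addEdge, State.reg_setReg, State.reg_setArr, State.arr_setReg,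
      State.arr_setArr]
  · simp [State.arr_setReg, State.arr_setArr]
  · simp [State.arr_setReg, State.arr_setArr]
  · intro a ha
    simp only [State.arr_setReg, State.arr_setArr]
    repeat rw [if_neg (by omega)]
  · intro x hx
    simp [State.reg_setReg, State.reg_setArr, hx]

/-- Read the arc in register `3`. -/
def buildBody : Stmt :=
  .assign 8 (.load 0 (.var 3)) ;; .assign 9 (.load 1 (.var 3)) ;;
  .assign 10 (.load 19 (.add (.load 18 (.var 9)) (.var 8))) ;;
  .ifEq (.var 10) (.const 0) addEdgeStmt (.store 7 (.sub (.var 10) (.const 1)) (.load 2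
      (.var 3))) ;;
  .assign 3 (.add (.var 3) (.const 1))

/-- The invariant of the loop that reads the arcs. -/
structure BuildInv {n : ℕ} (I : MinPAC (Fin n)) (l : List (Fin n × Fin n)) (W : ℕ) (s : State) :
    Prop where
  holds : s.Holds I l
  built : (view s).Built I W (fun u v => s.arr 19 (u * n + v)) (l.take (s.reg 3))
  reg_two : s.reg 2 = 0
  row : ∀ u < n, s.arr 18 u = u * n
  reg_six : s.reg 6 = W
  le : s.reg 3 ≤ l.length

theorem mul_add_eq_iff {n : ℕ} {u v u' v' : Fin n} :
    (u : ℕ) * n + v = u' * n + v' ↔ u = u' ∧ v = v' := by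
  constructor
  · intro h
    have h1 : ∀ a b : Fin n, ((a : ℕ) * n + b) / n = a := fun a b => by
      rw [mul_comm, Nat.mul_add_div a.pos, Nat.div_eq_of_lt b.2, add_zero]
    have h2 := congrArg (· / n) h
    simp only [h1] at h2
    rw [h2] at h
    exact ⟨Fin.ext h2, Fin.ext (by omega)⟩
  · rintro ⟨rfl, rfl⟩
    rfl

/-- One look at the entry for `(v, u)` decides whether the arc `(u, v)` opens a new edge. The table
is never initialised: entries not yet written are zero, and real entries are shifted by one. -/
theorem wp_buildBody {B n W : ℕ} {I : MinPAC (Fin n)} {l : List (Fin n × Fin n)} {s : State}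
    (hl : l.Nodup) (hadj : ∀ u v, (u, v) ∈ l → I.graph.Adj u v)
    (hW : ∀ a ∈ l, I.weight a.1 a.2 ≤ W) (hB : n * n + 2 * l.length * l.length +
      2 * l.length + 1 ≤ B) (hs : BuildInv I l W s) (hlt : s.reg 3 < s.reg 1) :
    buildBody.wp B (fun s' => BuildInv I l W s' ∧ l.length - s'.reg 3 < l.length - s.reg 3) s := by
  obtain ⟨h1, h2, h3, h4, h5, h6⟩ := hs
  rw [h1.reg_one] at hlt
  obtain ⟨e1, e2, e3⟩ := h1.entry _ hlt
  have hmem : l[s.reg 3] ∈ l := List.getElem_mem hlt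
  have hW' := hW _ hmem
  obtain ⟨u, v, huv⟩ : ∃ u v, l[s.reg 3] = (u, v) := ⟨_, _, rfl⟩
  have htake : l.take (s.reg 3) ++ [(u, v)] = l.take (s.reg 3 + 1) := by
    rw [← huv, List.take_append_getElem hlt]
  have hnew : (u, v) ∉ l.take (s.reg 3) := by
    have := hl.sublist (List.take_sublist (s.reg 3 + 1) l)
    rw [← htake, List.nodup_append] at this
    exact fun h => this.2.2 _ h _ (List.mem_singleton_self _) rfl
  rw [huv] at e1 e2 e3 hW' hmem
  have hne : u ≠ v := by
    rintro rfl
    exact I.loopless _ (hadj _ _ hmem)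
  have hrow : ∀ a b : Fin n, (a : ℕ) * n + b ≤ B := fun a b => by
    have : ((a : ℕ) + 1) * n ≤ n * n := Nat.mul_le_mul_right _ a.2
    have := b.2
    rw [add_one_mul] at *
    omega
  have hE : (view s).ne ≤ l.length := h2.ne_le.trans (List.length_take_le' _ _)
  have hinc : 2 * (view s).ne * (view s).ne ≤ 2 * l.length * l.length := by gcongr
  have hdeg := h2.degs.le
  have hne4 : (view s).ne = s.reg 4 := rfl
  rw [hne4] at hE hinc hdeg
  simp only [buildBody, Stmt.wp, Expr.Safe, Expr.eval, true_and, State.reg_setReg,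
    State.reg_setArr, State.arr_setReg, reduceIte, Nat.reduceEqDiff, e1, e2, h4 v v.2]
  refine ⟨hrow v u, by omega, fun hM => ?_, fun hM => ?_⟩
  · refine wp_addEdgeStmt ?_ ?_ ?_ ?_ ?_ fun s' v' a19 a18 a2 r' => ?_
    · simpa [State.reg_setReg] using fun h => hne (Fin.ext h)
    · intro x
      have := (hdeg x).1
      change (view s).deg x + 1 ≤ B
      omega
    · intro x
      have := (hdeg x).2
      change (view s).inc x + s.reg 4 ≤ B
      omega
    · simpa [State.reg_setReg, State.arr_setReg, h4 u u.2] using hrow u v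
    · change s.reg 4 + 1 ≤ B
      omega
    have r3 : s'.reg 3 = s.reg 3 := r' 3 (by norm_num)
    have v'' : view s' = (view s).addEdge u v (I.weight u v) W := by
      simpa [State.reg_setReg, State.arr_setReg, e3, h5, view] using v'
    have a19' : s'.arr 19 = update (s.arr 19) (u * n + v) (s.reg 4 + 1) := by
      simpa [State.reg_setReg, State.arr_setReg, h4 u u.2] using a19
    refine ⟨⟨by omega, by omega⟩, ⟨?_, ?_, ?_, ?_, ?_, ?_⟩, ?_⟩
    · exact h1.congr (r' 0 (by norm_num)) (r' 1 (by norm_num)) a2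
    · change (view s').Built I W (fun u v => s'.arr 19 (u * n + v)) (l.take (s'.reg 3 + 1))
      rw [r3, ← htake, v'']
      refine h2.addEdge hne hnew hM hW' fun u' v' => ?_
      rw [a19', update_apply]
      exact if_congr mul_add_eq_iff rfl rfl
    · exact (r' 2 (by norm_num)).trans h3
    · intro x hx
      exact (congrFun a18 x).trans (h4 x hx)
    · exact (r' 6 (by norm_num)).trans h5
    · change s'.reg 3 + 1 ≤ _
      omega
    · omega
  · refine ⟨by omega, ⟨by omega, by omega⟩, ⟨?_, ?_, h3, ?_, h5, ?_⟩, ?_⟩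
    · refine h1.congr rfl rfl fun a ha => ?_
      simp only [State.arr_setReg, State.arr_setArr]
      rw [if_neg (by omega)]
    · simp only [State.reg_setReg, reduceIte]
      rw [← htake]
      have := h2.setWt hM hW'
      convert this using 1
      · simp [view, Data.setWt, State.reg_setReg, State.reg_setArr, State.arr_setReg,
          State.arr_setArr, e3]
      · simp [State.arr_setReg, State.arr_setArr]
    · simpa [State.arr_setReg, State.arr_setArr] using h4
    · change s.reg 3 + 1 ≤ _
      omega
    · omega

end RAM


/-! ## The algorithm -/

namespace RAM

open Data

/-- The statement `p`, followed by the loop that executes `q` while register `3` is smaller than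
register `y`. -/
def phase (p : Stmt) (y : ℕ) (q : Stmt) : Prog :=
  .seq (p.code 30) (.whileLt 3 y (q.code 30))

/-- A phase with at most `7 * x` iterations takes at most `phaseTime p q * x` steps. -/
def phaseTime (p q : Stmt) : ℕ := p.time + (q.time + 1) * 7 + 1

theorem runs_phase {B y x : ℕ} {p q : Stmt} {s : State} (I : State → Prop) (Φ : State → ℕ)
    (hp : p.ok 30 = true) (hq : q.ok 30 = true) (hy : y < 30) (hx : 1 ≤ x)
    (hbody : ∀ s, I s → s.reg 3 < s.reg y → q.wp B (fun s' => I s' ∧ Φ s' < Φ s) s)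
    (hs : p.wp B (fun s => I s ∧ Φ s ≤ 7 * x) s) :
    Runs B 30 (phase p y q) s (phaseTime p q * x) fun s' => I s' ∧ s'.reg y ≤ s'.reg 3 := by
  refine ((p.runs hp hs).seq fun s' h => ?_).mono
    (t := p.time + ((q.time + 1) * (7 * x) + 1)) ?_ fun _ h => h
  · refine (Runs.whileLt I Φ (by norm_num) hy (fun s hI hlt => q.runs hq (hbody s hI hlt))
      h.1).mono ?_ fun _ h => h
    have := Nat.mul_le_mul_left (q.time + 1) h.2
    omega
  · have : phaseTime p q * x = p.time * x + (q.time + 1) * (7 * x) + x := by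
      unfold phaseTime; ring
    have := Nat.le_mul_of_pos_right p.time hx
    omega

/-- Read the input. -/
def readProg : Prog :=
  .seq (phase (.assign 5 (.var 0)) 0 tableBody)
    (.seq (phase (.assign 3 (.const 0) ;; .assign 6 (.const 1)) 1 sumBody)
      (phase (.assign 3 (.const 0)) 1 buildBody))

/-- The factor in the running time of `readProg`. -/
def readTime : ℕ :=
  phaseTime (.assign 5 (.var 0)) tableBody +
    (phaseTime (.assign 3 (.const 0) ;; .assign 6 (.const 1)) sumBody +
      phaseTime (.assign 3 (.const 0)) buildBody)

theorem runs_readProg {B n : ℕ} {I : MinPAC (Fin n)} {l : List (Fin n × Fin n)} {s : State}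
    (hl : l.Nodup) (hadj : ∀ u v, (u, v) ∈ l → I.graph.Adj u v) (hn : 1 ≤ n)
    (hB : n * n + n + 2 * l.length * l.length + 2 * l.length + 1 ≤ B)
    (hB' : 1 + (l.map fun a => I.weight a.1 a.2).sum ≤ B) (hs : s.Holds I l)
    (hr : ∀ x, 2 ≤ x → s.reg x = 0) (ha : ∀ a i, 3 ≤ a → s.arr a i = 0) :
    Runs B 30 readProg s (readTime * (n + l.length)) fun s' =>
      s'.reg 2 = 0 ∧ ∃ M, (view s').Built I (1 + (l.map fun a => I.weight a.1 a.2).sum) M l := by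
  have hx : 1 ≤ n + l.length := by omega
  rw [readTime, add_mul, add_mul]
  refine Runs.seq (runs_phase (TableInv I l) (fun s => n - s.reg 3) rfl rfl (by norm_num) hx
    (fun s hs hlt => wp_tableBody (by omega) hs hlt) ?_) fun s₁ h₁ => ?_
  · refine ⟨trivial, ⟨hs.congr rfl rfl fun _ _ => rfl, ?_, hr 2 le_rfl, fun i => ha 19 i
        (by norm_num),
      fun u hu => ?_, ?_, ?_⟩, ?_⟩
    · have ha' : ∀ a, 3 ≤ a → s.arr a = fun _ => 0 := fun a h => funext fun i => ha a i h
      simp [view, init, State.reg_setReg, State.arr_setReg, ha', hr, Expr.eval, hs.reg_zero]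
    · simp [State.reg_setReg, hr] at hu
    · simp [State.reg_setReg, hr]
    · simp [State.reg_setReg, hr]
    · omega
  obtain ⟨⟨h1, h2, h3, h4, h5, h6, h7⟩, h8⟩ := h₁
  have h9 : s₁.reg 3 = n := by
    have := h1.reg_zero
    omega
  refine Runs.seq (runs_phase (SumInv I l) (fun s => l.length - s.reg 3) rfl rfl (by norm_num) hx
    (fun s hs hlt => wp_sumBody hB' (by omega) hs hlt) ?_) fun s₂ h₂ => ?_
  · refine ⟨Nat.zero_le _, (by omega : 1 ≤ B), ⟨h1.congr rfl rfl fun _ _ => rfl, h2, h3, h4,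
      h9 ▸ h5, ?_, ?_⟩, ?_⟩
    · simp [State.reg_setReg, Expr.eval]
    · simp [State.reg_setReg, Expr.eval]
    · omega
  obtain ⟨⟨i1, i2, i3, i4, i5, i6, i7⟩, i8⟩ := h₂
  have i9 : s₂.reg 3 = l.length := by
    have := i1.reg_one
    omega
  rw [i9, List.take_length] at i6
  refine (runs_phase (BuildInv I l (1 + (l.map fun a => I.weight a.1 a.2).sum))
      (fun s => l.length - s.reg 3) rfl rfl (by norm_num) hx
    (fun s hs hlt => wp_buildBody hl hadj (fun a ha => ?_) (by omega) hs hlt) ?_).mono le_rfl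
      fun s' h => ?_
  · exact (List.single_le_sum (fun _ _ => Nat.zero_le _) _
      (List.mem_map_of_mem (f := fun a => I.weight a.1 a.2) ha)).trans (Nat.le_add_left _ _)
  · refine ⟨Nat.zero_le _, ⟨i1.congr rfl rfl fun _ _ => rfl, ?_, i3, i5, i6, Nat.zero_le _⟩, ?_⟩
    · have hv : view (s₂.setReg 3 0) = init n := i2
      have ht : ∀ i, (s₂.setReg 3 0).arr 19 i = 0 := i4
      simp only [Expr.eval, hv, ht]
      exact init_built I _
    · omega
  · obtain ⟨⟨j1, j2, j3, j4, j5, j6⟩, j7⟩ := h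
    have j8 : s'.reg 3 = l.length := by
      have := j1.reg_one
      omega
    rw [j8, List.take_length] at j2
    exact ⟨j3, _, j2⟩

/-- Reduce the stored network. -/
def reduceProg : Prog :=
  .seq (phase (.assign 3 (.const 0) ;; .assign 8 (.const 0)) 5 pruneBody)
    (.seq (phase (.assign 3 (.const 0)) 4 contractBody)
      (phase (.assign 3 (.const 0) ;; .assign 16 (.var 4)) 16 expandBody))

/-- The factor in the running time of `reduceProg`. -/
def reduceTime : ℕ :=
  phaseTime (.assign 3 (.const 0) ;; .assign 8 (.const 0)) pruneBody +
    (phaseTime (.assign 3 (.const 0)) contractBody +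
      phaseTime (.assign 3 (.const 0) ;; .assign 16 (.var 4)) expandBody)

/-- The result of the reduction of the network `N₀` with feedback edge number `g`. -/
structure Reduced (N₀ : Net) (n m g : ℕ) (s : State) : Prop where
  core : (view s).Core
  reduces : N₀.Reduces (view s).net (s.reg 2)
  single : ∀ e ∈ (view s).net.E, (view s).kind e = 1
  nonempty : (view s).net.V.Nonempty
  card_V : (view s).net.V.card ≤ 20 * g - 20
  card_E : (view s).net.E.card ≤ 21 * g - 21
  nv_le : (view s).nv ≤ n + 6 * m
  ne_le : (view s).ne ≤ 7 * m

/-- The word bound covers the achieved constant (at most `k₀`), the summaries (at most `K * n`, and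
twice that for the two shares of an inner gain), the sums of edge numbers, and the enlarged counts
of vertices and edges. -/
theorem runs_reduceProg {B k₀ n m g K x : ℕ} {N₀ : Net} {s : State} (hg : 2 ≤ g) (hk : N₀.Ach k₀)
    (hB : k₀ + K * (2 * n + 1) + 2 * m * m + 7 * m + n + 6 ≤ B) (hx : 1 ≤ x)
    (hx' : n + m ≤ x) (hs : (view s).Stage N₀ n m g K (s.reg 2))
    (hs' : ∀ e, (view s).kind e ≤ 1) :
    Runs B 30 reduceProg s (reduceTime * x) (Reduced N₀ n m g) := by
  rw [reduceTime, add_mul, add_mul]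
  have hK : K ≤ K * (2 * n + 1) := Nat.le_mul_of_pos_right _ (by omega)
  have hV : ∀ s : State, (view s).nv = n → (view s).net.V.card ≤ n := fun s h =>
    h ▸ (Finset.card_le_card (Finset.filter_subset _ _)).trans (Finset.card_range _).le
  have hE : ∀ s : State, (view s).ne = m → (view s).net.E.card ≤ m := fun s h =>
    h ▸ (Finset.card_le_card (Finset.filter_subset _ _)).trans (Finset.card_range _).le
  refine Runs.seq (runs_phase (PruneInv N₀ n m g K) prunePotential rfl rfl (by norm_num) hx
    (fun s hs hlt => wp_pruneBody hk (by omega) hs hlt) ?_) fun s₁ h₁ => ?_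
  · refine ⟨Nat.zero_le _, Nat.zero_le _, ⟨hs, hs', fun y hy hne => ?_, Or.inr rfl⟩, ?_⟩
    · simp [State.reg_setReg, Expr.eval] at hy hne
      exact absurd hy hne
    · have h1 := hV s hs.nv
      have h2 : s.reg 5 = n := hs.nv
      change (view s).net.V.card + (s.reg 5 - 0) ≤ _
      omega
  obtain ⟨⟨h1, h2, h3, h4⟩, h5⟩ := h₁
  refine Runs.seq (runs_phase (ContractInv N₀ n m g K) contractPotential rfl rfl (by norm_num) hx
    (fun s hs hlt => wp_contractBody hg hk (by omega) hs hlt) ?_) fun s₂ h₂ => ?_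
  · refine ⟨Nat.zero_le _, ⟨h1, ?_, fun v => ?_, fun e _ he => absurd he (Nat.not_lt_zero _)⟩, ?_⟩
    · exact fun e _ => h2 e
    -- The scan has passed all vertices, so the one possible exception in register `8` is not a
    -- vertex.
    · have h6 : s₁.reg 8 = s₁.reg 3 := h4.resolve_left (by omega)
      change (view s₁).deg v ≠ 1
      rcases lt_or_ge v (s₁.reg 5) with h7 | h7
      · exact h3 v (by omega) (by omega)
      · rw [h1.degs.1, Net.load_eq_zero h1.core.wf]
        · norm_num
        · exact fun hv => absurd (lt_nv_of_mem hv) (not_lt.2 h7)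
    · have h6 := hE s₁ h1.ne
      have h7 : s₁.reg 4 = m := h1.ne
      change (view s₁).net.E.card + (s₁.reg 4 - 0) ≤ _
      omega
  obtain ⟨⟨i1, i2⟩, i3⟩ := h₂
  have hm : s₂.reg 4 = m := i1.ne
  have hn : s₂.reg 5 = n := i1.nv
  have hcard := i1.card
  obtain ⟨k, hk'⟩ := i1.exists_ach hk
  have h3 : ∀ v ∈ (view s₂).net.V, 3 ≤ (view s₂).net.load (fun _ => 1) v := fun v hv => by
    refine Net.three_le_load i1.core.wf hk' (by omega) hv ?_ fun e he => ?_
    · rw [← i1.degs.1]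
      exact i2.deg_ne_one v
    · have h4 : e < s₂.reg 4 := (mem_E.1 he).1
      have := i2.deg_ne_two e he (by omega)
      rwa [i1.degs.1, i1.degs.1] at this
  have h4 := Net.card_le_of_three_le i1.core.wf h3 hcard
  have h5 : (view s₂).longEdges.card ≤ (view s₂).net.E.card :=
    Finset.card_le_card (Finset.filter_subset _ _)
  have h6 : (view s₂).net.V.Nonempty := by
    obtain ⟨e, he⟩ := Finset.card_pos.1 (by omega : 0 < (view s₂).net.E.card)
    exact ⟨_, (i1.core.wf e he).1⟩
  -- The bounds are `(2g - 2) + 6 (3g - 3)` and `(3g - 3) + 6 (3g - 3)`, as each edge may stand for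
  -- a path.
  refine (runs_phase (ExpandInv N₀ n m (20 * g - 20) (21 * g - 21) (s₂.reg 2))
    (fun s => m - s.reg 3) rfl rfl (by norm_num) hx
    (fun s hs hlt => wp_expandBody (by omega) hs hlt) ?_).mono le_rfl fun s' h => ?_
  · refine ⟨Nat.zero_le _, trivial, ⟨i1.core, i1.reduces, rfl, hm, ?_, ?_, fun e he =>
      ⟨Nat.zero_le _, ?_⟩, ?_, ?_, Nat.zero_le _, hm.ge, ?_⟩, ?_⟩
    · change (view s₂).net.V.card + 6 * (view s₂).longEdges.card ≤ _
      omega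
    · change (view s₂).net.E.card + 6 * (view s₂).longEdges.card ≤ _
      omega
    · have : e < s₂.reg 4 := (mem_longEdges.1 he).1
      omega
    · change s₂.reg 5 ≤ _
      omega
    · change s₂.reg 4 ≤ _
      omega
    · obtain ⟨v, hv⟩ := h6
      exact ⟨v, mem_V.1 hv⟩
    · omega
  · obtain ⟨⟨j1, j2, j3, j4, j5, j6, j7, j8, j9, j10, j11, v, j12⟩, j13⟩ := h
    refine ⟨j1, by rwa [j3], fun e he => ?_, ⟨v, mem_V.2 j12⟩, by omega, by omega,
      (?_ : s'.reg 5 ≤ _), (?_ : s'.reg 4 ≤ _)⟩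
    · have h7 := j1.kind_le e
      have h8 := (mem_E.1 he).2
      have h9 : (view s').kind e ≠ 2 := fun h9 => by
        have := j7 e (mem_longEdges.2 ⟨(mem_E.1 he).1, h9⟩)
        omega
      omega
    · omega
    · omega

/-- Write the stored network as an instance of MinPAC. -/
def writeProg : Prog :=
  .seq (phase (.assign 3 (.const 0) ;; .assign 7 (.const 0)) 5 numberBody)
    (phase (.assign 3 (.const 0) ;; .assign 1 (.const 0) ;; .assign 0 (.var 7)) 4 writeBody)

/-- The factor in the running time of `writeProg`. -/
def writeTime : ℕ :=
  phaseTime (.assign 3 (.const 0) ;; .assign 7 (.const 0)) numberBody +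
    phaseTime (.assign 3 (.const 0) ;; .assign 1 (.const 0) ;; .assign 0 (.var 7)) writeBody

/-- Register `2` collects the constant of the reductions and then the minimum powers, which the
output weights no longer contain. At most `7 * m` edges give at most `14 * m` arcs before the finer
count. -/
theorem runs_writeProg {B k₀ n m g x : ℕ} {N₀ : Net} {s : State}
    (hk : IsLeast {k | N₀.Ach k} k₀) (hB : k₀ + n + 14 * m + 2 ≤ B) (hx : 1 ≤ x)
    (hx' : n + m ≤ x) (hs : Reduced N₀ n m g s) :
    Runs B 30 writeProg s (writeTime * x) fun s' => ∃ (n' : ℕ) (I' : MinPAC (Fin n')),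
      s'.Stores I' ∧ n' ≤ 20 * g - 20 ∧ I'.arcs.card ≤ 42 * g - 42 ∧ k₀ = I'.opt + s'.reg 2 := by
  rw [writeTime, add_mul]
  obtain ⟨h1, h2, h3, h4, h5, h6, h7, h8⟩ := hs
  obtain ⟨h9, h10⟩ := h2.isLeast hk
  have h11 : ∑ v ∈ (view s).net.V, (view s).base v ≤ k₀ - s.reg 2 := h10.1.sum_base_le
  refine Runs.seq (runs_phase (NumberInv (view s) (s.reg 2)) (fun s' => (view s).nv - s'.reg 3) rfl
    rfl (by norm_num) hx
    (fun s hs hlt => wp_numberBody (by omega) (by omega) hs hlt) ?_) fun s₁ h => ?_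
  · have hV : ((view s).below 0).net.V = ∅ := Finset.eq_empty_of_forall_notMem fun v hv =>
      absurd (mem_below.1 hv).1 (Nat.not_lt_zero _)
    refine ⟨Nat.zero_le _, Nat.zero_le _, ⟨rfl, ⟨?_, ?_, ?_⟩, ?_, ?_, Nat.zero_le _⟩, ?_⟩
    · intro v hv
      change v ∈ ((view s).below 0).net.V at hv
      simp [hV] at hv
    · intro v hv
      change v ∈ ((view s).below 0).net.V at hv
      simp [hV] at hv
    · intro i hi
      exact absurd hi (Nat.not_lt_zero _)
    · change 0 = ((view s).below 0).net.V.card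
      rw [hV]
      rfl
    · change s.reg 2 = s.reg 2 + ∑ v ∈ ((view s).below 0).net.V, _
      rw [hV]
      rfl
    · omega
  obtain ⟨⟨i1, i2, i3, i4, i5⟩, i6⟩ := h
  have i7 : s₁.reg 5 = (view s).nv := congrArg Data.nv i1
  have i8 : (view s).below (s₁.reg 3) = view s := by
    rw [show s₁.reg 3 = (view s).nv by omega]
    rfl
  rw [i8] at i2 i3 i4
  obtain ⟨I', j1, j2, j3⟩ := h1.exists_minPAC h3 i2 h4 h10
  refine (runs_phase (WriteInv (view s) (s₁.arr 20) (s₁.reg 7) (s₁.reg 2))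
    (fun s' => (view s).ne - s'.reg 3) rfl rfl (by norm_num) hx
    (fun s hs hlt => wp_writeBody (by omega) hs hlt) ?_).mono le_rfl fun s' h => ?_
  · refine ⟨Nat.zero_le _, Nat.zero_le _, trivial, ⟨i1, rfl, rfl, rfl, ⟨rfl, fun i hi => ?_⟩,
      Nat.zero_le _⟩, ?_⟩
    · exact absurd hi (Nat.not_lt_zero _)
    · omega
  · obtain ⟨⟨l1, l2, l3, l4, l5, l6⟩, l7⟩ := h
    have l8 : s'.reg 4 = (view s).ne := congrArg Data.ne l1
    rw [show s'.reg 3 = (view s).ne by omega] at l5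
    exact ⟨_, I', j3 s' l3 l5.1 l5.2, by omega, by omega, by omega⟩

end RAM


/-! ### The complete algorithm and its word length -/

namespace RAM

/-- The algorithm. -/
def algorithm : Prog := .seq readProg (.seq reduceProg writeProg)

/-- The factor in the running time of the algorithm. -/
def algorithmTime : ℕ := readTime + (reduceTime + writeTime)

theorem arcs_eq_toFinset {n : ℕ} {I : MinPAC (Fin n)} {l : List (Fin n × Fin n)}
    (hl : ∀ u v, (u, v) ∈ l ↔ I.graph.Adj u v) : I.arcs = l.toFinset := by
  ext ⟨u, v⟩
  rw [List.mem_toFinset, hl]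
  simp [MinPAC.arcs]

/-- With `N = n + m + max w + 2`, every number that occurs is at most a small multiple of `N ^ 3`:
the largest are products of the weight `W`, at most `N ^ 2`, with `n`. The seventh power absorbs the
multiple because `N ≥ 2`. -/
theorem runs_algorithm {B n : ℕ} {I : MinPAC (Fin n)} (hg : 2 ≤ I.feedbackEdgeNumber)
    {s : State} (hs : s.IsInput I) (hB : (n + I.arcs.card + I.maxWeight + 2) ^ 7 ≤ B) :
    Runs B 30 algorithm s (algorithmTime * (n + I.arcs.card)) fun s' =>
      ∃ (n' : ℕ) (I' : MinPAC (Fin n')), s'.Stores I' ∧ n' ≤ 20 * I.feedbackEdgeNumber - 20 ∧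
        I'.arcs.card ≤ 42 * I.feedbackEdgeNumber - 42 ∧ I.opt = I'.opt + s'.reg 2 := by
  obtain ⟨⟨h1, l, h2, h3, h4, h5⟩, h6, h7⟩ := hs
  have harcs := arcs_eq_toFinset h3
  have hcard : I.arcs.card = l.length := by rw [harcs, List.toFinset_card_of_nodup h2]
  set S := (l.map fun a => I.weight a.1 a.2).sum with hS
  have hsum : ∑ a ∈ I.arcs, I.weight a.1 a.2 = S := by
    rw [harcs, List.sum_toFinset _ h2]
  have hopt := I.opt_le_sum_weight
  rw [hsum] at hopt
  have hle : S ≤ l.length * I.maxWeight := by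
    rw [← hsum, ← hcard, ← smul_eq_mul]
    exact Finset.sum_le_card_nsmul _ _ _ fun a ha =>
      Finset.le_sup (f := fun a => I.weight a.1 a.2) ha
  rw [hcard] at hB ⊢
  have hn : 1 ≤ n := Fin.pos (Classical.choice I.nonempty)
  set N := n + l.length + I.maxWeight + 2 with hN
  have b1 : N * N ≤ N * N * N := Nat.le_mul_of_pos_right _ (by omega)
  have b2 : 16 * (N * N * N) ≤ B := by
    refine le_trans ?_ hB
    have : 2 ^ 4 ≤ N ^ 4 := Nat.pow_le_pow_left (by omega) 4
    calc 16 * (N * N * N) ≤ N ^ 4 * (N * N * N) := Nat.mul_le_mul_right _ this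
      _ = N ^ 7 := by ring
  have b3 : n * n ≤ N * N := Nat.mul_le_mul (by omega) (by omega)
  have b4 : l.length * l.length ≤ N * N := Nat.mul_le_mul (by omega) (by omega)
  have b5 : 2 * N ≤ N * N := Nat.mul_le_mul_right _ (by omega)
  have b6 : (l.length + 1) * (I.maxWeight + 1) ≤ N * N := Nat.mul_le_mul (by omega) (by omega)
  have b7 : 1 + S ≤ N * N := by
    rw [add_one_mul, mul_add_one] at b6
    omega
  have b8 : (1 + S) * n ≤ N * N * N := Nat.mul_le_mul b7 (by omega)
  have e1 : (1 + S) * (2 * n + 1) = 2 * ((1 + S) * n) + (1 + S) := by ring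
  rw [algorithmTime, add_mul, add_mul]
  refine (runs_readProg h2 (fun u v => (h3 u v).1) hn (by rw [mul_assoc 2]; omega) (by omega)
    ⟨h1, h4, h5⟩ h6 fun a i ha => h7 a i (Or.inl ha)).seq ?_
  rintro s₁ ⟨i1, M, i2⟩
  have hk := (i2.represents h3).isLeast (by omega)
  have i3 : (view s₁).ne ≤ l.length := i2.ne_le
  have i4 : (view s₁).ne * (view s₁).ne ≤ l.length * l.length := Nat.mul_le_mul i3 i3
  refine (runs_reduceProg hg hk.1 (by rw [e1, mul_assoc 2]; omega) (by omega) (by omega)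
    (i1 ▸ i2.stage h3) fun e => ?_).seq fun s₂ h =>
      runs_writeProg hk (by omega) (by omega) (by omega) h
  rw [i2.kind]
  split_ifs <;> omega

end RAM


/-- There is a program that, given any instance `I` of MinPAC on `n` vertices with `m` arcs and
feedback edge number `g ≥ 2`, produces in time `O(n + m)`, with words of
`O(log (n + m + max w))` bits, an instance `I'` with at most `20 g - 20` vertices and at most
`42 g - 42` arcs, together with a number `d` (in register `2`) such that
`opt I = opt I' + d`. -/
theorem mainTheorem1 :
    ∃ (P : RAM.Prog) (c : ℕ), ∀ (n : ℕ) (I : MinPAC (Fin n)), 2 ≤ I.feedbackEdgeNumber →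
      ∀ s : RAM.State, s.IsInput I →
        ∃ (t : ℕ) (s' : RAM.State),
          RAM.Exec ((n + I.arcs.card + I.maxWeight + 2) ^ c) P s t s' ∧
          t ≤ c * (n + I.arcs.card) ∧
          ∃ (n' : ℕ) (I' : MinPAC (Fin n')), s'.Stores I' ∧
            n' ≤ 20 * I.feedbackEdgeNumber - 20 ∧
            I'.arcs.card ≤ 42 * I.feedbackEdgeNumber - 42 ∧
            I.opt = I'.opt + s'.reg 2 := by
  -- One constant serves as time factor and as exponent of the word bound; the summand `7` takes
  -- care of the exponent.
  refine ⟨RAM.algorithm, RAM.algorithmTime + 7, fun n I hg s hs => ?_⟩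
  obtain ⟨t, r, s', h1, h2, h3, n', I', ⟨h4, l, h5, h6, h7, h8⟩, h9, h10, h11⟩ :=
    RAM.runs_algorithm hg hs (Nat.pow_le_pow_right (by omega) (Nat.le_add_left 7 _)) s
      (.refl 30 s)
  have hr : ∀ x < 30, r.reg x = s'.reg x := h3.1
  refine ⟨t, r, h1, h2.trans (Nat.mul_le_mul_right _ (by omega)), n', I', ?_, h9, h10, ?_⟩
  · refine ⟨(hr 0 (by norm_num)).trans h4, l, h5, h6, (hr 1 (by norm_num)).trans h7, ?_⟩
    rw [h3.2]
    exact h8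
  · rw [hr 2 (by norm_num), h11]
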